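/- Let $N,d\ge 1$ be integers, let $(\Omega,\mathcal G,\mathbb P)$ be a complete probability space, and order $\mathbb R_+^N=[0,\infty)^N$ coordinatewise, with $s<t$ meaning $s\le t$ and $s\ne t$, and $s\wedge t$ the coordinatewise minimum; $\|\cdot\|$ is the Euclidean norm. Let $(\mathcal F_t)_{t\in\mathbb R_+^N}$ be a commuting filtration, that is, an increasing family of sub-$\sigma$-fields of $\mathcal G$ such that $\mathcal F_0$ contains all $\mathbb P$-null sets, $\mathcal F_t=\bigcap_{s>t}\mathcal F_s$ for all $t$, and $\mathbb E[Y\mid\mathcal F_s]=\mathbb E[Y\mid\mathcal F_{s\wedge t}]$ a.s. for all $s,t$ and all bounded $\mathcal F_t$-measurable $Y$. Let $X=(X_t)_{t\in\mathbb R_+^N}$ be a continuous centered Gaussian process with values in $\mathbb R^d$, adapted to $(\mathcal F_t)$, whose coordinate processes $X^1,\dots,X^d$ are independent and have a common covariance function $\sigma(s,t)=\mathbb E[X^i_sX^i_t]$, $s,t\in(0,\infty)^N$. Put $\sigma^2(t)=\sigma(t,t)$ and $\rho(s,t)=\sigma(s,t)/(\sigma(s)\sigma(t))$. Suppose that $\alpha\in(0,1)$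 and $\gamma\ge\alpha$ satisfy $N/\alpha\ge 2$ and the following two hypotheses. (A1) For all $0<a<b<\infty$ there are positive finite constants $\delta,\varepsilon,C_1,\dots,C_5$ such that for all $s,t\in[a,b]^N$: $C_1\le\sigma^2(t)\le C_2$; if $\|t-s\|\le\delta$, then $\left|1-\frac{\sigma(s,t)}{\sigma^2(s)}\right|\le C_3\|t-s\|^{\gamma}$ and $C_4\|t-s\|^{2\alpha}\le 1-\rho^2(s,t)\le C_5\|t-s\|^{2\alpha}$; if $\|t-s\|>\delta$, then $|\rho(s,t)|<1-\varepsilon$. (A2) For all $0<a<b<\infty$ and $M>0$ there are positive finite constants $C_6,C_7,C_8$ such that for all $s,t\in[a,b]^N$ with $s\le t$: $\mathbf 1_{\{\|X_s\|\le M\}}\,\|\mathbb E[X_t-X_s\mid\mathcal F_s]\|\le C_6\|t-s\|^{\gamma}$ a.s., and $C_7\|t-s\|^{2\alpha}\le\mathbb E\big[\|(X_t-X_s)-\mathbb E[X_t-X_s\mid\mathcal F_s]\|^2\big]\le C_8\|t-s\|^{2\alpha}$. Write $\dim_{\mathcal H}$ for Hausdorff dimension and say that a random set $E\subset\mathbb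 R^d$ has stochastic codimension $\beta\in[0,d]$ if, for every compact $A\subset\mathbb R^d$, $\mathbb P\{E\cap A\ne\emptyset\}>0$ whenever $\dim_{\mathcal H}(A)>\beta$ and $\mathbb P\{E\cap A\ne\emptyset\}=0$ whenever $\dim_{\mathcal H}(A)<\beta$. Then the range $X((0,\infty)^N)=\{X_t:t\in(0,\infty)^N\}$ has a stochastic codimension, equal to $(d-N/\alpha)^+$. If moreover $d>N/\alpha$, then $$\dim_{\mathcal H}\,X((0,\infty)^N)=N/\alpha\quad\text{almost surely.}$$ -/

import Mathlib

open MeasureTheory ProbabilityTheory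
open scoped NNReal ENNReal

/-- The parameter set `ℝ₊^N`, with its coordinatewise partial order
(so `s < t` means `s ≤ t` and `s ≠ t`, and `s ⊓ t` is the coordinatewise minimum). -/
abbrev Param (N : ℕ) : Type := Fin N → ℝ≥0

/-- The Euclidean distance `‖t - s‖` of two parameters. -/
noncomputable def paramDist {N : ℕ} (s t : Param N) : ℝ :=
  Real.sqrt (∑ k, ((t k : ℝ) - (s k : ℝ)) ^ 2)

/-- The open orthant `(0, ∞)^N`. -/
def openOrthant (N : ℕ) : Set (Param N) := {t | ∀ k, 0 < t k}

/-- The cube `[a, b]^N`. -/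
def paramCube (N : ℕ) (a b : ℝ) : Set (Param N) := {t | ∀ k, a ≤ (t k : ℝ) ∧ (t k : ℝ) ≤ b}

/-- A complete, right continuous, commuting filtration indexed by `ℝ₊^N`. -/
structure IsCommutingFiltration {Ω : Type*} {m : MeasurableSpace Ω} (P : Measure Ω) {N : ℕ}
    (F : Filtration (Param N) m) : Prop where
  null_mem : ∀ A : Set Ω, P A = 0 → MeasurableSet[F 0] A
  right_continuous : ∀ t : Param N, F t = ⨅ s : Param N, ⨅ _ : t < s, F s
  commuting : ∀ (s t : Param N) (Y : Ω → ℝ), Measurable[F t] Y → (∃ C : ℝ, ∀ ω, |Y ω| ≤ C) →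
    P[Y | F s] =ᵐ[P] P[Y | F (s ⊓ t)]

/-- `X` is a continuous centered Gaussian process in `ℝ^d`, indexed by `ℝ₊^N`, whose coordinate
processes are independent and have the common covariance function `σ` on `(0, ∞)^N`. -/
structure IsCenteredGaussianField {Ω : Type*} {m : MeasurableSpace Ω} (P : Measure Ω) {N d : ℕ}
    (X : Param N → Ω → EuclideanSpace ℝ (Fin d)) (σ : Param N → Param N → ℝ) : Prop where
  gaussian : IsGaussianProcess X P
  centered : ∀ t, ∫ ω, X t ω ∂P = 0
  continuous : ∀ᵐ ω ∂P, Continuous fun t => X t ω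
  indep : iIndepFun (fun (i : Fin d) (ω : Ω) (t : Param N) => X t ω i) P
  cov : ∀ i : Fin d, ∀ s ∈ openOrthant N, ∀ t ∈ openOrthant N,
    ∫ ω, X s ω i * X t ω i ∂P = σ s t

/-- The correlation `ρ(s,t) = σ(s,t) / (σ(t) σ(s))`, where `σ(t)² = σ(t,t)`. -/
noncomputable def corr {N : ℕ} (σ : Param N → Param N → ℝ) (s t : Param N) : ℝ :=
  σ s t / (Real.sqrt (σ t t) * Real.sqrt (σ s s))

/-- The condition on the covariance function: on every cube `[a,b]^N` with `0 < a < b < ∞`,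
the variance is bounded above and away from `0`, the regression coefficient is `γ`-close to `1`,
`1 - ρ²` is comparable to `‖t - s‖^(2α)` near the diagonal, and `|ρ|` is bounded away from `1`
off the diagonal. -/
def HypA1 {N : ℕ} (σ : Param N → Param N → ℝ) (α γ : ℝ) : Prop :=
  ∀ a b : ℝ, 0 < a → a < b →
    ∃ δ ε C₁ C₂ C₃ C₄ C₅ : ℝ,
      0 < δ ∧ 0 < ε ∧ 0 < C₁ ∧ 0 < C₂ ∧ 0 < C₃ ∧ 0 < C₄ ∧ 0 < C₅ ∧
      ∀ s ∈ paramCube N a b, ∀ t ∈ paramCube N a b,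
        (C₁ ≤ σ t t ∧ σ t t ≤ C₂) ∧
        (paramDist s t ≤ δ → |1 - σ s t / σ s s| ≤ C₃ * paramDist s t ^ γ) ∧
        (paramDist s t ≤ δ →
          C₄ * paramDist s t ^ (2 * α) ≤ 1 - corr σ s t ^ 2 ∧
          1 - corr σ s t ^ 2 ≤ C₅ * paramDist s t ^ (2 * α)) ∧
        (δ < paramDist s t → |corr σ s t| < 1 - ε)

/-- The condition on the increments of `X` given the past: for `s ≤ t` in `[a,b]^N`, the
conditional mean of `X_t - X_s` given `F_s` is at most `C₆ ‖t - s‖^γ` a.s. on `{‖X_s‖ ≤ M}`, and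
the mean square error of this conditional mean is comparable to `‖t - s‖^(2α)`. -/
def HypA2 {Ω : Type*} {m : MeasurableSpace Ω} (P : Measure Ω) {N d : ℕ}
    (F : Filtration (Param N) m) (X : Param N → Ω → EuclideanSpace ℝ (Fin d)) (α γ : ℝ) : Prop :=
  ∀ a b M : ℝ, 0 < a → a < b → 0 < M →
    ∃ C₆ C₇ C₈ : ℝ, 0 < C₆ ∧ 0 < C₇ ∧ 0 < C₈ ∧
      ∀ s ∈ paramCube N a b, ∀ t ∈ paramCube N a b, s ≤ t →
        (∀ᵐ ω ∂P, ‖X s ω‖ ≤ M →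
          ‖(P[fun ω' => X t ω' - X s ω' | F s]) ω‖ ≤ C₆ * paramDist s t ^ γ) ∧
        C₇ * paramDist s t ^ (2 * α) ≤
          ∫ ω, ‖(X t ω - X s ω) - (P[fun ω' => X t ω' - X s ω' | F s]) ω‖ ^ 2 ∂P ∧
        ∫ ω, ‖(X t ω - X s ω) - (P[fun ω' => X t ω' - X s ω' | F s]) ω‖ ^ 2 ∂P ≤
          C₈ * paramDist s t ^ (2 * α)

/-- The random set `E` in `ℝ^d` has stochastic codimension `β`: `β ∈ [0, d]`, and `E` hits a compact
set `A` with positive probability if `dim_H A > β`, and with probability zero if `dim_H A < β`. -/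
def HasStochasticCodim {Ω : Type*} {m : MeasurableSpace Ω} (P : Measure Ω) {d : ℕ}
    (E : Ω → Set (EuclideanSpace ℝ (Fin d))) (β : ℝ) : Prop :=
  0 ≤ β ∧ β ≤ d ∧
    ∀ A : Set (EuclideanSpace ℝ (Fin d)), IsCompact A →
      (ENNReal.ofReal β < dimH A → 0 < P {ω | (E ω ∩ A).Nonempty}) ∧
      (dimH A < ENNReal.ofReal β → P {ω | (E ω ∩ A).Nonempty} = 0)

/-- The range `X((0, ∞)^N)`, a random set in `ℝ^d`. -/
def fieldRange {Ω : Type*} {N d : ℕ} (X : Param N → Ω → EuclideanSpace ℝ (Fin d)) (ω : Ω) :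
    Set (EuclideanSpace ℝ (Fin d)) :=
  (fun t => X t ω) '' openOrthant N

/-! An affine change of parameter reduces everything to fields on the unit cube (`UnitCubeField`).
Two facts govern such a field `Z`: the conditional variance of a coordinate of `Z_u` given that of
`Z_v` is comparable to `|u - v|^(2α)`, and the regression coefficient differs from `1` by at most a
multiple of `|u - v|^α`. Upper bounds. Gaussian moments and chaining give a modulus of every order
`η < α` along dyadic grids (`ae_dyadic_modulus`). Hence about `r^(-N/η)` grid points decide whether
`Z` meets a ball of radius `r`. Each comes that close with probability `O(r^d)`, so the ball is hit
with probability `O(r^(d - N/η))` where the modulus constant is bounded. Summing over economical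
covers, sets of zero `(d - N/η)`-dimensional measure are almost surely missed
(`measure_hit_eq_zero`). The same modulus bounds the dimension of the image by `N/η`. Hitting. If
`A` has positive `β`-dimensional measure, Frostman measures on `A` define approximate local times `J
n`, to which the second moment method applies. Its core is `exists_measure_pair_le`: `Z_u` and `Z_v`
lie within `ε` of `x` and `y` with probability at most a multiple of `(ε² / max(ε, |x - y|, |u -
v|^α))^d`. Splitting the exponent `d` as `β' + (d - β')` separates an energy of order `β' < β` in
space from a Riesz kernel of order `α(d - β') < N` in time. Near hits at every scale then have
probability bounded below, and compactness turns them into a hit (`measure_hit_pos`). Dimension from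
below. For `β < N/α < d`, Fubini and the increment estimate show that the occupation measure of a
ball of radius `r` about almost every `Z_v` is `O(r^β)`; the mass distribution principle concludes
(`ae_le_dimH_image`). -/

/-! ### Gaussian estimates on the line and for pairs -/

/-- A centered Gaussian measure of an interval of radius `ε` on which `|x| ≥ a`. -/
lemma gaussianReal_closedBall_le {v : ℝ≥0} (hv : v ≠ 0) {z ε a : ℝ} (ha : 0 ≤ a)
    (h : ∀ x ∈ Metric.closedBall z ε, a ≤ |x|) :
    gaussianReal 0 v (Metric.closedBall z ε) ≤
      ENNReal.ofReal (ε / √v * Real.exp (-a ^ 2 / (2 * v))) := by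
  have hv' : (0 : ℝ) < v := by positivity
  rw [gaussianReal_apply _ hv]
  have hb : ∀ x ∈ Metric.closedBall z ε, gaussianPDF 0 v x ≤
      ENNReal.ofReal ((2 * √v)⁻¹ * Real.exp (-a ^ 2 / (2 * v))) := by
    intro x hx
    rw [gaussianPDF, gaussianPDFReal]
    apply ENNReal.ofReal_le_ofReal
    have h1 : 2 * √v ≤ √(2 * Real.pi * v) := by
      apply Real.le_sqrt_of_sq_le
      rw [mul_pow, Real.sq_sqrt hv'.le]
      nlinarith [Real.pi_gt_three]
    have h2 : a ^ 2 ≤ x ^ 2 := by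
      rw [← sq_abs x]; exact pow_le_pow_left₀ ha (h x hx) 2
    have h3 : 0 < √(v : ℝ) := Real.sqrt_pos.2 hv'
    rw [sub_zero]
    have h4 : -x ^ 2 / (2 * v) ≤ -a ^ 2 / (2 * (v : ℝ)) := by gcongr
    gcongr
  calc ∫⁻ x in Metric.closedBall z ε, gaussianPDF 0 v x
      ≤ ∫⁻ x in Metric.closedBall z ε,
          ENNReal.ofReal ((2 * √v)⁻¹ * Real.exp (-a ^ 2 / (2 * v))) :=
        setLIntegral_mono measurable_const hb
    _ = ENNReal.ofReal ((2 * √v)⁻¹ * Real.exp (-a ^ 2 / (2 * v))) * ENNReal.ofReal (2 * ε) := by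
        rw [setLIntegral_const, Real.volume_closedBall]
    _ = _ := by
        rw [← ENNReal.ofReal_mul (by positivity)]
        congr 1
        have h3 : √(v : ℝ) ≠ 0 := (Real.sqrt_pos.2 hv').ne'
        field_simp

lemma gaussianReal_closedBall_le' {v : ℝ≥0} (hv : v ≠ 0) {z ε : ℝ} :
    gaussianReal 0 v (Metric.closedBall z ε) ≤ ENNReal.ofReal (ε / √v) := by
  simpa using gaussianReal_closedBall_le hv le_rfl (fun x _ => abs_nonneg x) (z := z)

/-- On `|x| ≤ M + 1` the density is bounded below uniformly in the variance: the prefactor is least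
at `c₂`, the exponential at `c₁`. -/
lemma le_gaussianReal_closedBall {c₁ c₂ M : ℝ} (hc₁ : 0 < c₁) (hc : c₁ ≤ c₂) (hM : 0 ≤ M) :
    ∃ c > 0, ∀ (v : ℝ≥0) (z ε : ℝ), c₁ ≤ v → (v : ℝ) ≤ c₂ → |z| ≤ M → 0 ≤ ε → ε ≤ 1 →
      ENNReal.ofReal (c * ε) ≤ gaussianReal 0 v (Metric.closedBall z ε) := by
  have hc₂ : 0 < c₂ := hc₁.trans_le hc
  refine ⟨2 * ((√(2 * Real.pi * c₂))⁻¹ * Real.exp (-(M + 1) ^ 2 / (2 * c₁))), by positivity, ?_⟩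
  intro v z ε hv1 hv2 hz hε0 hε1
  have hv' : (0 : ℝ) < v := hc₁.trans_le hv1
  have hv : v ≠ 0 := by rintro rfl; simp at hv'
  rw [gaussianReal_apply _ hv]
  have hb : ∀ x ∈ Metric.closedBall z ε,
      ENNReal.ofReal ((√(2 * Real.pi * c₂))⁻¹ * Real.exp (-(M + 1) ^ 2 / (2 * c₁))) ≤
        gaussianPDF 0 v x := by
    intro x hx
    rw [gaussianPDF, gaussianPDFReal]
    apply ENNReal.ofReal_le_ofReal
    have hx' : |x| ≤ M + 1 := by
      rw [Metric.mem_closedBall, Real.dist_eq] at hx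
      calc |x| = |(x - z) + z| := by ring_nf
        _ ≤ |x - z| + |z| := abs_add_le _ _
        _ ≤ _ := by linarith
    have h2 : x ^ 2 ≤ (M + 1) ^ 2 := by
      rw [← sq_abs x]; exact pow_le_pow_left₀ (abs_nonneg _) hx' 2
    have h3 : 0 < √(2 * Real.pi * v) := by positivity
    have h4 : x ^ 2 / (2 * v) ≤ (M + 1) ^ 2 / (2 * c₁) := by gcongr
    gcongr ?_ * Real.exp ?_
    · gcongr
    · rw [sub_zero, neg_div, neg_div]; linarith
  calc ENNReal.ofReal (2 * ((√(2 * Real.pi * c₂))⁻¹ * Real.exp (-(M + 1) ^ 2 / (2 * c₁))) * ε)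
      = ENNReal.ofReal ((√(2 * Real.pi * c₂))⁻¹ * Real.exp (-(M + 1) ^ 2 / (2 * c₁)))
          * ENNReal.ofReal (2 * ε) := by
        rw [← ENNReal.ofReal_mul (by positivity)]; congr 1; ring
    _ = ∫⁻ x in Metric.closedBall z ε,
          ENNReal.ofReal ((√(2 * Real.pi * c₂))⁻¹ * Real.exp (-(M + 1) ^ 2 / (2 * c₁))) := by
        rw [setLIntegral_const, Real.volume_closedBall]
    _ ≤ _ := setLIntegral_mono' Metric.isClosed_closedBall.measurableSet hb

/-- Scaling reduces this to the standard Gaussian; adding `1` to its moment merely makes the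
constant visibly positive. -/
lemma lintegral_enorm_pow_gaussianReal (p : ℕ) :
    ∃ C : ℝ, 0 < C ∧ ∀ v : ℝ≥0, ∫⁻ x, ‖x‖ₑ ^ p ∂(gaussianReal 0 v) ≤ ENNReal.ofReal (C * √v ^ p) := by
  have hfin : ∫⁻ x, ‖x‖ₑ ^ p ∂(gaussianReal 0 1) ≠ ∞ := by
    have h := (memLp_id_gaussianReal (μ := 0) (v := 1) (p : ℝ≥0)).eLpNorm_lt_top
    by_cases hp : p = 0
    · simp [hp]
    · have := (eLpNorm_lt_top_iff_lintegral_rpow_enorm_lt_top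
        (by simpa using hp) (by simp)).1 h
      simpa using this.ne
  refine ⟨(∫⁻ x, ‖x‖ₑ ^ p ∂(gaussianReal 0 1)).toReal + 1, by positivity, fun v => ?_⟩
  have hmap : gaussianReal 0 v = (gaussianReal 0 1).map (√v * ·) := by
    rw [gaussianReal_map_const_mul]
    congr 1
    · simp
    · ext; simp
  rw [hmap, lintegral_map (by fun_prop) (by fun_prop)]
  simp_rw [enorm_mul, mul_pow]
  rw [lintegral_const_mul _ (by fun_prop), mul_comm, ENNReal.ofReal_mul (by positivity),
    ENNReal.ofReal_add (by positivity) (by positivity), ENNReal.ofReal_toReal hfin,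
    ENNReal.ofReal_pow (by positivity), Real.enorm_eq_ofReal (by positivity)]
  gcongr
  exact le_self_add

section Pair

variable {Ω : Type*} {m : MeasurableSpace Ω} {P : Measure Ω}

lemma map_eq_gaussianReal_of_centered {U : Ω → ℝ} (hU : HasGaussianLaw U P)
    (h0 : ∫ ω, U ω ∂P = 0) : P.map U = gaussianReal 0 (∫ ω, U ω * U ω ∂P).toNNReal := by
  rw [hU.map_eq_gaussianReal, h0, variance_of_integral_eq_zero hU.aemeasurable h0]
  simp_rw [pow_two]

/-- Small ball estimate for a pair of centered, jointly Gaussian variables, obtained by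
regressing the first on the second. -/
lemma measure_pair_le [IsProbabilityMeasure P] {U V : Ω → ℝ}
    (hUV : HasGaussianLaw (fun ω => (U ω, V ω)) P) (hU : Measurable U) (hV : Measurable V)
    (hU0 : ∫ ω, U ω ∂P = 0) (hV0 : ∫ ω, V ω ∂P = 0)
    {a b c : ℝ} (haa : ∫ ω, U ω * U ω ∂P = a) (hbb : ∫ ω, V ω * V ω ∂P = b)
    (hcc : ∫ ω, U ω * V ω ∂P = c) (hb : 0 < b) (hw : 0 < a - c ^ 2 / b)
    {x y ε τ : ℝ} (hε : 0 ≤ ε) (hτ : 0 ≤ τ)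
    (h : ∀ y', |y' - y| ≤ ε → τ + ε ≤ |x - c / b * y'| ∨ τ = 0) :
    P {ω | |U ω - x| ≤ ε ∧ |V ω - y| ≤ ε} ≤
      ENNReal.ofReal (ε / √b * (ε / √(a - c ^ 2 / b) *
        Real.exp (-τ ^ 2 / (2 * (a - c ^ 2 / b))))) := by
  set w := a - c ^ 2 / b with hwdef
  -- The regression residual is uncorrelated with `V`, hence independent of it by joint Gaussianity,
  -- and has variance `w`.
  set Z : Ω → ℝ := fun ω => U ω - c / b * V ω with hZdef
  have hZV : HasGaussianLaw (fun ω => (Z ω, V ω)) P := by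
    have := hUV.map ((ContinuousLinearMap.fst ℝ ℝ ℝ - (c / b) • ContinuousLinearMap.snd ℝ ℝ ℝ).prod
      (ContinuousLinearMap.snd ℝ ℝ ℝ))
    exact this
  have hUm := hUV.fst.memLp_two
  have hVm := hUV.snd.memLp_two
  have hZ0 : ∫ ω, Z ω ∂P = 0 := by
    rw [hZdef, integral_sub hUV.fst.integrable (hUV.snd.integrable.const_mul _),
      integral_const_mul, hU0, hV0]; simp
  have iUU : Integrable (fun ω => U ω * U ω) P := hUm.integrable_mul hUm
  have iVV : Integrable (fun ω => V ω * V ω) P := hVm.integrable_mul hVm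
  have iUV : Integrable (fun ω => U ω * V ω) P := hUm.integrable_mul hVm
  have hZVint : ∫ ω, Z ω * V ω ∂P = 0 := by
    have : (fun ω => Z ω * V ω) = fun ω => U ω * V ω - c / b * (V ω * V ω) := by
      ext ω; simp only [hZdef]; ring
    rw [this, integral_sub iUV (iVV.const_mul _), integral_const_mul, hcc, hbb]
    field_simp; ring
  have hZZ : ∫ ω, Z ω * Z ω ∂P = w := by
    have : (fun ω => Z ω * Z ω) = fun ω => U ω * U ω - (2 * (c / b)) * (U ω * V ω)
        + (c / b) ^ 2 * (V ω * V ω) := by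
      ext ω; simp only [hZdef]; ring
    rw [this, integral_add (by exact iUU.sub (iUV.const_mul _)) (iVV.const_mul _),
      integral_sub iUU (iUV.const_mul _), integral_const_mul, integral_const_mul, haa, hbb, hcc,
      hwdef]
    field_simp; ring
  have hind : IndepFun Z V P := by
    apply hZV.indepFun_of_covariance_eq_zero
    rw [covariance_eq_sub hZV.fst.memLp_two hVm, hZ0, hV0]
    simpa using hZVint
  have hZmeas : Measurable Z := by fun_prop
  have hlawZ := map_eq_gaussianReal_of_centered hZV.fst hZ0
  have hlawV := map_eq_gaussianReal_of_centered hUV.snd hV0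
  rw [hZZ] at hlawZ
  rw [hbb] at hlawV
  have hjoint := (indepFun_iff_map_prod_eq_prod_map_map hZmeas.aemeasurable hV.aemeasurable).1 hind
  set S : Set (ℝ × ℝ) := {q | |q.1 + c / b * q.2 - x| ≤ ε ∧ |q.2 - y| ≤ ε} with hS
  have hSm : MeasurableSet S := by
    apply MeasurableSet.inter
    · exact measurableSet_le (f := fun q : ℝ × ℝ => |q.1 + c / b * q.2 - x|) (by fun_prop)
        measurable_const
    · exact measurableSet_le (f := fun q : ℝ × ℝ => |q.2 - y|) (by fun_prop) measurable_const
  have hset : {ω | |U ω - x| ≤ ε ∧ |V ω - y| ≤ ε} = (fun ω => (Z ω, V ω)) ⁻¹' S := by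
    ext ω; simp [hS, hZdef]
  rw [hset, ← Measure.map_apply (hZmeas.prodMk hV) hSm, hjoint,
    Measure.prod_apply_symm hSm]
  have hw' : w.toNNReal ≠ 0 := by simpa using hw
  have hb' : b.toNNReal ≠ 0 := by simpa using hb
  -- For a fixed value `y'` of `V`, the residual must lie in an interval of radius `ε` about `x -
  -- (c/b) y'`, all of whose points have modulus at least `τ`.
  have hslice : ∀ y', P.map Z ((fun z => (z, y')) ⁻¹' S) ≤
      (Metric.closedBall y ε).indicator
        (fun _ => ENNReal.ofReal (ε / √w * Real.exp (-τ ^ 2 / (2 * w)))) y' := by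
    intro y'
    by_cases hy : |y' - y| ≤ ε
    · rw [Set.indicator_of_mem (by rwa [Metric.mem_closedBall, Real.dist_eq])]
      have : (fun z => (z, y')) ⁻¹' S = Metric.closedBall (x - c / b * y') ε := by
        ext z
        simp only [hS, Set.mem_preimage, Set.mem_ofPred_eq, hy, and_true, Metric.mem_closedBall,
          Real.dist_eq]
        rw [show z - (x - c / b * y') = z + c / b * y' - x by ring]
      rw [this, hlawZ]
      have hb0 := gaussianReal_closedBall_le hw' hτ (z := x - c / b * y') (ε := ε) ?_
      · simpa [Real.coe_toNNReal _ hw.le] using hb0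
      · intro z hz
        rcases h y' hy with h1 | h1
        · rw [Metric.mem_closedBall, Real.dist_eq] at hz
          have : |x - c / b * y'| ≤ |z| + |z - (x - c / b * y')| := by
            calc |x - c / b * y'| = |z - (z - (x - c / b * y'))| := by ring_nf
              _ ≤ _ := abs_sub _ _
          linarith
        · rw [h1]; exact abs_nonneg _
    · have : (fun z => (z, y')) ⁻¹' S = ∅ := by
        ext z; simp [hS, hy]
      rw [this]; simp
  calc ∫⁻ y', P.map Z ((fun z => (z, y')) ⁻¹' S) ∂(P.map V)
      ≤ ∫⁻ y', (Metric.closedBall y ε).indicator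
        (fun _ => ENNReal.ofReal (ε / √w * Real.exp (-τ ^ 2 / (2 * w)))) y' ∂(P.map V) :=
        lintegral_mono hslice
    _ = ENNReal.ofReal (ε / √w * Real.exp (-τ ^ 2 / (2 * w))) * P.map V (Metric.closedBall y ε) := by
        rw [lintegral_indicator_const Metric.isClosed_closedBall.measurableSet]
    _ ≤ ENNReal.ofReal (ε / √w * Real.exp (-τ ^ 2 / (2 * w))) * ENNReal.ofReal (ε / √b) := by
        gcongr
        rw [hlawV]
        simpa [Real.coe_toNNReal _ hb.le] using gaussianReal_closedBall_le' hb' (z := y)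
    _ = _ := by rw [← ENNReal.ofReal_mul (by positivity), mul_comm]

end Pair

/-! ### Covariance bounds on cubes and rescaling of the parameter -/

section Covariance

variable {N : ℕ}

lemma paramDist_comm (s t : Param N) : paramDist s t = paramDist t s := by
  unfold paramDist
  congr 1
  exact Finset.sum_congr rfl fun k _ => by ring

lemma paramDist_nonneg (s t : Param N) : 0 ≤ paramDist s t := Real.sqrt_nonneg _

lemma paramCube_subset_openOrthant {a b : ℝ} (ha : 0 < a) : paramCube N a b ⊆ openOrthant N :=
  fun _ ht k => NNReal.coe_pos.1 (ha.trans_le (ht k).1)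

lemma paramDist_le_of_mem_cube {a b : ℝ} {s t : Param N}
    (hs : s ∈ paramCube N a b) (ht : t ∈ paramCube N a b) :
    paramDist s t ≤ √(N * (b - a) ^ 2) := by
  apply Real.sqrt_le_sqrt
  calc ∑ k, ((t k : ℝ) - (s k : ℝ)) ^ 2 ≤ ∑ _k : Fin N, (b - a) ^ 2 := by
        apply Finset.sum_le_sum
        intro k _
        apply sq_le_sq'
        · linarith [(hs k).1, (hs k).2, (ht k).1, (ht k).2]
        · linarith [(hs k).1, (hs k).2, (ht k).1, (ht k).2]
    _ = _ := by simp

/-- Consequences of the covariance condition on a cube: comparison of the conditional variance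
and of the regression coefficient with powers of the distance, without a locality restriction. -/
lemma HypA1.exists_bounds {σ : Param N → Param N → ℝ} {α γ : ℝ} (hA1 : HypA1 σ α γ)
    (hα0 : 0 < α) (hγ : α ≤ γ)
    (hsymm : ∀ s ∈ openOrthant N, ∀ t ∈ openOrthant N, σ s t = σ t s)
    {a b : ℝ} (ha : 0 < a) (hab : a < b) :
    ∃ c C : ℝ, 0 < c ∧ 0 < C ∧ ∀ s ∈ paramCube N a b, ∀ t ∈ paramCube N a b,
      c ≤ σ t t ∧ σ t t ≤ C ∧
      c * paramDist s t ^ (2 * α) ≤ σ s s - σ s t ^ 2 / σ t t ∧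
      σ s s - σ s t ^ 2 / σ t t ≤ C * paramDist s t ^ (2 * α) ∧
      |1 - σ s t / σ t t| ≤ C * paramDist s t ^ α := by
  obtain ⟨δ, ε, C₁, C₂, C₃, C₄, C₅, hδ, hε, h1, h2, h3, h4, h5, H⟩ := hA1 a b ha hab
  -- `R` exceeds the diameter of the cube. Beyond distance `δ` every power of the distance lies
  -- between constants, so the far regime can be absorbed into the local one.
  set R : ℝ := √(N * (b - a) ^ 2) + 1 with hR
  have hR1 : 1 ≤ R := by rw [hR]; linarith [Real.sqrt_nonneg (N * (b - a) ^ 2)]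
  have hR0 : 0 < R := by linarith
  refine ⟨min C₁ (min (C₁ * C₄) (C₁ * ε * (R ^ (2 * α))⁻¹)),
    C₂ + (C₂ * C₅ + C₂ * (δ ^ (2 * α))⁻¹) + (C₃ * R ^ (γ - α) + (1 + C₂ / C₁) * (δ ^ α)⁻¹),
    by positivity, by positivity, ?_⟩
  intro s hs t ht
  obtain ⟨⟨ht1, ht2⟩, -, hnear, hfar⟩ := H s hs t ht
  -- The points are swapped because the regression here is on the variable at `t`, whose variance is
  -- the denominator; symmetry of `σ` then restores the order of its arguments.
  obtain ⟨⟨hs1, hs2⟩, hreg, -, -⟩ := H t ht s hs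
  rw [paramDist_comm t s, ← hsymm s (paramCube_subset_openOrthant ha hs) t
    (paramCube_subset_openOrthant ha ht)] at hreg
  set D := paramDist s t with hD
  have hD0 : 0 ≤ D := paramDist_nonneg s t
  have hDR : D ≤ R := (paramDist_le_of_mem_cube hs ht).trans (by rw [hR]; linarith)
  have htt : 0 < σ t t := h1.trans_le ht1
  have hss : 0 < σ s s := h1.trans_le hs1
  have hcorr : corr σ s t ^ 2 = σ s t ^ 2 / (σ t t * σ s s) := by
    rw [corr, div_pow, mul_pow, Real.sq_sqrt htt.le, Real.sq_sqrt hss.le]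
  have hw : σ s s - σ s t ^ 2 / σ t t = σ s s * (1 - corr σ s t ^ 2) := by
    rw [hcorr]; field_simp
  have hDα : 0 ≤ D ^ α := Real.rpow_nonneg hD0 _
  have hD2α : 0 ≤ D ^ (2 * α) := Real.rpow_nonneg hD0 _
  have hp1 : 0 ≤ C₂ * C₅ := by positivity
  have hp2 : 0 ≤ C₂ * (δ ^ (2 * α))⁻¹ := by positivity
  have hp3 : 0 ≤ C₃ * R ^ (γ - α) := by positivity
  have hp4 : 0 ≤ (1 + C₂ / C₁) * (δ ^ α)⁻¹ := by positivity
  refine ⟨(min_le_left _ _).trans ht1, by linarith, ?_⟩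
  rw [hw]
  by_cases hDδ : D ≤ δ
  · obtain ⟨hn1, hn2⟩ := hnear hDδ
    refine ⟨?_, ?_, ?_⟩
    · calc _ ≤ (C₁ * C₄) * D ^ (2 * α) := by
            gcongr; exact (min_le_right _ _).trans (min_le_left _ _)
        _ = C₁ * (C₄ * D ^ (2 * α)) := by ring
        _ ≤ _ := by gcongr
    · calc _ ≤ C₂ * (C₅ * D ^ (2 * α)) := by
            apply mul_le_mul hs2 hn2 _ h2.le
            exact le_trans (by positivity) hn1
        _ = (C₂ * C₅) * D ^ (2 * α) := by ring
        _ ≤ _ := by gcongr; linarith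
    · calc _ ≤ C₃ * D ^ γ := hreg hDδ
        _ = C₃ * (D ^ (γ - α) * D ^ α) := by
            rw [← Real.rpow_add_of_nonneg hD0 (by linarith) hα0.le]; ring_nf
        _ ≤ C₃ * (R ^ (γ - α) * D ^ α) := by
            have : D ^ (γ - α) ≤ R ^ (γ - α) := Real.rpow_le_rpow hD0 hDR (by linarith)
            gcongr
        _ = (C₃ * R ^ (γ - α)) * D ^ α := by ring
        _ ≤ _ := by gcongr; linarith
  · push Not at hDδ
    have hf := hfar hDδ
    have hε1 : 0 < 1 - ε := (abs_nonneg _).trans_lt hf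
    have hsq : corr σ s t ^ 2 ≤ 1 - ε := by
      rw [← sq_abs]
      calc |corr σ s t| ^ 2 ≤ (1 - ε) ^ 2 := pow_le_pow_left₀ (abs_nonneg _) hf.le 2
        _ ≤ 1 - ε := by nlinarith
    have hD' : 0 < D := hδ.trans hDδ
    have e1 : 1 ≤ (δ ^ (2 * α))⁻¹ * D ^ (2 * α) := by
      rw [inv_mul_eq_div, one_le_div (by positivity)]
      exact Real.rpow_le_rpow hδ.le hDδ.le (by linarith)
    have e2 : 1 ≤ (δ ^ α)⁻¹ * D ^ α := by
      rw [inv_mul_eq_div, one_le_div (by positivity)]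
      exact Real.rpow_le_rpow hδ.le hDδ.le (by linarith)
    have e3 : (R ^ (2 * α))⁻¹ * D ^ (2 * α) ≤ 1 := by
      rw [inv_mul_eq_div, div_le_one (by positivity)]
      exact Real.rpow_le_rpow hD0 hDR (by linarith)
    refine ⟨?_, ?_, ?_⟩
    · calc _ ≤ (C₁ * ε * (R ^ (2 * α))⁻¹) * D ^ (2 * α) := by
            gcongr; exact (min_le_right _ _).trans (min_le_right _ _)
        _ = C₁ * ε * ((R ^ (2 * α))⁻¹ * D ^ (2 * α)) := by ring
        _ ≤ C₁ * ε * 1 := by gcongr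
        _ ≤ _ := by rw [mul_one]; gcongr; linarith
    · calc _ ≤ C₂ * 1 := by
            apply mul_le_mul hs2 _ _ h2.le
            · linarith [sq_nonneg (corr σ s t)]
            · linarith
        _ ≤ C₂ * ((δ ^ (2 * α))⁻¹ * D ^ (2 * α)) := by gcongr
        _ = (C₂ * (δ ^ (2 * α))⁻¹) * D ^ (2 * α) := by ring
        _ ≤ _ := by gcongr; linarith
    · have hst : |σ s t| ≤ C₂ := by
        apply abs_le_of_sq_le_sq _ h2.le
        have : σ s t ^ 2 / (σ t t * σ s s) ≤ 1 := by rw [← hcorr]; linarith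
        rw [div_le_one (by positivity)] at this
        nlinarith
      calc |1 - σ s t / σ t t| ≤ |(1 : ℝ)| + |σ s t / σ t t| := abs_sub _ _
        _ ≤ 1 + C₂ / C₁ := by
            rw [abs_one, abs_div, abs_of_pos htt]; gcongr
        _ = (1 + C₂ / C₁) * 1 := by ring
        _ ≤ (1 + C₂ / C₁) * ((δ ^ α)⁻¹ * D ^ α) := by gcongr
        _ = ((1 + C₂ / C₁) * (δ ^ α)⁻¹) * D ^ α := by ring
        _ ≤ _ := by gcongr; linarith

/-- The affine parametrization of the cube `[a, a + L]^N` by the unit cube. -/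
noncomputable def cubeParam (a L : ℝ) (u : Fin N → ℝ) : Param N := fun k => (a + L * u k).toNNReal

lemma continuous_cubeParam (a L : ℝ) : Continuous (cubeParam a L : (Fin N → ℝ) → Param N) := by
  unfold cubeParam
  fun_prop

lemma coe_cubeParam {a L : ℝ} (ha : 0 < a) (hL : 0 < L) {u : Fin N → ℝ} (hu : u ∈ Set.Icc 0 1)
    (k : Fin N) : (cubeParam a L u k : ℝ) = a + L * u k := by
  have := hu.1 k
  simp only [Pi.zero_apply] at this
  exact Real.coe_toNNReal _ (by positivity)

lemma cubeParam_mem {a L : ℝ} (ha : 0 < a) (hL : 0 < L) {u : Fin N → ℝ} (hu : u ∈ Set.Icc 0 1) :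
    cubeParam a L u ∈ paramCube N a (a + L) := by
  intro k
  rw [coe_cubeParam ha hL hu]
  have h0 := hu.1 k
  have h1 := hu.2 k
  simp only [Pi.zero_apply, Pi.one_apply] at h0 h1
  constructor <;> nlinarith

/-- The distance on `Fin N → ℝ` is the sup distance; comparing it with the Euclidean one costs the
factor `√N`. -/
lemma paramDist_cubeParam {a L : ℝ} (ha : 0 < a) (hL : 0 < L) {u v : Fin N → ℝ}
    (hu : u ∈ Set.Icc 0 1) (hv : v ∈ Set.Icc 0 1) :
    L * dist u v ≤ paramDist (cubeParam a L u) (cubeParam a L v) ∧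
      paramDist (cubeParam a L u) (cubeParam a L v) ≤ L * √N * dist u v := by
  have hk : ∀ k, ((cubeParam a L v k : ℝ) - cubeParam a L u k) ^ 2 = L ^ 2 * dist (u k) (v k) ^ 2 := by
    intro k
    rw [coe_cubeParam ha hL hu, coe_cubeParam ha hL hv, Real.dist_eq, sq_abs]; ring
  unfold paramDist
  simp_rw [hk]
  constructor
  · rcases isEmpty_or_nonempty (Fin N) with hN | hN
    · have : dist u v = 0 := by rw [Subsingleton.elim u v, dist_self]
      rw [this, mul_zero]; exact Real.sqrt_nonneg _
    · rw [← le_div_iff₀' hL]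
      refine (dist_pi_le_iff (by positivity)).2 fun k => ?_
      rw [le_div_iff₀' hL]
      apply Real.le_sqrt_of_sq_le
      rw [mul_pow]
      exact Finset.single_le_sum (f := fun k => L ^ 2 * dist (u k) (v k) ^ 2)
        (fun i _ => by positivity) (Finset.mem_univ k)
  · apply Real.sqrt_le_iff.2
    refine ⟨by positivity, ?_⟩
    calc ∑ k, L ^ 2 * dist (u k) (v k) ^ 2 ≤ ∑ _k : Fin N, L ^ 2 * dist u v ^ 2 := by
          gcongr with k _
          exact dist_le_pi_dist u v k
      _ = _ := by
          simp only [Finset.sum_const, Finset.card_univ, Fintype.card_fin, nsmul_eq_mul]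
          rw [mul_pow, mul_pow, Real.sq_sqrt (by positivity)]; ring

end Covariance

/-! ### Fields on the unit cube: small balls and moments -/

/-- A centered Gaussian field on the unit cube with independent, identically distributed
coordinates, whose covariance `κ` has conditional variances and regression coefficients
controlled by the distance to the power `α`. -/
structure UnitCubeField {Ω : Type*} {m : MeasurableSpace Ω} (P : Measure Ω) {N d : ℕ}
    (Z : (Fin N → ℝ) → Ω → EuclideanSpace ℝ (Fin d)) (κ : (Fin N → ℝ) → (Fin N → ℝ) → ℝ)
    (α c C : ℝ) : Prop where
  c_pos : 0 < c
  C_pos : 0 < C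
  α_pos : 0 < α
  measurable : ∀ u, Measurable (Z u)
  continuous : ∀ᵐ ω ∂P, Continuous fun u => Z u ω
  indep : iIndepFun (fun (i : Fin d) (ω : Ω) (u : Fin N → ℝ) => Z u ω i) P
  gaussian : ∀ u v, HasGaussianLaw (fun ω => (Z u ω, Z v ω)) P
  mean : ∀ u i, ∫ ω, Z u ω i ∂P = 0
  cov : ∀ i, ∀ u ∈ Set.Icc 0 1, ∀ v ∈ Set.Icc 0 1, ∫ ω, Z u ω i * Z v ω i ∂P = κ u v
  le_var : ∀ u ∈ Set.Icc 0 1, c ≤ κ u u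
  var_le : ∀ u ∈ Set.Icc 0 1, κ u u ≤ C
  le_condVar : ∀ u ∈ Set.Icc 0 1, ∀ v ∈ Set.Icc 0 1,
    c * (dist u v ^ α) ^ 2 ≤ κ u u - κ u v ^ 2 / κ v v
  condVar_le : ∀ u ∈ Set.Icc 0 1, ∀ v ∈ Set.Icc 0 1,
    κ u u - κ u v ^ 2 / κ v v ≤ C * (dist u v ^ α) ^ 2
  regression : ∀ u ∈ Set.Icc 0 1, ∀ v ∈ Set.Icc 0 1, |1 - κ u v / κ v v| ≤ C * dist u v ^ α

/-- Positivity of `d` supplies a coordinate from which the symmetry of `σ` is read off. Since `α ≤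
γ`, the regression bound of order `γ` is weakened to order `α`, the only exponent that matters from
here on. -/
lemma UnitCubeField.of_field {Ω : Type*} {m : MeasurableSpace Ω} {P : Measure Ω} {N d : ℕ}
    (hd : 0 < d) {F : Filtration (Param N) m}
    {X : Param N → Ω → EuclideanSpace ℝ (Fin d)} {σ : Param N → Param N → ℝ}
    (hX : IsCenteredGaussianField P X σ) (hadapted : Adapted F X)
    {α γ : ℝ} (hα0 : 0 < α) (hγ : α ≤ γ) (hA1 : HypA1 σ α γ) {a L : ℝ} (ha : 0 < a) (hL : 0 < L) :
    ∃ c C : ℝ, UnitCubeField P (fun u => X (cubeParam a L u))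
      (fun u v => σ (cubeParam a L u) (cubeParam a L v)) α c C := by
  have hsymm : ∀ s ∈ openOrthant N, ∀ t ∈ openOrthant N, σ s t = σ t s := by
    intro s hs t ht
    rw [← hX.cov ⟨0, hd⟩ s hs t ht, ← hX.cov ⟨0, hd⟩ t ht s hs]
    simp_rw [mul_comm]
  obtain ⟨c, C, hc, hC, H⟩ := hA1.exists_bounds hα0 hγ hsymm ha (by linarith : a < a + L)
  have hmem : ∀ u ∈ Set.Icc (0 : Fin N → ℝ) 1, cubeParam a L u ∈ paramCube N a (a + L) :=
    fun u hu => cubeParam_mem ha hL hu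
  have hpow : ∀ x : ℝ, 0 ≤ x → x ^ (2 * α) = (x ^ α) ^ 2 := fun x hx => by
    rw [mul_comm, Real.rpow_mul hx, Real.rpow_two]
  set B := C * ((L * √N) ^ α) ^ 2 + C * (L * √N) ^ α with hB
  have hB1 : 0 ≤ C * ((L * √N) ^ α) ^ 2 := by positivity
  have hB2 : 0 ≤ C * (L * √N) ^ α := by positivity
  refine ⟨min c (c * (L ^ α) ^ 2), C + B, by positivity, by positivity, hα0, ?_, ?_, ?_, ?_, ?_, ?_,
    ?_, ?_, ?_, ?_, ?_⟩
  · exact fun u => (hadapted _).mono (F.le _) le_rfl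
  · filter_upwards [hX.continuous] with ω hω
    exact hω.comp (continuous_cubeParam a L)
  · have hg : ∀ i : Fin d, Measurable (fun (f : Param N → ℝ) (u : Fin N → ℝ) => f (cubeParam a L u)) :=
      fun _ => measurable_pi_lambda _ fun u => measurable_pi_apply _
    exact hX.indep.comp _ hg
  · exact fun u v => hX.gaussian.hasGaussianLaw_prodMk
  · intro u i
    have hint := (hX.gaussian.hasGaussianLaw_eval (cubeParam a L u)).integrable
    have := (EuclideanSpace.proj i : EuclideanSpace ℝ (Fin d) →L[ℝ] ℝ).integral_comp_comm hint
    simpa [hX.centered] using this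
  · intro i u hu v hv
    exact hX.cov i _ (paramCube_subset_openOrthant ha (hmem u hu)) _
      (paramCube_subset_openOrthant ha (hmem v hv))
  · intro u hu
    exact (min_le_left _ _).trans (H _ (hmem u hu) _ (hmem u hu)).1
  · intro u hu
    linarith [(H _ (hmem u hu) _ (hmem u hu)).2.1]
  · intro u hu v hv
    refine le_trans ?_ (H _ (hmem u hu) _ (hmem v hv)).2.2.1
    rw [hpow _ (paramDist_nonneg _ _)]
    calc _ ≤ c * (L ^ α) ^ 2 * (dist u v ^ α) ^ 2 := by gcongr; exact min_le_right _ _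
      _ = c * ((L * dist u v) ^ α) ^ 2 := by
          rw [Real.mul_rpow hL.le dist_nonneg]; ring
      _ ≤ _ := by
          gcongr
          exact (paramDist_cubeParam ha hL hu hv).1
  · intro u hu v hv
    refine (H _ (hmem u hu) _ (hmem v hv)).2.2.2.1.trans ?_
    rw [hpow _ (paramDist_nonneg _ _)]
    calc _ ≤ C * ((L * √N * dist u v) ^ α) ^ 2 := by
          gcongr
          · exact Real.rpow_nonneg (paramDist_nonneg _ _) _
          · exact paramDist_nonneg _ _
          · exact (paramDist_cubeParam ha hL hu hv).2
      _ = C * ((L * √N) ^ α) ^ 2 * (dist u v ^ α) ^ 2 := by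
          rw [Real.mul_rpow (by positivity) dist_nonneg]; ring
      _ ≤ _ := by gcongr; linarith
  · intro u hu v hv
    refine (H _ (hmem u hu) _ (hmem v hv)).2.2.2.2.trans ?_
    calc _ ≤ C * (L * √N * dist u v) ^ α := by
          gcongr
          · exact paramDist_nonneg _ _
          · exact (paramDist_cubeParam ha hL hu hv).2
      _ = C * (L * √N) ^ α * dist u v ^ α := by
          rw [Real.mul_rpow (by positivity) dist_nonneg]; ring
      _ ≤ _ := by gcongr; linarith

/-- Combine `q ^ n ≤ n! * exp q` with `q - q ^ 2 / 2 ≤ 1`. This trades a Gaussian tail for any power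
of the distance. -/
lemma Real.pow_mul_exp_neg_sq_le (n : ℕ) {q : ℝ} (hq : 0 ≤ q) :
    q ^ n * Real.exp (-q ^ 2 / 2) ≤ n.factorial * Real.exp 1 := by
  have h1 : q ^ n ≤ n.factorial * Real.exp q := by
    have := Real.pow_div_factorial_le_exp q hq n
    rwa [div_le_iff₀' (by positivity)] at this
  calc q ^ n * Real.exp (-q ^ 2 / 2) ≤ n.factorial * Real.exp q * Real.exp (-q ^ 2 / 2) := by gcongr
    _ = n.factorial * Real.exp (q + -q ^ 2 / 2) := by rw [mul_assoc, ← Real.exp_add]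
    _ ≤ _ := by
        gcongr
        nlinarith [sq_nonneg (q - 1)]

namespace UnitCubeField

variable {Ω : Type*} {m : MeasurableSpace Ω} {P : Measure Ω} {N d : ℕ}
  {Z : (Fin N → ℝ) → Ω → EuclideanSpace ℝ (Fin d)} {κ : (Fin N → ℝ) → (Fin N → ℝ) → ℝ}
  {α c C : ℝ}

lemma measurable_coord (hZ : UnitCubeField P Z κ α c C) (u : Fin N → ℝ) (i : Fin d) :
    Measurable fun ω => Z u ω i :=
  (EuclideanSpace.proj i : EuclideanSpace ℝ (Fin d) →L[ℝ] ℝ).measurable.comp (hZ.measurable u)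

lemma gaussian_coord (hZ : UnitCubeField P Z κ α c C) (u v : Fin N → ℝ) (i : Fin d) :
    HasGaussianLaw (fun ω => (Z u ω i, Z v ω i)) P := by
  have h := (hZ.gaussian u v).map
    (((EuclideanSpace.proj i : EuclideanSpace ℝ (Fin d) →L[ℝ] ℝ).comp
      (ContinuousLinearMap.fst ℝ _ _)).prod
      ((EuclideanSpace.proj i : EuclideanSpace ℝ (Fin d) →L[ℝ] ℝ).comp
      (ContinuousLinearMap.snd ℝ _ _)))
  exact h

/-- Independence of the coordinate processes makes box events factor, so `d`-dimensional small ball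
bounds reduce to scalar ones. -/
lemma measure_iInter_coord (hZ : UnitCubeField P Z κ α c C) (u v : Fin N → ℝ)
    {S : Fin d → Set (ℝ × ℝ)} (hS : ∀ i, MeasurableSet (S i)) :
    P (⋂ i, {ω | (Z u ω i, Z v ω i) ∈ S i}) = ∏ i, P {ω | (Z u ω i, Z v ω i) ∈ S i} := by
  have h := hZ.indep.comp (fun (_ : Fin d) (f : (Fin N → ℝ) → ℝ) => (f u, f v))
    (fun _ => (measurable_pi_apply u).prodMk (measurable_pi_apply v))
  have := h.measure_inter_preimage_eq_mul Finset.univ (sets := S) (fun i _ => hS i)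
  simpa [Set.preimage, Function.comp_def] using this

lemma var_pos (hZ : UnitCubeField P Z κ α c C) {u : Fin N → ℝ} (hu : u ∈ Set.Icc 0 1) :
    0 < κ u u := hZ.c_pos.trans_le (hZ.le_var u hu)

lemma measurable_sub_coord (hZ : UnitCubeField P Z κ α c C) (u v : Fin N → ℝ) (i : Fin d) :
    Measurable fun ω => Z u ω i - Z v ω i :=
  (hZ.measurable_coord u i).sub (hZ.measurable_coord v i)

lemma map_coord (hZ : UnitCubeField P Z κ α c C) {u : Fin N → ℝ} (hu : u ∈ Set.Icc 0 1)
    (i : Fin d) : P.map (fun ω => Z u ω i) = gaussianReal 0 (κ u u).toNNReal := by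
  rw [map_eq_gaussianReal_of_centered (hZ.gaussian_coord u u i).fst (hZ.mean u i),
    hZ.cov i u hu u hu]

/-- The variance is displayed along the orthogonal decomposition of the increment into the
regression residual and `(κ u v / κ v v - 1)` times the coordinate of `Z v`. -/
lemma map_sub_coord (hZ : UnitCubeField P Z κ α c C) {u v : Fin N → ℝ} (hu : u ∈ Set.Icc 0 1)
    (hv : v ∈ Set.Icc 0 1) (i : Fin d) :
    P.map (fun ω => Z u ω i - Z v ω i) =
      gaussianReal 0 (κ u u - κ u v ^ 2 / κ v v + (1 - κ u v / κ v v) ^ 2 * κ v v).toNNReal := by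
  have hg := hZ.gaussian_coord u v i
  have h1 := hg.fst.memLp_two
  have h2 := hg.snd.memLp_two
  have iuu : Integrable (fun ω => Z u ω i * Z u ω i) P := h1.integrable_mul h1
  have ivv : Integrable (fun ω => Z v ω i * Z v ω i) P := h2.integrable_mul h2
  have iuv : Integrable (fun ω => Z u ω i * Z v ω i) P := h1.integrable_mul h2
  rw [map_eq_gaussianReal_of_centered hg.fun_sub]
  · congr 2
    have : (fun ω => (Z u ω i - Z v ω i) * (Z u ω i - Z v ω i)) =
        fun ω => Z u ω i * Z u ω i - 2 * (Z u ω i * Z v ω i) + Z v ω i * Z v ω i := by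
      ext ω; ring
    rw [this, integral_add (by exact iuu.sub (iuv.const_mul _)) ivv,
      integral_sub iuu (iuv.const_mul _), integral_const_mul, hZ.cov i u hu u hu,
      hZ.cov i u hu v hv, hZ.cov i v hv v hv]
    have := (hZ.var_pos hv).ne'
    field_simp; ring
  · rw [integral_sub hg.fst.integrable hg.snd.integrable, hZ.mean, hZ.mean, sub_zero]

lemma measure_ball_le (hZ : UnitCubeField P Z κ α c C) {u : Fin N → ℝ} (hu : u ∈ Set.Icc 0 1)
    (x : EuclideanSpace ℝ (Fin d)) {r : ℝ} (hr : 0 ≤ r) :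
    P {ω | ‖Z u ω - x‖ ≤ r} ≤ ENNReal.ofReal ((r / √c) ^ d) := by
  have hc := hZ.c_pos
  calc P {ω | ‖Z u ω - x‖ ≤ r}
      ≤ P (⋂ i, {ω | (Z u ω i, Z u ω i) ∈ {q : ℝ × ℝ | |q.1 - x i| ≤ r}}) := by
        apply measure_mono
        intro ω hω
        simp only [Set.mem_iInter, Set.mem_ofPred_eq] at hω ⊢
        intro i
        exact (PiLp.norm_apply_le (Z u ω - x) i).trans hω
    _ = ∏ i, P {ω | (Z u ω i, Z u ω i) ∈ {q : ℝ × ℝ | |q.1 - x i| ≤ r}} :=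
        hZ.measure_iInter_coord u u fun i =>
          measurableSet_le (f := fun q : ℝ × ℝ => |q.1 - x i|) (by fun_prop) measurable_const
    _ ≤ ∏ _i : Fin d, ENNReal.ofReal (r / √c) := by
        refine Finset.prod_le_prod' fun i _ => ?_
        have : {ω | (Z u ω i, Z u ω i) ∈ {q : ℝ × ℝ | |q.1 - x i| ≤ r}} =
            (fun ω => Z u ω i) ⁻¹' Metric.closedBall (x i) r := by
          ext ω; simp [Real.dist_eq]
        rw [this, ← Measure.map_apply (hZ.measurable_coord u i)
          Metric.isClosed_closedBall.measurableSet, hZ.map_coord hu]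
        refine (gaussianReal_closedBall_le' ?_).trans (ENNReal.ofReal_le_ofReal ?_)
        · simpa using hZ.var_pos hu
        · rw [Real.coe_toNNReal _ (hZ.var_pos hu).le]
          gcongr
          exact hZ.le_var u hu
    _ = _ := by
        rw [Finset.prod_const, Finset.card_univ, Fintype.card_fin, ENNReal.ofReal_pow (by positivity)]

/-- The ball contains a box of half-side `r / (d + 1)`; using `d + 1` instead of `√d` avoids a
separate case `d = 0`. -/
lemma exists_le_measure_ball (hZ : UnitCubeField P Z κ α c C) (M : ℝ) :
    ∃ B : ℝ, 0 < B ∧ ∀ u ∈ Set.Icc (0 : Fin N → ℝ) 1, ∀ x : EuclideanSpace ℝ (Fin d), ‖x‖ ≤ M →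
      ∀ r, 0 ≤ r → r ≤ 1 → ENNReal.ofReal (B * r ^ d) ≤ P {ω | ‖Z u ω - x‖ ≤ r} := by
  have hc := hZ.c_pos
  obtain ⟨b, hb, H⟩ := le_gaussianReal_closedBall hc (le_max_left c C) (abs_nonneg M)
  refine ⟨(b / (d + 1)) ^ d, by positivity, fun u hu x hx r hr0 hr1 => ?_⟩
  set r' := r / (d + 1) with hr'
  have hr'0 : 0 ≤ r' := by positivity
  have hr'1 : r' ≤ 1 := by
    rw [hr', div_le_one (by positivity)]; linarith [(Nat.cast_nonneg d : (0 : ℝ) ≤ d)]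
  calc ENNReal.ofReal ((b / (d + 1)) ^ d * r ^ d) = ∏ _i : Fin d, ENNReal.ofReal (b * r') := by
        rw [Finset.prod_const, Finset.card_univ, Fintype.card_fin,
          ← ENNReal.ofReal_pow (by positivity), hr', ← mul_pow]
        congr 2; ring
    _ ≤ ∏ i, P {ω | (Z u ω i, Z u ω i) ∈ {q : ℝ × ℝ | |q.1 - x i| ≤ r'}} := by
        refine Finset.prod_le_prod' fun i _ => ?_
        have : {ω | (Z u ω i, Z u ω i) ∈ {q : ℝ × ℝ | |q.1 - x i| ≤ r'}} =
            (fun ω => Z u ω i) ⁻¹' Metric.closedBall (x i) r' := by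
          ext ω; simp [Real.dist_eq]
        rw [this, ← Measure.map_apply (hZ.measurable_coord u i)
          Metric.isClosed_closedBall.measurableSet, hZ.map_coord hu]
        apply H _ _ _ _ _ _ hr'0 hr'1
        · rw [Real.coe_toNNReal _ (hZ.var_pos hu).le]; exact hZ.le_var u hu
        · rw [Real.coe_toNNReal _ (hZ.var_pos hu).le]
          exact (hZ.var_le u hu).trans (le_max_right _ _)
        · exact ((PiLp.norm_apply_le x i).trans hx).trans (le_abs_self M)
    _ = P (⋂ i, {ω | (Z u ω i, Z u ω i) ∈ {q : ℝ × ℝ | |q.1 - x i| ≤ r'}}) :=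
        (hZ.measure_iInter_coord u u fun i =>
          measurableSet_le (f := fun q : ℝ × ℝ => |q.1 - x i|) (by fun_prop) measurable_const).symm
    _ ≤ _ := by
        apply measure_mono
        intro ω hω
        simp only [Set.mem_iInter, Set.mem_ofPred_eq] at hω ⊢
        rw [EuclideanSpace.norm_eq]
        apply Real.sqrt_le_iff.2 ⟨hr0, ?_⟩
        calc ∑ i, ‖(Z u ω - x) i‖ ^ 2 ≤ ∑ _i : Fin d, r' ^ 2 := by
              gcongr with i _
              exact hω i
          _ = d * r' ^ 2 := by simp
          _ ≤ r ^ 2 := by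
              rw [hr', div_pow, ← mul_div_assoc, div_le_iff₀ (by positivity)]
              nlinarith [sq_nonneg r, (Nat.cast_nonneg d : (0 : ℝ) ≤ d), mul_nonneg (sq_nonneg r) (sq_nonneg (d : ℝ)), mul_nonneg (sq_nonneg r) (Nat.cast_nonneg d : (0 : ℝ) ≤ d)]

/-- The variance of an increment dominates the conditional variance, because the regression defect
adds a nonnegative term. -/
lemma measure_sub_ball_le (hZ : UnitCubeField P Z κ α c C) {u v : Fin N → ℝ}
    (hu : u ∈ Set.Icc 0 1) (hv : v ∈ Set.Icc 0 1) (huv : u ≠ v) {r : ℝ} (hr : 0 ≤ r) :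
    P {ω | ‖Z u ω - Z v ω‖ ≤ r} ≤ ENNReal.ofReal ((r / (√c * dist u v ^ α)) ^ d) := by
  have hc := hZ.c_pos
  have hdist : 0 < dist u v := dist_pos.2 huv
  calc P {ω | ‖Z u ω - Z v ω‖ ≤ r}
      ≤ P (⋂ i, {ω | (Z u ω i, Z v ω i) ∈ {q : ℝ × ℝ | |q.1 - q.2| ≤ r}}) := by
        apply measure_mono
        intro ω hω
        simp only [Set.mem_iInter, Set.mem_ofPred_eq] at hω ⊢
        intro i
        exact (PiLp.norm_apply_le (Z u ω - Z v ω) i).trans hω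
    _ = ∏ i, P {ω | (Z u ω i, Z v ω i) ∈ {q : ℝ × ℝ | |q.1 - q.2| ≤ r}} :=
        hZ.measure_iInter_coord u v fun i =>
          measurableSet_le (f := fun q : ℝ × ℝ => |q.1 - q.2|) (by fun_prop) measurable_const
    _ ≤ ∏ _i : Fin d, ENNReal.ofReal (r / (√c * dist u v ^ α)) := by
        refine Finset.prod_le_prod' fun i _ => ?_
        have : {ω | (Z u ω i, Z v ω i) ∈ {q : ℝ × ℝ | |q.1 - q.2| ≤ r}} =
            (fun ω => Z u ω i - Z v ω i) ⁻¹' Metric.closedBall 0 r := by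
          ext ω; simp
        have hle : c * (dist u v ^ α) ^ 2 ≤
            κ u u - κ u v ^ 2 / κ v v + (1 - κ u v / κ v v) ^ 2 * κ v v := by
          have h1 := hZ.le_condVar u hu v hv
          have h2 := mul_nonneg (sq_nonneg (1 - κ u v / κ v v)) (hZ.var_pos hv).le
          linarith
        have hpos : 0 < c * (dist u v ^ α) ^ 2 := by positivity
        rw [this, ← Measure.map_apply (hZ.measurable_sub_coord u v i)
          Metric.isClosed_closedBall.measurableSet, hZ.map_sub_coord hu hv]
        refine (gaussianReal_closedBall_le' ?_).trans (ENNReal.ofReal_le_ofReal ?_)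
        · simpa using hpos.trans_le hle
        · rw [Real.coe_toNNReal _ (hpos.le.trans hle)]
          gcongr
          rw [← Real.sqrt_sq (by positivity : 0 ≤ dist u v ^ α), ← Real.sqrt_mul hc.le]
          exact Real.sqrt_le_sqrt hle
    _ = _ := by
        rw [Finset.prod_const, Finset.card_univ, Fintype.card_fin, ENNReal.ofReal_pow (by positivity)]

/-- The upper bound needs both controls: the conditional variance and the squared regression defect
are each of order `dist u v ^ (2 * α)`. -/
lemma exists_moment_le (hZ : UnitCubeField P Z κ α c C) (p : ℕ) :
    ∃ B : ℝ, 0 < B ∧ ∀ u ∈ Set.Icc (0 : Fin N → ℝ) 1, ∀ v ∈ Set.Icc (0 : Fin N → ℝ) 1,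
      ∀ i, ∫⁻ ω, ‖Z u ω i - Z v ω i‖ₑ ^ p ∂P ≤ ENNReal.ofReal (B * (dist u v ^ α) ^ p) := by
  have hC := hZ.C_pos
  obtain ⟨K, hK, H⟩ := lintegral_enorm_pow_gaussianReal p
  refine ⟨K * √(C + C ^ 2 * C) ^ p, by positivity, fun u hu v hv i => ?_⟩
  have hh : 0 ≤ dist u v ^ α := by positivity
  have hle : κ u u - κ u v ^ 2 / κ v v + (1 - κ u v / κ v v) ^ 2 * κ v v ≤
      (C + C ^ 2 * C) * (dist u v ^ α) ^ 2 := by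
    have h1 := hZ.condVar_le u hu v hv
    have h2 : (1 - κ u v / κ v v) ^ 2 ≤ (C * dist u v ^ α) ^ 2 := by
      rw [← sq_abs]
      exact pow_le_pow_left₀ (abs_nonneg _) (hZ.regression u hu v hv) 2
    calc _ ≤ C * (dist u v ^ α) ^ 2 + (C * dist u v ^ α) ^ 2 * C :=
          add_le_add h1 (mul_le_mul h2 (hZ.var_le v hv) (hZ.var_pos hv).le (by positivity))
      _ = _ := by ring
  have := H (κ u u - κ u v ^ 2 / κ v v + (1 - κ u v / κ v v) ^ 2 * κ v v).toNNReal
  rw [← hZ.map_sub_coord hu hv i, lintegral_map (by fun_prop)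
    (hZ.measurable_sub_coord u v i)] at this
  refine this.trans (ENNReal.ofReal_le_ofReal ?_)
  rw [mul_assoc, ← mul_pow]
  gcongr
  rw [← Real.sqrt_sq hh, ← Real.sqrt_mul (by positivity)]
  apply Real.sqrt_le_sqrt
  rw [Real.coe_toNNReal']
  exact max_le hle (by positivity)

set_option maxHeartbeats 800000 in
/-- The two-point small ball estimate. -/
lemma exists_measure_pair_le [IsProbabilityMeasure P] (hZ : UnitCubeField P Z κ α c C) {M : ℝ} (hM : 0 ≤ M) :
    ∃ B : ℝ, 0 < B ∧ ∀ u ∈ Set.Icc (0 : Fin N → ℝ) 1, ∀ v ∈ Set.Icc (0 : Fin N → ℝ) 1,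
      ∀ x y : EuclideanSpace ℝ (Fin d), ‖y‖ ≤ M → ∀ ε, 0 < ε → ε ≤ 1 →
      P {ω | ‖Z u ω - x‖ ≤ ε ∧ ‖Z v ω - y‖ ≤ ε} ≤
        ENNReal.ofReal (B * (ε ^ 2 / max ε (max ‖x - y‖ (dist u v ^ α))) ^ d) := by
  have hc := hZ.c_pos
  have hC := hZ.C_pos
  -- The summand `3` excludes simultaneous hits when `u = v` and `‖x - y‖ > K * ε`; the other
  -- summand makes the errors at most `μ / (2 * d)` when space dominates.
  set K : ℝ := 2 * d * (2 + C * (M + 1)) + 3 with hK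
  have hKd : 0 ≤ 2 * d * (2 + C * (M + 1)) := by positivity
  have hK3 : 3 ≤ K := by linarith
  have hK0 : 0 < K := by linarith
  set B₁ := (K / √c) ^ d with hB₁
  set B₂ := (K / c) ^ d with hB₂
  set B₃ := (2 * d / √c) ^ d * (d.factorial * Real.exp 1) with hB₃
  have hB₁0 : 0 < B₁ := by positivity
  have hB₂0 : 0 < B₂ := by positivity
  have hB₃0 : 0 ≤ B₃ := by positivity
  refine ⟨B₁ + B₂ + B₃, by positivity, ?_⟩
  intro u hu v hv x y hy ε hε hε1
  set h := dist u v ^ α with hh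
  set μ := max ε (max ‖x - y‖ h) with hμ
  have hh0 : 0 ≤ h := by positivity
  have hμ0 : 0 < μ := lt_max_of_lt_left hε
  have hQ0 : 0 ≤ (ε ^ 2 / μ) ^ d := by positivity
  -- the product bound over the coordinates
  have hprod : ∀ b : Fin d → ℝ, (∀ i, 0 ≤ b i) →
      (∀ i, P {ω | |Z u ω i - x i| ≤ ε ∧ |Z v ω i - y i| ≤ ε} ≤ ENNReal.ofReal (b i)) →
      P {ω | ‖Z u ω - x‖ ≤ ε ∧ ‖Z v ω - y‖ ≤ ε} ≤ ENNReal.ofReal (∏ i, b i) := by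
    intro b hb0 hb
    calc P {ω | ‖Z u ω - x‖ ≤ ε ∧ ‖Z v ω - y‖ ≤ ε}
        ≤ P (⋂ i, {ω | (Z u ω i, Z v ω i) ∈ {q : ℝ × ℝ | |q.1 - x i| ≤ ε ∧ |q.2 - y i| ≤ ε}}) := by
          apply measure_mono
          intro ω hω
          simp only [Set.mem_iInter, Set.mem_ofPred_eq] at hω ⊢
          exact fun i => ⟨(PiLp.norm_apply_le (Z u ω - x) i).trans hω.1,
            (PiLp.norm_apply_le (Z v ω - y) i).trans hω.2⟩
      _ = ∏ i, P {ω | (Z u ω i, Z v ω i) ∈ {q : ℝ × ℝ | |q.1 - x i| ≤ ε ∧ |q.2 - y i| ≤ ε}} :=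
          hZ.measure_iInter_coord u v fun i =>
            (measurableSet_le (f := fun q : ℝ × ℝ => |q.1 - x i|) (by fun_prop)
              measurable_const).inter
            (measurableSet_le (f := fun q : ℝ × ℝ => |q.2 - y i|) (by fun_prop) measurable_const)
      _ ≤ ∏ i, ENNReal.ofReal (b i) := Finset.prod_le_prod' fun i _ => hb i
      _ = _ := (ENNReal.ofReal_prod_of_nonneg fun i _ => hb0 i).symm
  -- If `ε` is comparable to the maximum, `ε² / μ` is at least `ε / K` and the one-point bound
  -- suffices.
  by_cases hA : μ ≤ K * ε
  · calc P {ω | ‖Z u ω - x‖ ≤ ε ∧ ‖Z v ω - y‖ ≤ ε} ≤ P {ω | ‖Z u ω - x‖ ≤ ε} :=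
          measure_mono fun ω hω => hω.1
      _ ≤ ENNReal.ofReal ((ε / √c) ^ d) := hZ.measure_ball_le hu x hε.le
      _ ≤ _ := by
          apply ENNReal.ofReal_le_ofReal
          calc (ε / √c) ^ d ≤ (K / √c * (ε ^ 2 / μ)) ^ d := by
                gcongr
                rw [div_mul_div_comm, div_le_div_iff₀ (by positivity) (by positivity)]
                nlinarith [mul_le_mul_of_nonneg_left hA (by positivity : 0 ≤ ε * √c)]
            _ = B₁ * (ε ^ 2 / μ) ^ d := by rw [mul_pow]
            _ ≤ _ := by gcongr; linarith
  push Not at hA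
  rcases eq_or_ne u v with huv | huv
  · have hh' : h = 0 := by rw [hh, huv, dist_self, Real.zero_rpow hZ.α_pos.ne']
    have hρ : K * ε < ‖x - y‖ := by
      rw [hμ, hh', lt_max_iff, lt_max_iff] at hA
      rcases hA with h1 | h1 | h1
      · nlinarith
      · exact h1
      · nlinarith
    have : {ω | ‖Z u ω - x‖ ≤ ε ∧ ‖Z v ω - y‖ ≤ ε} = ∅ := by
      ext ω
      simp only [Set.mem_ofPred_eq, Set.mem_empty_iff_false, iff_false, not_and, not_le]
      intro h1
      rw [← huv]
      have : ‖x - y‖ ≤ ‖Z u ω - y‖ + ‖Z u ω - x‖ := by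
        calc ‖x - y‖ = ‖(Z u ω - y) - (Z u ω - x)‖ := by congr 1; abel
          _ ≤ _ := norm_sub_le _ _
      nlinarith
    rw [this]; simp
  have hdist : 0 < dist u v := dist_pos.2 huv
  have hhpos : 0 < h := by positivity
  set w := κ u u - κ u v ^ 2 / κ v v with hw
  have hwle : c * h ^ 2 ≤ w := hZ.le_condVar u hu v hv
  have hw0 : 0 < w := lt_of_lt_of_le (by positivity) hwle
  have hpair : ∀ i (τ : ℝ), 0 ≤ τ →
      (∀ y', |y' - y i| ≤ ε → τ + ε ≤ |x i - κ u v / κ v v * y'| ∨ τ = 0) →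
      P {ω | |Z u ω i - x i| ≤ ε ∧ |Z v ω i - y i| ≤ ε} ≤
        ENNReal.ofReal (ε / √c * (ε / √w * Real.exp (-τ ^ 2 / (2 * w)))) := by
    intro i τ hτ hτ'
    refine (measure_pair_le (hZ.gaussian_coord u v i) (hZ.measurable_coord u i)
      (hZ.measurable_coord v i) (hZ.mean u i) (hZ.mean v i) (hZ.cov i u hu u hu)
      (hZ.cov i v hv v hv) (hZ.cov i u hu v hv) (hZ.var_pos hv) hw0 hε.le hτ hτ').trans ?_
    apply ENNReal.ofReal_le_ofReal
    gcongr
    exact hZ.le_var v hv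
  -- If time dominates, the residual has standard deviation of order at least `μ`, and bounding its
  -- density is enough in every coordinate.
  by_cases hBh : μ ≤ K * h
  · have hsw : √c * h ≤ √w := by
      rw [← Real.sqrt_sq hh0, ← Real.sqrt_mul hc.le]
      exact Real.sqrt_le_sqrt hwle
    refine (hprod (fun _ => K / c * (ε ^ 2 / μ)) (fun _ => by positivity) fun i => ?_).trans ?_
    · refine (hpair i 0 le_rfl fun _ _ => Or.inr rfl).trans (ENNReal.ofReal_le_ofReal ?_)
      simp only [ne_eq, OfNat.ofNat_ne_zero, not_false_eq_true, zero_pow, neg_zero, zero_div,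
        Real.exp_zero, mul_one]
      calc ε / √c * (ε / √w) ≤ ε / √c * (ε / (√c * h)) := by gcongr
        _ = ε ^ 2 / (c * h) := by
            rw [div_mul_div_comm, ← mul_assoc, Real.mul_self_sqrt hc.le, pow_two]
        _ ≤ K / c * (ε ^ 2 / μ) := by
            rw [div_mul_div_comm, div_le_div_iff₀ (by positivity) (by positivity)]
            nlinarith [mul_le_mul_of_nonneg_left hBh (by positivity : 0 ≤ ε ^ 2 * c)]
    · apply ENNReal.ofReal_le_ofReal
      rw [Finset.prod_const, Finset.card_univ, Fintype.card_fin, mul_pow]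
      gcongr; linarith
  push Not at hBh
  have hμρ : μ = ‖x - y‖ := by
    rw [hμ]
    rcases max_choice ε (max ‖x - y‖ h) with h1 | h1
    · rw [← hμ] at h1; nlinarith
    · rw [h1]
      rcases max_choice ‖x - y‖ h with h2 | h2
      · exact h2
      · rw [← hμ, h2] at h1; nlinarith
  -- If space dominates, some coordinate gap is at least `μ / d`, so that residual must be as large
  -- as `τ`. Its Gaussian tail alone pays for all `d` factors `ε / √w`, turning them into `ε / τ`.
  obtain ⟨i₀, hi₀⟩ : ∃ i, μ / d ≤ |x i - y i| := by
    by_contra! hcon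
    have h1 : ‖x - y‖ ≤ ∑ i, |x i - y i| := by
      rw [EuclideanSpace.norm_eq]
      apply Real.sqrt_le_iff.2 ⟨by positivity, ?_⟩
      exact Finset.sum_sq_le_sq_sum_of_nonneg (fun i _ => abs_nonneg (x i - y i))
    rcases Nat.eq_zero_or_pos d with hd | hd
    · subst hd
      simp at h1
      rw [h1] at hμρ
      exact hμ0.ne' (by rw [hμρ]; simp)
    · have : Nonempty (Fin d) := ⟨⟨0, hd⟩⟩
      have h2 : ∑ i, |x i - y i| < ∑ _i : Fin d, μ / d :=
        Finset.sum_lt_sum_of_nonempty Finset.univ_nonempty fun i _ => hcon i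
      rw [Finset.sum_const, Finset.card_univ, Fintype.card_fin, nsmul_eq_mul,
        mul_div_cancel₀ _ (by positivity)] at h2
      linarith
  have hd : 0 < d := Fin.pos i₀
  have hd' : (0 : ℝ) < d := by positivity
  set τ := μ / (2 * d) with hτ
  have hτ0 : 0 < τ := by positivity
  have hτ' : ∀ y', |y' - y i₀| ≤ ε → τ + ε ≤ |x i₀ - κ u v / κ v v * y'| ∨ τ = 0 := by
    intro y' hy'
    left
    have h1 : |x i₀ - y i₀| ≤ |x i₀ - κ u v / κ v v * y'| + |y' - y i₀| +
        |1 - κ u v / κ v v| * |y'| := by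
      rw [← abs_mul]
      calc |x i₀ - y i₀| = |(x i₀ - κ u v / κ v v * y') + (y' - y i₀) -
            (1 - κ u v / κ v v) * y'| := by ring_nf
        _ ≤ |(x i₀ - κ u v / κ v v * y') + (y' - y i₀)| + |(1 - κ u v / κ v v) * y'| := abs_sub _ _
        _ ≤ _ := by gcongr; exact abs_add_le _ _
    have h2 : |y'| ≤ M + 1 := by
      calc |y'| = |(y' - y i₀) + y i₀| := by ring_nf
        _ ≤ |y' - y i₀| + |y i₀| := abs_add_le _ _
        _ ≤ ε + M := add_le_add hy' ((PiLp.norm_apply_le y i₀).trans hy)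
        _ ≤ _ := by linarith
    have h3 : |1 - κ u v / κ v v| * |y'| ≤ C * h * (M + 1) := by
      gcongr
      exact hZ.regression u hu v hv
    have hεK : ε ≤ μ / K := by rw [le_div_iff₀' hK0]; exact hA.le
    have hhK : h ≤ μ / K := by rw [le_div_iff₀' hK0]; exact hBh.le
    have h4 : 2 * ε + C * h * (M + 1) ≤ μ / (2 * d) := by
      calc 2 * ε + C * h * (M + 1) ≤ 2 * (μ / K) + C * (μ / K) * (M + 1) := by gcongr
        _ = μ * (2 + C * (M + 1)) / K := by ring
        _ ≤ μ / (2 * d) := by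
            rw [div_le_div_iff₀ hK0 (by positivity),
              show μ * (2 + C * (M + 1)) * (2 * d) = μ * (2 * d * (2 + C * (M + 1))) by ring]
            gcongr
            linarith
    have h5 : μ / d = μ / (2 * d) + μ / (2 * d) := by field_simp; ring
    rw [hτ]
    linarith
  refine (hprod (fun i => ε / √c * (ε / √w * (if i = i₀ then Real.exp (-τ ^ 2 / (2 * w)) else 1)))
    (fun i => by positivity) fun i => ?_).trans ?_
  · by_cases hi : i = i₀
    · rw [if_pos hi, hi]
      exact hpair i₀ τ hτ0.le hτ'
    · rw [if_neg hi]
      simpa using hpair i 0 le_rfl fun _ _ => Or.inr rfl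
  · apply ENNReal.ofReal_le_ofReal
    simp_rw [Finset.prod_mul_distrib]
    rw [Finset.prod_ite_eq' Finset.univ i₀ (fun _ => Real.exp (-τ ^ 2 / (2 * w)))]
    simp only [Finset.prod_const, Finset.card_univ, Fintype.card_fin, Finset.mem_univ, if_true]
    have hsw : 0 < √w := Real.sqrt_pos.2 hw0
    have hq := Real.pow_mul_exp_neg_sq_le d (by positivity : 0 ≤ τ / √w)
    have hexp : -(τ / √w) ^ 2 / 2 = -τ ^ 2 / (2 * w) := by
      rw [div_pow, Real.sq_sqrt hw0.le]; field_simp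
    rw [hexp] at hq
    calc (ε / √c) ^ d * ((ε / √w) ^ d * Real.exp (-τ ^ 2 / (2 * w)))
        = (ε / √c) ^ d * (ε / τ) ^ d * ((τ / √w) ^ d * Real.exp (-τ ^ 2 / (2 * w))) := by
          rw [← mul_assoc, ← mul_assoc]
          congr 1
          rw [mul_assoc, ← mul_pow (ε / τ)]
          congr 2
          field_simp
      _ ≤ (ε / √c) ^ d * (ε / τ) ^ d * (d.factorial * Real.exp 1) := by gcongr
      _ = B₃ * (ε ^ 2 / μ) ^ d := by
          rw [hB₃, ← mul_pow, mul_right_comm, ← mul_pow]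
          congr 2
          rw [hτ]; field_simp
      _ ≤ _ := by gcongr; linarith

end UnitCubeField

/-! ### Dyadic chaining and the upper bound for the image dimension -/

section Grid

variable {N : ℕ}

/-- The points of the dyadic grid of mesh `2⁻ⁿ` in the unit cube. -/
noncomputable def gridPt (n : ℕ) (z : Fin N → Fin (2 ^ n + 1)) : Fin N → ℝ :=
  fun k => (z k : ℝ) / 2 ^ n

/-- The index of the grid point just below a point of the unit cube. -/
noncomputable def floorIdx (n : ℕ) (u : Fin N → ℝ) : Fin N → Fin (2 ^ n + 1) :=
  fun k => Fin.ofNat (2 ^ n + 1) ⌊2 ^ n * u k⌋₊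

lemma gridPt_mem (n : ℕ) (z : Fin N → Fin (2 ^ n + 1)) : gridPt n z ∈ Set.Icc 0 1 := by
  refine ⟨fun k => ?_, fun k => ?_⟩
  · simp only [gridPt, Pi.zero_apply]; positivity
  · simp only [gridPt, Pi.one_apply]
    rw [div_le_one (by positivity)]
    have := (z k).is_le
    exact_mod_cast this

lemma dist_gridPt_floorIdx_le (n : ℕ) {u : Fin N → ℝ} (hu : u ∈ Set.Icc 0 1) :
    dist (gridPt n (floorIdx n u)) u ≤ (1 / 2) ^ n := by
  refine (dist_pi_le_iff (by positivity)).2 fun k => ?_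
  have h0 : 0 ≤ u k := hu.1 k
  have h1 : u k ≤ 1 := hu.2 k
  -- `Fin.ofNat` reduces modulo `2 ^ n + 1`; this bound, attained at `u k = 1`, rules out wrapping.
  have hle : ⌊2 ^ n * u k⌋₊ ≤ 2 ^ n := by
    apply Nat.floor_le_of_le
    push_cast
    nlinarith [pow_pos (two_pos : (0 : ℝ) < 2) n]
  have hval : ((floorIdx n u k : ℕ) : ℝ) = ⌊2 ^ n * u k⌋₊ := by
    simp only [floorIdx, Fin.val_ofNat]
    rw [Nat.mod_eq_of_lt (by omega)]
  have ha := Nat.floor_le (by positivity : 0 ≤ 2 ^ n * u k)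
  have hb := Nat.lt_floor_add_one (2 ^ n * u k)
  have hp : (0 : ℝ) < 2 ^ n := by positivity
  rw [gridPt, Real.dist_eq, hval, one_div, inv_pow, ← one_div, abs_le]
  constructor
  · rw [neg_le_sub_iff_le_add, ← add_div, le_div_iff₀ hp]; linarith
  · rw [sub_le_iff_le_add, div_le_iff₀ hp, add_mul, one_div_mul_cancel hp.ne']; linarith

lemma card_grid_le (n : ℕ) :
    (Fintype.card (Fin N → Fin (2 ^ n + 1)) : ℝ) ≤ (2 * 2 ^ n) ^ N := by
  rw [Fintype.card_fun, Fintype.card_fin, Fintype.card_fin]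
  push_cast
  gcongr
  linarith [one_le_pow₀ (one_le_two : (1 : ℝ) ≤ 2) (n := n)]

end Grid

namespace UnitCubeField

variable {Ω : Type*} {m : MeasurableSpace Ω} {P : Measure Ω} {N d : ℕ}
  {Z : (Fin N → ℝ) → Ω → EuclideanSpace ℝ (Fin d)} {κ : (Fin N → ℝ) → (Fin N → ℝ) → ℝ}
  {α c C : ℝ}

/-- Neighbouring pairs of points in two successive dyadic grids. -/
noncomputable def gridPairs (N n : ℕ) :
    Finset ((Fin N → Fin (2 ^ n + 1)) × (Fin N → Fin (2 ^ (n + 1) + 1))) :=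
  Finset.univ.filter fun q => dist (gridPt n q.1) (gridPt (n + 1) q.2) ≤ 2 * (1 / 2) ^ n

/-- Counting all pairs, neighbours or not, is affordable because the moment order `p` may be taken
as large as desired. -/
lemma card_gridPairs_le (N n : ℕ) :
    ((gridPairs N n).card : ℝ) ≤ 8 ^ N * ((2 : ℝ) ^ (2 * N : ℝ)) ^ n := by
  calc ((gridPairs N n).card : ℝ) ≤ (Fintype.card ((Fin N → Fin (2 ^ n + 1)) ×
        (Fin N → Fin (2 ^ (n + 1) + 1))) : ℝ) := by
        exact_mod_cast Finset.card_le_univ _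
    _ ≤ (2 * 2 ^ n) ^ N * (2 * 2 ^ (n + 1)) ^ N := by
        rw [Fintype.card_prod, Nat.cast_mul]
        exact mul_le_mul (card_grid_le n) (card_grid_le (n + 1)) (Nat.cast_nonneg _)
          (by positivity)
    _ = _ := by
        have e : ((2 : ℝ) ^ (2 * N : ℝ)) ^ n = (2 ^ n * 2 ^ n) ^ N := by
          rw [show (2 * N : ℝ) = ((2 * N : ℕ) : ℝ) by push_cast; ring,
            Real.rpow_natCast, ← pow_mul, ← pow_add, ← pow_mul]
          congr 1; ring
        rw [e, ← mul_pow, ← mul_pow, pow_succ]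
        congr 1; ring

lemma rpow_grid_identity (α η B : ℝ) (p n : ℕ) :
    (((2 : ℝ) ^ η) ^ n) ^ p * (B * ((2 * (1 / 2) ^ n) ^ α) ^ p) =
      B * (2 ^ α) ^ p * ((2 : ℝ) ^ (p * (η - α))) ^ n := by
  rw [Real.mul_rpow (by norm_num) (by positivity), mul_pow]
  have h1 : ((1 / 2 : ℝ) ^ n) ^ α = ((2 : ℝ) ^ (-α)) ^ n := by
    rw [← Real.rpow_natCast, ← Real.rpow_mul (by norm_num), mul_comm (n : ℝ),
      Real.rpow_mul (by norm_num), Real.rpow_natCast, one_div,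
      Real.inv_rpow (by norm_num), Real.rpow_neg (by norm_num)]
  have h2 : (2 : ℝ) ^ (p * (η - α)) = ((2 : ℝ) ^ η) ^ p * ((2 : ℝ) ^ (-α)) ^ p := by
    rw [← mul_pow, ← Real.rpow_add two_pos, ← Real.rpow_natCast,
      ← Real.rpow_mul (by norm_num)]
    congr 1; ring
  rw [h1, h2, mul_pow]
  ring

/-- The weighted sum of the `p`-th powers of the increments over neighbouring grid points. -/
noncomputable def gridMoment (Z : (Fin N → ℝ) → Ω → EuclideanSpace ℝ (Fin d)) (η : ℝ) (p n : ℕ)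
    (ω : Ω) : ℝ≥0∞ :=
  ∑ q ∈ gridPairs N n, ∑ i : Fin d, ENNReal.ofReal ((((2 : ℝ) ^ η) ^ n) ^ p) *
    ‖Z (gridPt n q.1) ω i - Z (gridPt (n + 1) q.2) ω i‖ₑ ^ p

lemma term_le_gridMoment (Z : (Fin N → ℝ) → Ω → EuclideanSpace ℝ (Fin d)) (η : ℝ) (p n : ℕ)
    (ω : Ω) (q : (Fin N → Fin (2 ^ n + 1)) × (Fin N → Fin (2 ^ (n + 1) + 1)))
    (hq : q ∈ gridPairs N n) (i : Fin d) :
    ENNReal.ofReal ((((2 : ℝ) ^ η) ^ n) ^ p) *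
      ‖Z (gridPt n q.1) ω i - Z (gridPt (n + 1) q.2) ω i‖ₑ ^ p ≤ gridMoment Z η p n ω := by
  refine le_trans ?_ (Finset.single_le_sum (fun _ _ => zero_le) hq)
  exact Finset.single_le_sum (f := fun i : Fin d => ENNReal.ofReal ((((2 : ℝ) ^ η) ^ n) ^ p) *
    ‖Z (gridPt n q.1) ω i - Z (gridPt (n + 1) q.2) ω i‖ₑ ^ p) (fun _ _ => zero_le)
    (Finset.mem_univ i)

lemma measurable_gridMoment_term (hZ : UnitCubeField P Z κ α c C) (η : ℝ) (p n : ℕ)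
    (u v : Fin N → ℝ) (i : Fin d) :
    Measurable fun ω => ENNReal.ofReal ((((2 : ℝ) ^ η) ^ n) ^ p) * ‖Z u ω i - Z v ω i‖ₑ ^ p :=
  ((hZ.measurable_sub_coord _ _ i).enorm.pow_const p).const_mul _

lemma measurable_gridMoment (hZ : UnitCubeField P Z κ α c C) (η : ℝ) (p n : ℕ) :
    Measurable (gridMoment Z η p n) :=
  Finset.measurable_sum _ fun _ _ => Finset.measurable_sum _ fun i _ =>
    hZ.measurable_gridMoment_term η p n _ _ i

lemma exists_lintegral_gridMoment_le (hZ : UnitCubeField P Z κ α c C) (η : ℝ) (p : ℕ) :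
    ∃ B : ℝ, ∀ n, ∫⁻ ω, gridMoment Z η p n ω ∂P ≤
      ENNReal.ofReal (B * ((2 : ℝ) ^ (2 * N + p * (η - α))) ^ n) := by
  obtain ⟨B, hB, H⟩ := hZ.exists_moment_le p
  have hα := hZ.α_pos
  refine ⟨8 ^ N * d * B * (2 ^ α) ^ p, fun n => ?_⟩
  set b : ℝ := (((2 : ℝ) ^ η) ^ n) ^ p * (B * ((2 * (1 / 2) ^ n) ^ α) ^ p) with hb
  have hm : ∀ q ∈ gridPairs N n, ∀ i : Fin d, ∫⁻ ω, ENNReal.ofReal ((((2 : ℝ) ^ η) ^ n) ^ p) *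
      ‖Z (gridPt n q.1) ω i - Z (gridPt (n + 1) q.2) ω i‖ₑ ^ p ∂P ≤ ENNReal.ofReal b := by
    intro q hq i
    rw [lintegral_const_mul _ ((hZ.measurable_sub_coord _ _ i).enorm.pow_const p), hb,
      ENNReal.ofReal_mul (by positivity)]
    gcongr
    refine (H _ (gridPt_mem _ _) _ (gridPt_mem _ _) i).trans (ENNReal.ofReal_le_ofReal ?_)
    gcongr
    exact (Finset.mem_filter.1 hq).2
  unfold gridMoment
  rw [lintegral_finsetSum _ fun q _ => Finset.measurable_sum _ fun i _ =>
    hZ.measurable_gridMoment_term η p n _ _ i]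
  calc _ ≤ ∑ _q ∈ gridPairs N n, ∑ _i : Fin d, ENNReal.ofReal b := by
        refine Finset.sum_le_sum fun q hq => ?_
        rw [lintegral_finsetSum _ fun i _ => hZ.measurable_gridMoment_term η p n _ _ i]
        exact Finset.sum_le_sum fun i _ => hm q hq i
    _ = ENNReal.ofReal ((gridPairs N n).card * (d * b)) := by
        rw [Finset.sum_const, Finset.sum_const, Finset.card_univ, Fintype.card_fin,
          nsmul_eq_mul, nsmul_eq_mul, ENNReal.ofReal_mul (Nat.cast_nonneg _),
          ENNReal.ofReal_mul (Nat.cast_nonneg _), ENNReal.ofReal_natCast,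
          ENNReal.ofReal_natCast]
    _ ≤ _ := by
        apply ENNReal.ofReal_le_ofReal
        rw [hb, rpow_grid_identity]
        calc _ ≤ 8 ^ N * ((2 : ℝ) ^ (2 * N : ℝ)) ^ n *
              (d * (B * (2 ^ α) ^ p * ((2 : ℝ) ^ (p * (η - α))) ^ n)) := by
              gcongr
              exact card_gridPairs_le N n
          _ = _ := by
              rw [Real.rpow_add two_pos, mul_pow]; ring

lemma ae_gridPairs_bound (hZ : UnitCubeField P Z κ α c C) {η : ℝ} (hηα : η < α) :
    ∀ᵐ ω ∂P, ∃ K : ℝ, 0 ≤ K ∧ ∀ n, ∀ q ∈ gridPairs N n, ∀ i : Fin d,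
      |Z (gridPt n q.1) ω i - Z (gridPt (n + 1) q.2) ω i| ≤ K * ((2 : ℝ) ^ (-η)) ^ n := by
  -- With `p * (α - η) > 2 * N + 1` the expected grid moments decay geometrically, so their sum is
  -- almost surely finite.
  obtain ⟨p, hp⟩ := exists_nat_gt ((2 * N + 1) / (α - η))
  have hαη : 0 < α - η := by linarith
  rw [div_lt_iff₀ hαη] at hp
  have hp0 : p ≠ 0 := by
    rintro rfl
    simp only [CharP.cast_eq_zero, zero_mul] at hp
    linarith [(Nat.cast_nonneg N : (0 : ℝ) ≤ N)]
  obtain ⟨B, hB⟩ := hZ.exists_lintegral_gridMoment_le η p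
  have hρ1 : (2 : ℝ) ^ (2 * N + p * (η - α)) < 1 := by
    apply Real.rpow_lt_one_of_one_lt_of_neg one_lt_two
    nlinarith
  have hfin : ∫⁻ ω, ∑' n, gridMoment Z η p n ω ∂P ≠ ∞ := by
    rw [lintegral_tsum fun n => (hZ.measurable_gridMoment η p n).aemeasurable]
    refine ne_top_of_le_ne_top ?_ (ENNReal.tsum_le_tsum hB)
    exact ((summable_geometric_of_lt_one (by positivity) hρ1).mul_left _).tsum_ofReal_ne_top
  have hae := ae_lt_top (Measurable.tsum (hZ.measurable_gridMoment η p)) hfin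
  filter_upwards [hae] with ω hω
  refine ⟨(∑' n, gridMoment Z η p n ω).toReal + 1, by positivity, fun n q hq i => ?_⟩
  set S := ∑' n, gridMoment Z η p n ω with hS
  set D := Z (gridPt n q.1) ω i - Z (gridPt (n + 1) q.2) ω i with hD
  have h1 : ENNReal.ofReal ((((2 : ℝ) ^ η) ^ n) ^ p) * ‖D‖ₑ ^ p ≤ S :=
    (term_le_gridMoment Z η p n ω q hq i).trans (ENNReal.le_tsum n)
  clear_value D S
  have h2 : (((2 : ℝ) ^ η) ^ n * |D|) ^ p ≤ S.toReal := by
    rw [← ENNReal.ofReal_le_iff_le_toReal hω.ne, mul_pow, ENNReal.ofReal_mul (by positivity),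
      ENNReal.ofReal_pow (abs_nonneg D)]
    rwa [← Real.enorm_eq_ofReal_abs]
  -- This replaces a `p`-th root: a number above `1 + S` would be at most its own `p`-th power,
  -- hence at most `S`.
  have h3 : ((2 : ℝ) ^ η) ^ n * |D| ≤ S.toReal + 1 := by
    by_contra! hcon
    have hT : 0 ≤ S.toReal := ENNReal.toReal_nonneg
    have : S.toReal + 1 ≤ (((2 : ℝ) ^ η) ^ n * |D|) ^ p :=
      hcon.le.trans (le_self_pow₀ (by linarith) hp0)
    linarith
  rw [Real.rpow_neg (by norm_num), inv_pow, ← div_eq_mul_inv, le_div_iff₀ (by positivity)]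
  linarith

/-- Uniform modulus of continuity along the dyadic grids. -/
lemma ae_dyadic_modulus (hZ : UnitCubeField P Z κ α c C) {η : ℝ} (hη : 0 < η) (hηα : η < α) :
    ∀ᵐ ω ∂P, ∃ K : ℕ, ∀ n, ∀ u ∈ Set.Icc (0 : Fin N → ℝ) 1,
      ‖Z u ω - Z (gridPt n (floorIdx n u)) ω‖ ≤ K * ((2 : ℝ) ^ (-η)) ^ n := by
  filter_upwards [hZ.ae_gridPairs_bound hηα, hZ.continuous] with ω ⟨K, hK0, hK⟩ hcont
  set r : ℝ := (2 : ℝ) ^ (-η) with hr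
  have hr1 : r < 1 := Real.rpow_lt_one_of_one_lt_of_neg one_lt_two (by linarith)
  -- An integer constant lets the good events be exhausted by a countable union later.
  obtain ⟨K', hK'⟩ := exists_nat_ge (d * K / (1 - r))
  refine ⟨K', fun n u hu => ?_⟩
  have hstep : ∀ n, dist (Z (gridPt n (floorIdx n u)) ω)
      (Z (gridPt (n + 1) (floorIdx (n + 1) u)) ω) ≤ d * K * r ^ n := by
    intro n
    have hq : (floorIdx n u, floorIdx (n + 1) u) ∈ gridPairs N n := by
      refine Finset.mem_filter.2 ⟨Finset.mem_univ _, ?_⟩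
      calc _ ≤ dist (gridPt n (floorIdx n u)) u + dist (gridPt (n + 1) (floorIdx (n + 1) u)) u :=
            dist_triangle_right _ _ _
        _ ≤ (1 / 2) ^ n + (1 / 2) ^ (n + 1) :=
            add_le_add (dist_gridPt_floorIdx_le n hu) (dist_gridPt_floorIdx_le (n + 1) hu)
        _ ≤ _ := by rw [pow_succ]; linarith [pow_pos (one_half_pos : (0 : ℝ) < 1 / 2) n]
    rw [dist_eq_norm, EuclideanSpace.norm_eq]
    apply Real.sqrt_le_iff.2 ⟨by positivity, ?_⟩
    calc _ ≤ (∑ i, ‖(Z (gridPt n (floorIdx n u)) ω -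
            Z (gridPt (n + 1) (floorIdx (n + 1) u)) ω) i‖) ^ 2 :=
          Finset.sum_sq_le_sq_sum_of_nonneg (fun i _ => norm_nonneg _)
      _ ≤ (∑ _i : Fin d, K * r ^ n) ^ 2 := by
          gcongr with i _
          exact hK n _ hq i
      _ = _ := by
          rw [Finset.sum_const, Finset.card_univ, Fintype.card_fin, nsmul_eq_mul, mul_assoc]
  have hgrid : Filter.Tendsto (fun n => gridPt n (floorIdx n u)) Filter.atTop (nhds u) := by
    rw [tendsto_iff_dist_tendsto_zero]
    exact squeeze_zero (fun _ => dist_nonneg) (fun n => dist_gridPt_floorIdx_le n hu)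
      (tendsto_pow_atTop_nhds_zero_of_lt_one (by norm_num) (by norm_num))
  -- Path continuity identifies the limit of the chain of grid values with `Z u ω`, so the remaining
  -- distance is a geometric tail.
  have hlim := (hcont.tendsto u).comp hgrid
  have := dist_le_of_le_geometric_of_tendsto r (d * K) hr1 hstep hlim n
  rw [← dist_eq_norm, dist_comm]
  refine this.trans ?_
  rw [mul_div_right_comm]
  gcongr

/-- A dyadic modulus of continuity of order `η` bounds the dimension of the image by `N / η`. -/
lemma dimH_image_le_of_dyadic_modulus {E : Type*} [NormedAddCommGroup E] {f : (Fin N → ℝ) → E}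
    {η K : ℝ} (hη : 0 < η) (hK : 0 ≤ K)
    (h : ∀ n, ∀ u ∈ Set.Icc (0 : Fin N → ℝ) 1,
      ‖f u - f (gridPt n (floorIdx n u))‖ ≤ K * ((2 : ℝ) ^ (-η)) ^ n) :
    dimH (f '' Set.Icc 0 1) ≤ ENNReal.ofReal (N / η) := by
  borelize E
  set r : ℝ := (2 : ℝ) ^ (-η) with hr
  have hr1 : r < 1 := Real.rpow_lt_one_of_one_lt_of_neg one_lt_two (by linarith)
  have hr0 : 0 < r := by positivity
  have hs0 : (0 : ℝ) ≤ N / η := by positivity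
  have hmeas : Measure.hausdorffMeasure (N / η) (f '' Set.Icc 0 1) ≤
      ENNReal.ofReal (2 ^ N * (2 * K) ^ (N / η)) := by
    refine (Measure.hausdorffMeasure_le_liminf_sum (ι := fun n => Fin N → Fin (2 ^ n + 1)) (N / η)
      (f '' Set.Icc 0 1) (l := Filter.atTop) (fun n => ENNReal.ofReal (2 * K * r ^ n)) ?_
      (fun n z => f '' {u | u ∈ Set.Icc 0 1 ∧ floorIdx n u = z}) ?_ ?_).trans ?_
    · rw [← ENNReal.ofReal_zero]
      apply ENNReal.tendsto_ofReal
      rw [← mul_zero (2 * K)]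
      exact (tendsto_pow_atTop_nhds_zero_of_lt_one hr0.le hr1).const_mul _
    · refine Filter.Eventually.of_forall fun n z => Metric.ediam_le ?_
      rintro _ ⟨u, ⟨hu, huz⟩, rfl⟩ _ ⟨v, ⟨hv, hvz⟩, rfl⟩
      rw [edist_dist]
      apply ENNReal.ofReal_le_ofReal
      have h1 := h n u hu
      have h2 := h n v hv
      rw [huz, ← dist_eq_norm] at h1
      rw [hvz, ← dist_eq_norm] at h2
      linarith [dist_triangle_right (f u) (f v) (f (gridPt n z))]
    · refine Filter.Eventually.of_forall fun n => ?_
      rintro _ ⟨u, hu, rfl⟩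
      exact Set.mem_iUnion.2 ⟨floorIdx n u, u, ⟨hu, rfl⟩, rfl⟩
    · refine Filter.liminf_le_of_frequently_le' (Filter.Frequently.of_forall fun n => ?_)
      calc ∑ z : Fin N → Fin (2 ^ n + 1),
            Metric.ediam (f '' {u | u ∈ Set.Icc 0 1 ∧ floorIdx n u = z}) ^ ((N : ℝ) / η)
          ≤ ∑ _z : Fin N → Fin (2 ^ n + 1), ENNReal.ofReal ((2 * K * r ^ n) ^ ((N : ℝ) / η)) := by
            refine Finset.sum_le_sum fun z _ => ?_
            rw [← ENNReal.ofReal_rpow_of_nonneg (by positivity) hs0]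
            gcongr
            refine Metric.ediam_le ?_
            rintro _ ⟨u, ⟨hu, huz⟩, rfl⟩ _ ⟨v, ⟨hv, hvz⟩, rfl⟩
            rw [edist_dist]
            apply ENNReal.ofReal_le_ofReal
            have h1 := h n u hu
            have h2 := h n v hv
            rw [huz, ← dist_eq_norm] at h1
            rw [hvz, ← dist_eq_norm] at h2
            linarith [dist_triangle_right (f u) (f v) (f (gridPt n z))]
        _ = ENNReal.ofReal (Fintype.card (Fin N → Fin (2 ^ n + 1)) *
              (2 * K * r ^ n) ^ ((N : ℝ) / η)) := by
            rw [Finset.sum_const, Finset.card_univ, ENNReal.ofReal_mul (by positivity),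
              ENNReal.ofReal_natCast, nsmul_eq_mul]
        _ ≤ _ := by
            apply ENNReal.ofReal_le_ofReal
            -- The exponent `N / η` is the one at which the cell diameters exactly balance the
            -- number of cells, of order `2 ^ (n * N)`.
            have hrn : (r ^ n) ^ ((N : ℝ) / η) = ((2 ^ n) ^ N)⁻¹ := by
              rw [hr, ← Real.rpow_natCast, ← Real.rpow_mul (by positivity),
                ← Real.rpow_mul (by positivity), ← pow_mul, ← Real.rpow_natCast 2 (n * N),
                ← Real.rpow_neg (by norm_num)]
              congr 1
              push_cast
              field_simp
            rw [Real.mul_rpow (by positivity) (by positivity), hrn]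
            calc _ ≤ (2 * 2 ^ n) ^ N * ((2 * K) ^ ((N : ℝ) / η) * ((2 ^ n) ^ N)⁻¹) := by
                  gcongr
                  exact card_grid_le n
              _ = _ := by
                  rw [mul_pow]; field_simp
  have := dimH_le_of_hausdorffMeasure_ne_top (s := f '' Set.Icc 0 1) (d := (N / η).toNNReal) (by
    rw [Real.coe_toNNReal _ hs0]
    exact ne_top_of_le_ne_top ENNReal.ofReal_ne_top hmeas)
  exact this

lemma ae_dimH_image_le (hZ : UnitCubeField P Z κ α c C) {η : ℝ} (hη : 0 < η) (hηα : η < α) :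
    ∀ᵐ ω ∂P, dimH ((fun u => Z u ω) '' Set.Icc 0 1) ≤ ENNReal.ofReal (N / η) := by
  filter_upwards [hZ.ae_dyadic_modulus hη hηα] with ω ⟨K, hK⟩
  exact dimH_image_le_of_dyadic_modulus hη (Nat.cast_nonneg K) hK

end UnitCubeField

/-! ### Sets of small dimension are missed -/

/-- Economical covers of a set of Hausdorff measure zero. -/
lemma exists_cover_of_hausdorffMeasure_eq_zero {E : Type*} [MetricSpace E] [MeasurableSpace E]
    [BorelSpace E] {s : ℝ} (hs : 0 < s) {A : Set E} (hA : Measure.hausdorffMeasure s A = 0)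
    {ε : ℝ≥0∞} (hε : ε ≠ 0) :
    ∃ (t : ℕ → Set E) (r : ℕ → ℝ), A ⊆ ⋃ n, t n ∧ (∀ n, 0 < r n ∧ r n ≤ 1) ∧
      (∀ n, ∀ x ∈ t n, ∀ y ∈ t n, dist x y ≤ r n) ∧ ∑' n, ENNReal.ofReal (r n ^ s) ≤ ε := by
  have hε2 : ε / 2 ≠ 0 := by simpa using hε
  rw [Measure.hausdorffMeasure_apply] at hA
  have hA' := (ENNReal.iSup_eq_zero.1 (ENNReal.iSup_eq_zero.1 hA (1 / 2))) (by norm_num)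
  have hlt : (⨅ (t : ℕ → Set E) (_ : A ⊆ ⋃ n, t n) (_ : ∀ n, Metric.ediam (t n) ≤ 1 / 2),
      ∑' n, ⨆ _ : (t n).Nonempty, Metric.ediam (t n) ^ s) < ε / 2 := by
    rw [hA']; exact pos_iff_ne_zero.2 hε2
  simp only [iInf_lt_iff] at hlt
  obtain ⟨t, hAt, htd, htsum⟩ := hlt
  -- Covering sets may have diameter zero. Enlarging each to a strictly positive radius costs at
  -- most `δ n` in the sum, hence `ε / 2` in total.
  obtain ⟨δ, hδ0, hδ⟩ := ENNReal.exists_pos_sum_of_countable hε2 ℕ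
  have hdiam : ∀ n, ∃ r : ℝ, 0 < r ∧ r ≤ 1 ∧ Metric.ediam (t n) ≤ ENNReal.ofReal r ∧
      r ^ s ≤ (Metric.ediam (t n)).toReal ^ s + δ n := by
    intro n
    set D := (Metric.ediam (t n)).toReal with hD
    have hne : Metric.ediam (t n) ≠ ∞ := ne_top_of_le_ne_top (by norm_num) (htd n)
    have hD1 : D ≤ 1 / 2 := by
      have := ENNReal.toReal_mono (by norm_num) (htd n)
      simpa using this
    have hcont : Filter.Tendsto (fun r : ℝ => r ^ s) (nhds D) (nhds (D ^ s)) :=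
      (Real.continuousAt_rpow_const D s (Or.inr hs.le)).tendsto
    have hev := (hcont.eventually (gt_mem_nhds (by
      have := hδ0 n
      have : (0 : ℝ) < δ n := by exact_mod_cast this
      linarith : D ^ s < D ^ s + δ n)))
    obtain ⟨r, hr1, hr2⟩ : ∃ r, r ^ s < D ^ s + δ n ∧ D < r ∧ r < 1 := by
      have h2 : ∀ᶠ r in nhdsWithin D (Set.Ioi D), r < 1 :=
        nhdsWithin_le_nhds (gt_mem_nhds (by linarith))
      have h3 : ∀ᶠ r in nhdsWithin D (Set.Ioi D), D < r := self_mem_nhdsWithin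
      obtain ⟨r, h⟩ := ((hev.filter_mono nhdsWithin_le_nhds).and (h3.and h2)).exists
      exact ⟨r, h⟩
    refine ⟨r, lt_of_le_of_lt ENNReal.toReal_nonneg hr2.1, hr2.2.le, ?_, hr1.le⟩
    rw [← ENNReal.ofReal_toReal hne]
    exact ENNReal.ofReal_le_ofReal hr2.1.le
  choose r hr0 hr1 hrd hrs using hdiam
  refine ⟨t, r, hAt, fun n => ⟨hr0 n, hr1 n⟩, fun n x hx y hy => ?_, ?_⟩
  · have := (Metric.edist_le_ediam_of_mem hx hy).trans (hrd n)
    rwa [edist_dist, ENNReal.ofReal_le_ofReal_iff (hr0 n).le] at this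
  · calc ∑' n, ENNReal.ofReal (r n ^ s)
        ≤ ∑' n, ((⨆ _ : (t n).Nonempty, Metric.ediam (t n) ^ s) + δ n) := by
          refine ENNReal.tsum_le_tsum fun n => ?_
          have hne : Metric.ediam (t n) ≠ ∞ := ne_top_of_le_ne_top (by norm_num) (htd n)
          refine (ENNReal.ofReal_le_ofReal (hrs n)).trans ?_
          rw [ENNReal.ofReal_add (by positivity) (by positivity), ENNReal.ofReal_coe_nnreal]
          gcongr
          rw [← ENNReal.ofReal_rpow_of_nonneg ENNReal.toReal_nonneg hs.le,
            ENNReal.ofReal_toReal hne]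
          rcases (t n).eq_empty_or_nonempty with h | h
          · simp [h, hs]
          · exact le_iSup_of_le h le_rfl
      _ = (∑' n, ⨆ _ : (t n).Nonempty, Metric.ediam (t n) ^ s) + ∑' n, (δ n : ℝ≥0∞) :=
          ENNReal.tsum_add
      _ ≤ ε / 2 + ε / 2 := add_le_add htsum.le hδ.le
      _ = ε := ENNReal.add_halves ε

namespace UnitCubeField

variable {Ω : Type*} {m : MeasurableSpace Ω} {P : Measure Ω} {N d : ℕ}
  {Z : (Fin N → ℝ) → Ω → EuclideanSpace ℝ (Fin d)} {κ : (Fin N → ℝ) → (Fin N → ℝ) → ℝ}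
  {α c C : ℝ}

/-- The field does not hit sets of dimension less than `d - N / η`, `η < α`. -/
lemma measure_hit_eq_zero (hZ : UnitCubeField P Z κ α c C) {η : ℝ} (hη : 0 < η) (hηα : η < α)
    (hs : 0 < (d : ℝ) - N / η) {A : Set (EuclideanSpace ℝ (Fin d))}
    (hA : Measure.hausdorffMeasure ((d : ℝ) - N / η) A = 0) :
    P {ω | ∃ u ∈ Set.Icc (0 : Fin N → ℝ) 1, Z u ω ∈ A} = 0 := by
  set ρ : ℝ := (2 : ℝ) ^ (-η) with hρ
  have hρ1 : ρ < 1 := Real.rpow_lt_one_of_one_lt_of_neg one_lt_two (by linarith)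
  have hρ0 : 0 < ρ := by positivity
  have hc := hZ.c_pos
  set O : ℕ → Set Ω := fun K => {ω | ∀ n, ∀ u ∈ Set.Icc (0 : Fin N → ℝ) 1,
      ‖Z u ω - Z (gridPt n (floorIdx n u)) ω‖ ≤ K * ρ ^ n} with hO
  set Q : Set Ω := {ω | ∃ u ∈ Set.Icc (0 : Fin N → ℝ) 1, Z u ω ∈ A} with hQ
  have hball : ∀ (K : ℕ) (T : Set (EuclideanSpace ℝ (Fin d))) (r : ℝ), 0 < r → r ≤ 1 →
      (∀ x ∈ T, ∀ y ∈ T, dist x y ≤ r) →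
      P {ω | ω ∈ O K ∧ ∃ u ∈ Set.Icc (0 : Fin N → ℝ) 1, Z u ω ∈ T} ≤
        ENNReal.ofReal (4 ^ N * ((1 + K) / √c) ^ d) * ENNReal.ofReal (r ^ ((d : ℝ) - N / η)) := by
    intro K T r hr0 hr1 hT
    rcases T.eq_empty_or_nonempty with rfl | ⟨x, hx⟩
    · simp
    -- Here `ρ ^ (n + 1) < r ≤ ρ ^ n`: generation `n + 1` is fine enough for the modulus to be below
    -- `K * r`, while the second inequality keeps the number of grid points of order `r ^ (-N / η)`.
    obtain ⟨n, hn1, hn2⟩ := exists_nat_pow_near_of_lt_one hr0 hr1 hρ0 hρ1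
    calc P {ω | ω ∈ O K ∧ ∃ u ∈ Set.Icc (0 : Fin N → ℝ) 1, Z u ω ∈ T}
        ≤ P (⋃ z ∈ (Finset.univ : Finset (Fin N → Fin (2 ^ (n + 1) + 1))),
            {ω | ‖Z (gridPt (n + 1) z) ω - x‖ ≤ (1 + K) * r}) := by
          apply measure_mono
          rintro ω ⟨hω, u, hu, huT⟩
          simp only [Set.mem_iUnion]
          refine ⟨floorIdx (n + 1) u, Finset.mem_univ _, ?_⟩
          have h1 := hω (n + 1) u hu
          have h2 := hT _ huT x hx
          rw [← dist_eq_norm] at h1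
          have h3 : (K : ℝ) * ρ ^ (n + 1) ≤ K * r := by gcongr
          have := dist_triangle_left (Z (gridPt (n + 1) (floorIdx (n + 1) u)) ω) x (Z u ω)
          rw [Set.mem_ofPred_eq, ← dist_eq_norm]
          linarith
      _ ≤ ∑ z : Fin N → Fin (2 ^ (n + 1) + 1),
            P {ω | ‖Z (gridPt (n + 1) z) ω - x‖ ≤ (1 + K) * r} := measure_biUnion_finset_le _ _
      _ ≤ ∑ _z : Fin N → Fin (2 ^ (n + 1) + 1), ENNReal.ofReal (((1 + K) * r / √c) ^ d) :=
          Finset.sum_le_sum fun z _ => hZ.measure_ball_le (gridPt_mem _ _) x (by positivity)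
      _ = ENNReal.ofReal (Fintype.card (Fin N → Fin (2 ^ (n + 1) + 1)) *
            ((1 + K) * r / √c) ^ d) := by
          rw [Finset.sum_const, Finset.card_univ, ENNReal.ofReal_mul (by positivity),
              ENNReal.ofReal_natCast, nsmul_eq_mul]
      _ ≤ _ := by
          rw [← ENNReal.ofReal_mul (by positivity)]
          apply ENNReal.ofReal_le_ofReal
          have h2n : (2 : ℝ) ^ n ≤ r ^ (-(1 / η)) := by
            have : (2 : ℝ) ^ n = (ρ ^ n) ^ (-(1 / η)) := by
              rw [hρ, ← Real.rpow_natCast ((2 : ℝ) ^ (-η)), ← Real.rpow_mul (by positivity),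
                ← Real.rpow_mul (by positivity), ← Real.rpow_natCast]
              congr 1
              field_simp
            rw [this]
            exact Real.rpow_le_rpow_of_nonpos hr0 hn2 (by
              rw [neg_nonpos]; positivity)
          have hrr : (r ^ (-(1 / η))) ^ N * r ^ d = r ^ ((d : ℝ) - N / η) := by
            rw [← Real.rpow_natCast, ← Real.rpow_natCast, ← Real.rpow_mul hr0.le,
              ← Real.rpow_add hr0]
            congr 1
            ring
          calc _ ≤ (2 * 2 ^ (n + 1)) ^ N * ((1 + K) * r / √c) ^ d := by
                gcongr
                exact card_grid_le _
            _ = (4 * 2 ^ n) ^ N * (((1 + K) / √c) ^ d * r ^ d) := by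
                rw [← mul_pow ((1 + K) / √c), pow_succ]
                ring_nf
            _ ≤ (4 * r ^ (-(1 / η))) ^ N * (((1 + K) / √c) ^ d * r ^ d) := by gcongr
            _ = _ := by
                rw [← hrr, mul_pow]; ring
  have hK : ∀ K, P (O K ∩ Q) = 0 := by
    intro K
    set B := ENNReal.ofReal (4 ^ N * ((1 + K) / √c) ^ d) with hB
    refine le_antisymm (ENNReal.le_of_forall_pos_le_add fun ε hε _ => ?_) zero_le
    rw [zero_add]
    have hBtop : B ≠ ∞ := ENNReal.ofReal_ne_top
    have hεB : (ε : ℝ≥0∞) / B ≠ 0 := by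
      simp only [ne_eq, ENNReal.div_eq_zero_iff, not_or]
      exact ⟨by exact_mod_cast hε.ne', hBtop⟩
    obtain ⟨t, r, hAt, hr, hdist, hsum⟩ := exists_cover_of_hausdorffMeasure_eq_zero hs hA hεB
    calc P (O K ∩ Q) ≤ P (⋃ n, {ω | ω ∈ O K ∧ ∃ u ∈ Set.Icc (0 : Fin N → ℝ) 1, Z u ω ∈ t n}) := by
          apply measure_mono
          rintro ω ⟨hω, u, hu, huA⟩
          obtain ⟨n, hn⟩ := Set.mem_iUnion.1 (hAt huA)
          exact Set.mem_iUnion.2 ⟨n, hω, u, hu, hn⟩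
      _ ≤ ∑' n, P {ω | ω ∈ O K ∧ ∃ u ∈ Set.Icc (0 : Fin N → ℝ) 1, Z u ω ∈ t n} :=
          measure_iUnion_le _
      _ ≤ ∑' n, B * ENNReal.ofReal (r n ^ ((d : ℝ) - N / η)) :=
          ENNReal.tsum_le_tsum fun n => hball K (t n) (r n) (hr n).1 (hr n).2 (hdist n)
      _ = B * ∑' n, ENNReal.ofReal (r n ^ ((d : ℝ) - N / η)) := ENNReal.tsum_mul_left
      _ ≤ B * (ε / B) := by gcongr
      _ ≤ ε := ENNReal.mul_div_le
  -- Outside the null event where no integer modulus constant works, one of the events `O K` holds.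
  have hcov : Q ⊆ (⋃ K, O K ∩ Q) ∪ {ω | ∃ K : ℕ, ω ∈ O K}ᶜ := by
    intro ω hω
    by_cases h : ∃ K : ℕ, ω ∈ O K
    · obtain ⟨K, hK⟩ := h
      exact Or.inl (Set.mem_iUnion.2 ⟨K, hK, hω⟩)
    · exact Or.inr h
  refine measure_mono_null hcov (measure_union_null (measure_iUnion_null hK) ?_)
  exact hZ.ae_dyadic_modulus hη hηα

end UnitCubeField

/-! ### Integrability of the Riesz kernel on the cube -/

section SingularIntegral

lemma ENNReal.rpow_neg_anti {x y : ℝ≥0∞} (h : x ≤ y) {θ : ℝ} (hθ : 0 ≤ θ) :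
    y ^ (-θ) ≤ x ^ (-θ) := by
  rw [ENNReal.rpow_neg, ENNReal.rpow_neg]
  exact ENNReal.inv_le_inv.2 (ENNReal.rpow_le_rpow h hθ)

lemma lintegral_enorm_rpow_neg_lt_top {θ : ℝ} (hθ1 : θ < 1) :
    ∫⁻ x in Set.Icc (0 : ℝ) 1, ‖x‖ₑ ^ (-θ) < ∞ := by
  rw [setLIntegral_congr Ioc_ae_eq_Icc.symm]
  have h := (intervalIntegral.intervalIntegrable_rpow' (a := 0) (b := 1) (r := -θ)
    (by linarith)).1
  refine lt_of_le_of_lt (le_of_eq ?_) h.lintegral_lt_top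
  refine setLIntegral_congr_fun measurableSet_Ioc fun x hx => ?_
  rw [Real.enorm_eq_ofReal hx.1.le, ENNReal.ofReal_rpow_of_pos hx.1]

/-- Differences of points of the unit interval lie in `[-1, 1]`, so reflection and translation
invariance bound the potential at every `y` by twice the integral over `[0, 1]`. -/
lemma exists_lintegral_edist_rpow_neg_le_real {θ : ℝ} (hθ1 : θ < 1) :
    ∃ I : ℝ≥0∞, I ≠ ∞ ∧ ∀ y ∈ Set.Icc (0 : ℝ) 1,
      ∫⁻ x in Set.Icc (0 : ℝ) 1, edist x y ^ (-θ) ≤ I := by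
  set h : ℝ → ℝ≥0∞ := (Set.Icc (0 : ℝ) 1).indicator fun z => ‖z‖ₑ ^ (-θ) with hh
  have hm : Measurable h := (by fun_prop : Measurable fun z : ℝ => ‖z‖ₑ ^ (-θ)).indicator
    measurableSet_Icc
  have hfin : ∫⁻ z, h z ≠ ∞ := by
    rw [hh, lintegral_indicator measurableSet_Icc]
    exact (lintegral_enorm_rpow_neg_lt_top hθ1).ne
  refine ⟨2 * ∫⁻ z, h z, ENNReal.mul_ne_top (by norm_num) hfin, fun y hy => ?_⟩
  calc ∫⁻ x in Set.Icc (0 : ℝ) 1, edist x y ^ (-θ)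
      ≤ ∫⁻ x in Set.Icc (0 : ℝ) 1, (h (x - y) + h (-(x - y))) := by
        refine setLIntegral_mono' measurableSet_Icc fun x hx => ?_
        rw [edist_eq_enorm_sub]
        rcases le_total 0 (x - y) with hxy | hxy
        · refine le_add_right (le_of_eq ?_)
          rw [hh, Set.indicator_of_mem]
          exact ⟨hxy, by linarith [hx.2, hy.1]⟩
        · refine le_add_left (le_of_eq ?_)
          rw [hh, Set.indicator_of_mem, enorm_neg]
          exact ⟨by linarith, by linarith [hx.1, hy.2]⟩
    _ ≤ ∫⁻ x, (h (x - y) + h (-(x - y))) := setLIntegral_le_lintegral _ _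
    _ = ∫⁻ z, (h z + h (-z)) := lintegral_sub_right_eq_self (fun z => h z + h (-z)) y
    _ = (∫⁻ z, h z) + ∫⁻ z, h (-z) := lintegral_add_left hm _
    _ = 2 * ∫⁻ z, h z := by rw [lintegral_neg_eq_self, two_mul]

/-- Lebesgue measure on the unit cube. -/
noncomputable abbrev cubeMeasure (N : ℕ) : Measure (Fin N → ℝ) :=
  Measure.pi fun _ => (volume : Measure ℝ).restrict (Set.Icc 0 1)

instance isProbabilityMeasure_restrict_Icc :
    IsProbabilityMeasure ((volume : Measure ℝ).restrict (Set.Icc 0 1)) :=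
  ⟨by simp⟩

lemma ae_cubeMeasure_mem (N : ℕ) : ∀ᵐ u ∂(cubeMeasure N), u ∈ Set.Icc (0 : Fin N → ℝ) 1 := by
  rw [cubeMeasure, ← Measure.restrict_pi_pi, Set.pi_univ_Icc]
  exact ae_restrict_mem measurableSet_Icc

/-- The Riesz kernel of order `θ < N` is uniformly integrable over the unit cube. -/
lemma exists_lintegral_edist_rpow_neg_le {N : ℕ} {θ : ℝ} (hθ0 : 0 ≤ θ) (hθ1 : θ < N) :
    ∃ I : ℝ≥0∞, I ≠ ∞ ∧ ∀ v ∈ Set.Icc (0 : Fin N → ℝ) 1,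
      ∫⁻ u, edist u v ^ (-θ) ∂(cubeMeasure N) ≤ I := by
  have hN : (0 : ℝ) < N := hθ0.trans_lt hθ1
  obtain ⟨I, hI, H⟩ := exists_lintegral_edist_rpow_neg_le_real
    ((div_lt_one hN).2 hθ1)
  refine ⟨I ^ N, ENNReal.pow_ne_top hI, fun v hv => ?_⟩
  have hm : ∀ k : Fin N, Measurable fun x : ℝ => edist x (v k) ^ (-(θ / N)) := by
    intro k
    fun_prop
  calc ∫⁻ u, edist u v ^ (-θ) ∂(cubeMeasure N)
      ≤ ∫⁻ u, ∏ k, edist (u k) (v k) ^ (-(θ / N)) ∂(cubeMeasure N) := by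
        refine lintegral_mono fun u => ?_
        -- The sup distance dominates each coordinate distance, so the kernel is at most a product
        -- of one-dimensional kernels of order `θ / N < 1`, to which Tonelli applies.
        calc edist u v ^ (-θ) = ∏ _k : Fin N, edist u v ^ (-(θ / N)) := by
              rw [Finset.prod_const, Finset.card_univ, Fintype.card_fin, ← ENNReal.rpow_natCast,
                ← ENNReal.rpow_mul]
              congr 1
              field_simp
          _ ≤ _ := Finset.prod_le_prod' fun k _ =>
              ENNReal.rpow_neg_anti (edist_le_pi_edist u v k) (by positivity)
    _ = ∏ k, ∫⁻ u, edist (u k) (v k) ^ (-(θ / N)) ∂(cubeMeasure N) := by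
        refine lintegral_prod_eq_prod_lintegral_of_indepFun Finset.univ
          (fun k (u : Fin N → ℝ) => edist (u k) (v k) ^ (-(θ / N))) ?_
          fun k => (hm k).comp (measurable_pi_apply k)
        exact iIndepFun_pi fun k => (hm k).aemeasurable
    _ = ∏ k, ∫⁻ x in Set.Icc (0 : ℝ) 1, edist x (v k) ^ (-(θ / N)) := by
        refine Finset.prod_congr rfl fun k _ => ?_
        exact (measurePreserving_eval (fun _ : Fin N => (volume : Measure ℝ).restrict (Set.Icc 0 1))
          k).lintegral_comp (hm k)
    _ ≤ ∏ _k : Fin N, I := Finset.prod_le_prod' fun k _ => H _ ⟨hv.1 k, hv.2 k⟩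
    _ = I ^ N := by simp

end SingularIntegral

/-! ### Occupation measures and the lower bound for the image dimension -/

section MassDistribution

/-- If the occupation measure of a continuous function on the unit cube has upper local dimension
at least `β` almost everywhere, its image has dimension at least `β`. -/
lemma le_dimH_image_of_occupation {N d : ℕ} {f : (Fin N → ℝ) → EuclideanSpace ℝ (Fin d)}
    (hf : Continuous f) {β : ℝ} (hβ : 0 < β)
    (h : ∀ᵐ v ∂(cubeMeasure N), ∃ K : ℕ, ∀ n : ℕ,
      cubeMeasure N {u | ‖f u - f v‖ ≤ (1 / 2) ^ n} ≤ K * ENNReal.ofReal (((1 / 2) ^ n) ^ β)) :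
    ENNReal.ofReal β ≤ dimH (f '' Set.Icc 0 1) := by
  set lam := cubeMeasure N with hlam
  set S : ℕ → Set (Fin N → ℝ) := fun K => {v | v ∈ Set.Icc 0 1 ∧ ∀ n : ℕ,
    lam {u | ‖f u - f v‖ ≤ (1 / 2) ^ n} ≤ K * ENNReal.ofReal (((1 / 2) ^ n) ^ β)} with hS
  obtain ⟨K, hK⟩ : ∃ K, lam (S K) ≠ 0 := by
    by_contra! hcon
    have h0 : lam (⋃ K, S K) = 0 := measure_iUnion_null hcon
    have h1 : ∀ᵐ v ∂lam, v ∈ ⋃ K, S K := by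
      filter_upwards [h, ae_cubeMeasure_mem N] with v ⟨K, hK⟩ hv
      exact Set.mem_iUnion.2 ⟨K, hv, hK⟩
    have h2 : lam Set.univ = 0 := by
      refine measure_mono_null (t := (⋃ K, S K) ∪ (⋃ K, S K)ᶜ)
        (Set.union_compl_self _).ge ?_
      exact measure_union_null h0 h1
    simp [hlam] at h2
  -- `2 ^ β` pays for rounding a diameter up to a power of `1 / 2`, and `K + 1` guarantees that `K'`
  -- is invertible.
  set K' : ℝ≥0∞ := (K + 1) * ENNReal.ofReal (2 ^ β) with hK'
  have hK'0 : K' ≠ 0 := by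
    rw [hK']
    refine mul_ne_zero (by positivity) ?_
    simp only [ne_eq, ENNReal.ofReal_eq_zero, not_le]
    positivity
  have hK't : K' ≠ ∞ := by
    rw [hK']
    exact ENNReal.mul_ne_top (by simp) ENNReal.ofReal_ne_top
  set μ : Measure (EuclideanSpace ℝ (Fin d)) := K'⁻¹ • (lam.restrict (S K)).map f with hμ
  have hle : μ ≤ Measure.hausdorffMeasure β := by
    refine Measure.le_hausdorffMeasure β μ 1 one_pos fun s hs => ?_
    have hcl : MeasurableSet (closure s) := isClosed_closure.measurableSet
    have key : (lam.restrict (S K)).map f (closure s) ≤ K' * Metric.ediam s ^ β := by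
      rw [Measure.map_apply hf.measurable hcl,
        Measure.restrict_apply (hf.measurable hcl)]
      rcases (f ⁻¹' closure s ∩ S K).eq_empty_or_nonempty with he | ⟨v, hv, -, hvS⟩
      · rw [he]; simp
      have hstep : ∀ n : ℕ, Metric.ediam s ≤ ENNReal.ofReal ((1 / 2) ^ n) →
          lam (f ⁻¹' closure s ∩ S K) ≤ (K + 1) * ENNReal.ofReal (((1 / 2) ^ n) ^ β) := by
        intro n hn
        refine (measure_mono ?_).trans ((hvS n).trans ?_)
        · rintro u ⟨hu, -⟩
          have := (Metric.edist_le_ediam_of_mem (Set.mem_preimage.1 hu)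
            (Set.mem_preimage.1 hv)).trans ((Metric.ediam_closure s).le.trans hn)
          rwa [edist_dist, ENNReal.ofReal_le_ofReal_iff (by positivity), dist_eq_norm] at this
        · gcongr
          exact le_self_add
      have hne : Metric.ediam s ≠ ∞ := ne_top_of_le_ne_top ENNReal.one_ne_top hs
      set D := (Metric.ediam s).toReal with hD
      have hDs : Metric.ediam s = ENNReal.ofReal D := (ENNReal.ofReal_toReal hne).symm
      have hD1 : D ≤ 1 := by
        have := ENNReal.toReal_mono ENNReal.one_ne_top hs
        simpa using this
      -- For a set of diameter zero no single scale is sharp; letting `n` tend to infinity shows it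
      -- carries no mass.
      rcases eq_or_lt_of_le (ENNReal.toReal_nonneg : 0 ≤ D) with hD0 | hD0
      · have hlim : Filter.Tendsto (fun n : ℕ => ((K : ℝ≥0∞) + 1) *
            ENNReal.ofReal (((1 / 2 : ℝ) ^ n) ^ β)) Filter.atTop (nhds ((K + 1) * 0)) := by
          refine ENNReal.Tendsto.const_mul ?_ (Or.inr (by simp))
          rw [← ENNReal.ofReal_zero]
          apply ENNReal.tendsto_ofReal
          have := (tendsto_pow_atTop_nhds_zero_of_lt_one (by norm_num : (0 : ℝ) ≤ 1 / 2)
            (by norm_num)).rpow_const (Or.inr hβ.le : (0 : ℝ) ≠ 0 ∨ 0 ≤ β)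
          rwa [Real.zero_rpow hβ.ne'] at this
        rw [mul_zero] at hlim
        have := ge_of_tendsto' hlim fun n => hstep n (by rw [hDs, hD, ← hD0]; simp)
        exact this.trans zero_le
      · obtain ⟨n, hn1, hn2⟩ := exists_nat_pow_near_of_lt_one hD0 hD1
          (by norm_num : (0 : ℝ) < 1 / 2) (by norm_num)
        refine (hstep n (by rw [hDs]; exact ENNReal.ofReal_le_ofReal hn2)).trans ?_
        rw [hK', mul_assoc, hDs, ENNReal.ofReal_rpow_of_pos hD0, ← ENNReal.ofReal_mul (by positivity),
          ← Real.mul_rpow (by norm_num) hD0.le]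
        gcongr
        rw [pow_succ] at hn1
        linarith
    calc μ s ≤ μ (closure s) := measure_mono subset_closure
      _ = K'⁻¹ * (lam.restrict (S K)).map f (closure s) := by
          rw [hμ, Measure.smul_apply, smul_eq_mul]
      _ ≤ K'⁻¹ * (K' * Metric.ediam s ^ β) := by gcongr
      _ = Metric.ediam s ^ β := by
          rw [← mul_assoc, ENNReal.inv_mul_cancel hK'0 hK't, one_mul]
  have hpos : Measure.hausdorffMeasure β (f '' Set.Icc 0 1) ≠ 0 := by
    intro h0
    have h1 : μ (f '' Set.Icc 0 1) = 0 := le_antisymm ((hle _).trans h0.le) zero_le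
    have hmeas : MeasurableSet (f '' Set.Icc 0 1) :=
      (isCompact_Icc.image hf).isClosed.measurableSet
    rw [hμ, Measure.smul_apply, smul_eq_mul, mul_eq_zero, ENNReal.inv_eq_zero,
      Measure.map_apply hf.measurable hmeas, Measure.restrict_apply (hf.measurable hmeas)] at h1
    refine h1.elim hK't fun h2 => hK (measure_mono_null ?_ h2)
    exact fun v hv => ⟨⟨v, hv.1, rfl⟩, hv⟩
  have := le_dimH_of_hausdorffMeasure_ne_zero (s := f '' Set.Icc 0 1) (d := β.toNNReal)
    (by rwa [Real.coe_toNNReal _ hβ.le])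
  exact this

end MassDistribution

namespace UnitCubeField

variable {Ω : Type*} {m : MeasurableSpace Ω} {P : Measure Ω} {N d : ℕ}
  {Z : (Fin N → ℝ) → Ω → EuclideanSpace ℝ (Fin d)} {κ : (Fin N → ℝ) → (Fin N → ℝ) → ℝ}
  {α c C : ℝ}

/-- A version of the field all of whose paths are continuous. -/
lemma exists_continuous_version (hZ : UnitCubeField P Z κ α c C) :
    ∃ Z' : (Fin N → ℝ) → Ω → EuclideanSpace ℝ (Fin d), UnitCubeField P Z' κ α c C ∧
      (∀ ω, Continuous fun u => Z' u ω) ∧ ∀ᵐ ω ∂P, ∀ u, Z' u ω = Z u ω := by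
  classical
  -- Paths are set to zero on a measurable null set containing all the discontinuous ones, which
  -- preserves measurability at each parameter.
  obtain ⟨T, hT, hTm, hT0⟩ := exists_measurable_superset_of_null (ae_iff.1 hZ.continuous)
  set Z' : (Fin N → ℝ) → Ω → EuclideanSpace ℝ (Fin d) := fun u => Tᶜ.indicator (Z u) with hZ'
  have heq : ∀ ω ∉ T, ∀ u, Z' u ω = Z u ω := fun ω hω u => Set.indicator_of_mem (by exact hω) _
  have hae : ∀ᵐ ω ∂P, ∀ u, Z' u ω = Z u ω := by
    have : ∀ᵐ ω ∂P, ω ∉ T := measure_eq_zero_iff_ae_notMem.1 hT0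
    filter_upwards [this] with ω hω using heq ω hω
  have haeu : ∀ u, Z u =ᵐ[P] Z' u := fun u => by
    filter_upwards [hae] with ω hω using (hω u).symm
  have hcont : ∀ ω, Continuous fun u => Z' u ω := by
    intro ω
    by_cases hω : ω ∈ T
    · have : (fun u => Z' u ω) = fun _ => 0 := by
        ext1 u; exact Set.indicator_of_notMem (by simpa using hω) _
      rw [this]; exact continuous_const
    · have : (fun u => Z' u ω) = fun u => Z u ω := by ext1 u; exact heq ω hω u
      rw [this]
      by_contra hcon
      exact hω (hT hcon)
  refine ⟨Z', ?_, hcont, hae⟩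
  exact
    { c_pos := hZ.c_pos
      C_pos := hZ.C_pos
      α_pos := hZ.α_pos
      measurable := fun u => (hZ.measurable u).indicator hTm.compl
      continuous := Filter.Eventually.of_forall hcont
      indep := by
        refine hZ.indep.congr fun i => ?_
        filter_upwards [hae] with ω hω
        ext1 u
        rw [hω u]
      gaussian := fun u v => (hZ.gaussian u v).congr ((haeu u).prodMk (haeu v))
      mean := fun u i => by
        rw [← hZ.mean u i]
        refine integral_congr_ae ?_
        filter_upwards [hae] with ω hω
        rw [hω u]
      cov := fun i u hu v hv => by
        rw [← hZ.cov i u hu v hv]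
        refine integral_congr_ae ?_
        filter_upwards [hae] with ω hω
        rw [hω u, hω v]
      le_var := hZ.le_var
      var_le := hZ.var_le
      le_condVar := hZ.le_condVar
      condVar_le := hZ.condVar_le
      regression := hZ.regression }

/-- Interpolated small ball estimate for the increments. -/
lemma measure_sub_ball_le_edist [IsProbabilityMeasure P] (hZ : UnitCubeField P Z κ α c C)
    {β : ℝ} (hβ0 : 0 < β) (hβd : β ≤ d) {u v : Fin N → ℝ}
    (hu : u ∈ Set.Icc 0 1) (hv : v ∈ Set.Icc 0 1) {r : ℝ} (hr : 0 < r) :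
    P {ω | ‖Z u ω - Z v ω‖ ≤ r} ≤
      ENNReal.ofReal ((r / √c) ^ β) * edist u v ^ (-(α * β)) := by
  have hc := hZ.c_pos
  have hα := hZ.α_pos
  rcases eq_or_ne u v with rfl | huv
  · rw [edist_self, ENNReal.zero_rpow_of_neg (by rw [neg_lt_zero]; positivity), ENNReal.mul_top]
    · exact le_top
    · simp only [ne_eq, ENNReal.ofReal_eq_zero, not_le]; positivity
  · have hdist : 0 < dist u v := dist_pos.2 huv
    set q := r / (√c * dist u v ^ α) with hq
    have hq0 : 0 < q := by positivity
    -- A probability bounded by both `1` and `q ^ d` is bounded by every `q ^ β` with `0 < β ≤ d`.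
    have h1 : P {ω | ‖Z u ω - Z v ω‖ ≤ r} ≤ ENNReal.ofReal (q ^ β) := by
      rcases le_total q 1 with h | h
      · refine (hZ.measure_sub_ball_le hu hv huv hr.le).trans (ENNReal.ofReal_le_ofReal ?_)
        rw [← hq, ← Real.rpow_natCast]
        exact Real.rpow_le_rpow_of_exponent_ge hq0 h hβd
      · refine prob_le_one.trans ?_
        rw [← ENNReal.ofReal_one]
        exact ENNReal.ofReal_le_ofReal (Real.one_le_rpow h hβ0.le)
    refine h1.trans (le_of_eq ?_)
    rw [edist_dist, ENNReal.ofReal_rpow_of_pos hdist, ← ENNReal.ofReal_mul (by positivity)]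
    congr 1
    rw [hq, ← div_div, Real.div_rpow (by positivity) (by positivity), Real.rpow_neg hdist.le,
      Real.rpow_mul hdist.le, div_eq_mul_inv]

/-- Almost surely the image of the unit cube has dimension at least `β`, for each `β < N / α`. -/
lemma ae_le_dimH_image [IsProbabilityMeasure P] (hZ : UnitCubeField P Z κ α c C)
    {β : ℝ} (hβ0 : 0 < β) {β' : ℝ} (hββ' : β < β') (hβd : β' ≤ d) (hβN : α * β' < N) :
    ∀ᵐ ω ∂P, ENNReal.ofReal β ≤ dimH ((fun u => Z u ω) '' Set.Icc 0 1) := by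
  -- Continuity of every path makes the field jointly measurable, as Tonelli requires.
  obtain ⟨Z', hZ', hcont, hae⟩ := hZ.exists_continuous_version
  suffices h : ∀ᵐ ω ∂P, ENNReal.ofReal β ≤ dimH ((fun u => Z' u ω) '' Set.Icc 0 1) by
    filter_upwards [h, hae] with ω h1 h2
    have : (fun u => Z' u ω) = fun u => Z u ω := by ext1 u; exact h2 u
    rwa [this] at h1
  have hα := hZ.α_pos
  have hc := hZ.c_pos
  have hβ'0 : 0 < β' := hβ0.trans hββ'
  obtain ⟨I, hI, HI⟩ := exists_lintegral_edist_rpow_neg_le (N := N) (θ := α * β') (by positivity) hβN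
  set lam := cubeMeasure N with hlam
  have hjoint : Measurable (Function.uncurry Z') :=
    measurable_uncurry_of_continuous_of_measurable hcont hZ'.measurable
  set S : ℕ → Set (((Fin N → ℝ) × Ω) × (Fin N → ℝ)) :=
    fun n => {q | ‖Z' q.2 q.1.2 - Z' q.1.1 q.1.2‖ ≤ (1 / 2) ^ n} with hS
  have hSm : ∀ n, MeasurableSet (S n) := by
    intro n
    have h1 : Measurable fun q : ((Fin N → ℝ) × Ω) × (Fin N → ℝ) => Z' q.2 q.1.2 :=
      hjoint.comp (measurable_snd.prodMk (measurable_snd.comp measurable_fst))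
    have h2 : Measurable fun q : ((Fin N → ℝ) × Ω) × (Fin N → ℝ) => Z' q.1.1 q.1.2 :=
      hjoint.comp measurable_fst
    exact measurableSet_le (h1.sub h2).norm measurable_const
  set g : ℕ → (Fin N → ℝ) × Ω → ℝ≥0∞ := fun n q =>
    ENNReal.ofReal ((2 ^ n) ^ β) * lam {u | ‖Z' u q.2 - Z' q.1 q.2‖ ≤ (1 / 2) ^ n} with hg
  have hgm : ∀ n, Measurable (g n) := fun n =>
    (measurable_measure_prodMk_left (hSm n)).const_mul _
  -- The small ball bound is used at order `β'` against weights of order `β`; the gap makes the sum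
  -- over scales geometric.
  set ρ : ℝ := 2 ^ (β - β') with hρ
  have hρ1 : ρ < 1 := Real.rpow_lt_one_of_one_lt_of_neg one_lt_two (by linarith)
  have hbound : ∀ n, ∀ v ∈ Set.Icc (0 : Fin N → ℝ) 1, ∫⁻ ω, g n (v, ω) ∂P ≤
      ENNReal.ofReal ((√c ^ β')⁻¹ * ρ ^ n) * I := by
    intro n v hv
    have hswap : ∫⁻ ω, lam {u | ‖Z' u ω - Z' v ω‖ ≤ (1 / 2) ^ n} ∂P =
        ∫⁻ u, P {ω | ‖Z' u ω - Z' v ω‖ ≤ (1 / 2) ^ n} ∂lam := by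
      have hm : MeasurableSet {q : Ω × (Fin N → ℝ) | ‖Z' q.2 q.1 - Z' v q.1‖ ≤ (1 / 2) ^ n} := by
        have h1 : Measurable fun q : Ω × (Fin N → ℝ) => Z' q.2 q.1 := hjoint.comp measurable_swap
        have h2 : Measurable fun q : Ω × (Fin N → ℝ) => Z' v q.1 :=
          (hZ'.measurable v).comp measurable_fst
        exact measurableSet_le (h1.sub h2).norm measurable_const
      have e1 := Measure.prod_apply (μ := P) (ν := lam) hm
      have e2 := Measure.prod_apply_symm (μ := P) (ν := lam) hm
      exact e1.symm.trans e2
    calc ∫⁻ ω, g n (v, ω) ∂P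
        = ENNReal.ofReal ((2 ^ n) ^ β) * ∫⁻ u, P {ω | ‖Z' u ω - Z' v ω‖ ≤ (1 / 2) ^ n} ∂lam := by
          rw [← hswap, ← lintegral_const_mul']
          exact ENNReal.ofReal_ne_top
      _ ≤ ENNReal.ofReal ((2 ^ n) ^ β) *
            ∫⁻ u, ENNReal.ofReal (((1 / 2) ^ n / √c) ^ β') * edist u v ^ (-(α * β')) ∂lam := by
          gcongr 1
          refine lintegral_mono_ae ?_
          filter_upwards [ae_cubeMeasure_mem N] with u hu
          exact hZ'.measure_sub_ball_le_edist hβ'0 hβd hu hv (by positivity)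
      _ = ENNReal.ofReal ((2 ^ n) ^ β) * (ENNReal.ofReal (((1 / 2) ^ n / √c) ^ β') *
            ∫⁻ u, edist u v ^ (-(α * β')) ∂lam) := by
          rw [lintegral_const_mul']
          exact ENNReal.ofReal_ne_top
      _ ≤ ENNReal.ofReal ((2 ^ n) ^ β) * (ENNReal.ofReal (((1 / 2) ^ n / √c) ^ β') * I) := by
          gcongr
          exact HI v hv
      _ = _ := by
          rw [← mul_assoc, ← ENNReal.ofReal_mul (by positivity)]
          congr 2
          have h2n : (0 : ℝ) < 2 ^ n := by positivity
          have hρn : ρ ^ n = (2 ^ n) ^ β * ((2 ^ n) ^ β')⁻¹ := by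
            rw [hρ, ← Real.rpow_neg h2n.le, ← Real.rpow_add h2n, ← sub_eq_add_neg,
              ← Real.rpow_natCast, ← Real.rpow_mul (by norm_num), mul_comm,
              Real.rpow_mul (by norm_num), Real.rpow_natCast]
          rw [hρn, Real.div_rpow (by positivity) (by positivity), one_div, inv_pow,
            Real.inv_rpow h2n.le]
          ring
  have hfin : ∫⁻ ω, ∫⁻ v, ∑' n, g n (v, ω) ∂lam ∂P ≠ ∞ := by
    have hm : Measurable fun q : (Fin N → ℝ) × Ω => ∑' n, g n q := Measurable.tsum hgm
    rw [lintegral_lintegral_swap (f := fun ω v => ∑' n, g n (v, ω))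
      (hm.comp measurable_swap).aemeasurable]
    refine ne_top_of_le_ne_top (b := ∑' n, ENNReal.ofReal ((√c ^ β')⁻¹ * ρ ^ n) * I) ?_ ?_
    · rw [ENNReal.tsum_mul_right]
      refine ENNReal.mul_ne_top ?_ hI
      exact ((summable_geometric_of_lt_one (by positivity) hρ1).mul_left _).tsum_ofReal_ne_top
    · calc ∫⁻ v, ∫⁻ ω, ∑' n, g n (v, ω) ∂P ∂lam
          ≤ ∫⁻ _v, ∑' n, ENNReal.ofReal ((√c ^ β')⁻¹ * ρ ^ n) * I ∂lam := by
            refine lintegral_mono_ae ?_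
            filter_upwards [ae_cubeMeasure_mem N] with v hv
            rw [lintegral_tsum (f := fun n ω => g n (v, ω)) fun n =>
              ((hgm n).comp measurable_prodMk_left).aemeasurable]
            exact ENNReal.tsum_le_tsum fun n => hbound n v hv
        _ = _ := by rw [lintegral_const, measure_univ, mul_one]
  have hm2 : Measurable fun ω => ∫⁻ v, ∑' n, g n (v, ω) ∂lam :=
    ((Measurable.tsum hgm).comp measurable_swap).lintegral_prod_right'
  filter_upwards [ae_lt_top hm2 hfin] with ω hω
  refine le_dimH_image_of_occupation (hcont ω) hβ0 ?_
  have hm3 : Measurable fun v => ∑' n, g n (v, ω) :=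
    Measurable.tsum fun n => (hgm n).comp measurable_prodMk_right
  filter_upwards [ae_lt_top hm3 hω.ne] with v hv
  obtain ⟨K, hK⟩ := ENNReal.exists_nat_gt hv.ne
  refine ⟨K, fun n => ?_⟩
  have h1 : g n (v, ω) ≤ K := (ENNReal.le_tsum n).trans hK.le
  have h2n : (0 : ℝ) < (2 ^ n) ^ β := by positivity
  have h3 : ENNReal.ofReal (((1 / 2) ^ n) ^ β) = (ENNReal.ofReal ((2 ^ n) ^ β))⁻¹ := by
    rw [← ENNReal.ofReal_inv_of_pos h2n, one_div, inv_pow, Real.inv_rpow (by positivity)]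
  rw [h3, ← div_eq_mul_inv, ENNReal.le_div_iff_mul_le (Or.inl (by simpa using h2n))
    (Or.inl ENNReal.ofReal_ne_top), mul_comm]
  exact h1

end UnitCubeField

/-! ### Frostman measures and their potentials -/

section Frostman

variable {d : ℕ}

/-- The index of the dyadic cube of side `2⁻ᵏ` containing a point. -/
noncomputable def dyadicIdx (k : ℕ) (x : EuclideanSpace ℝ (Fin d)) : Fin d → ℤ :=
  fun i => ⌊2 ^ k * x i⌋

/-- The half-open dyadic cube of side `2⁻ᵏ` with index `z`. -/
def dyadicCube (k : ℕ) (z : Fin d → ℤ) : Set (EuclideanSpace ℝ (Fin d)) := {x | dyadicIdx k x = z}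

/-- The indices of the dyadic cubes of the next generation inside a dyadic cube. -/
def dyadicChildren (z : Fin d → ℤ) : Finset (Fin d → ℤ) :=
  Fintype.piFinset fun i => {2 * z i, 2 * z i + 1}

lemma dyadicIdx_succ_div (k : ℕ) (x : EuclideanSpace ℝ (Fin d)) (i : Fin d) :
    dyadicIdx (k + 1) x i / 2 = dyadicIdx k x i := by
  simp only [dyadicIdx]
  set t := 2 ^ k * x i with ht
  have h1 : 2 * ⌊t⌋ ≤ ⌊2 ^ (k + 1) * x i⌋ := by
    rw [Int.le_floor]
    push_cast
    rw [pow_succ, mul_comm ((2 : ℝ) ^ k) 2, mul_assoc]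
    linarith [Int.floor_le t]
  have h2 : ⌊2 ^ (k + 1) * x i⌋ < 2 * ⌊t⌋ + 2 := by
    rw [Int.floor_lt]
    push_cast
    rw [pow_succ, mul_comm ((2 : ℝ) ^ k) 2, mul_assoc]
    linarith [Int.lt_floor_add_one t]
  omega

lemma mem_dyadicChildren {z z' : Fin d → ℤ} : z' ∈ dyadicChildren z ↔ ∀ i, z' i / 2 = z i := by
  simp only [dyadicChildren, Fintype.mem_piFinset, Finset.mem_insert, Finset.mem_singleton]
  refine forall_congr' fun i => ?_
  omega

lemma dyadicCube_subset_of_mem_children {k : ℕ} {z z' : Fin d → ℤ} (h : z' ∈ dyadicChildren z) :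
    dyadicCube (k + 1) z' ⊆ dyadicCube k z := by
  rintro x rfl
  ext i
  rw [← dyadicIdx_succ_div]
  exact mem_dyadicChildren.1 h i

lemma dyadicCube_subset_biUnion_children (k : ℕ) (z : Fin d → ℤ) :
    dyadicCube k z ⊆ ⋃ z' ∈ dyadicChildren z, dyadicCube (k + 1) z' := by
  rintro x rfl
  refine Set.mem_biUnion (x := dyadicIdx (k + 1) x) ?_ rfl
  exact mem_dyadicChildren.2 fun i => dyadicIdx_succ_div k x i

lemma dyadicIdx_eq_of_le {j k : ℕ} (hjk : j ≤ k) {x y : EuclideanSpace ℝ (Fin d)}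
    (h : dyadicIdx k x = dyadicIdx k y) : dyadicIdx j x = dyadicIdx j y := by
  induction k, hjk using Nat.le_induction with
  | base => exact h
  | succ k _ ih =>
    refine ih ?_
    ext i
    rw [← dyadicIdx_succ_div k x, ← dyadicIdx_succ_div k y, h]

/-- The finite form of Frostman's construction: a measure on a dyadic cube which obeys the
prescribed bounds on all dyadic subcubes down to a fixed generation, and whose mass dominates a
given outer measure. -/
lemma exists_measure_dyadicCube_le {A : Set (EuclideanSpace ℝ (Fin d))}
    (Φ : OuterMeasure (EuclideanSpace ℝ (Fin d))) {cap : ℕ → ℝ≥0∞} (hcap : ∀ k, cap k ≠ ∞)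
    (hΦ : ∀ k z, Φ (A ∩ dyadicCube k z) ≤ cap k) (n : ℕ) :
    ∀ k z, ∃ μ : Measure (EuclideanSpace ℝ (Fin d)), μ (A ∩ dyadicCube k z)ᶜ = 0 ∧
      (∀ j, k ≤ j → j ≤ k + n → ∀ z', μ (dyadicCube j z') ≤ cap j) ∧
      Φ (A ∩ dyadicCube k z) ≤ μ Set.univ := by
  induction n with
  | zero =>
    intro k z
    rcases (A ∩ dyadicCube k z).eq_empty_or_nonempty with he | ⟨x, hx⟩
    · exact ⟨0, by simp, by simp, by rw [he]; simp⟩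
    -- At the finest generation a point mass at any point of `A` in the cube suffices, so the
    -- measures live on `A` itself without any limit.
    · refine ⟨cap k • Measure.dirac x, ?_, ?_, ?_⟩
      · rw [Measure.smul_apply, Measure.dirac_apply, Set.indicator_of_notMem (by simpa using hx)]
        simp
      · intro j hj1 hj2 z'
        obtain rfl : j = k := by omega
        rw [Measure.smul_apply, smul_eq_mul]
        exact mul_le_of_le_one_right' prob_le_one
      · rw [Measure.smul_apply, measure_univ, smul_eq_mul, mul_one]
        exact hΦ k z
  | succ n ih =>
    intro k z
    choose μ hμ1 hμ2 hμ3 using fun z' => ih (k + 1) z'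
    set ν : Measure (EuclideanSpace ℝ (Fin d)) := ∑ z' ∈ dyadicChildren z, μ z' with hν
    have hνap : ∀ s, ν s = ∑ z' ∈ dyadicChildren z, μ z' s := fun s => by
      rw [hν, Measure.finsetSum_apply]
    have hν1 : ν (A ∩ dyadicCube k z)ᶜ = 0 := by
      rw [hνap]
      refine Finset.sum_eq_zero fun z' hz' => measure_mono_null ?_ (hμ1 z')
      exact Set.compl_subset_compl.2
        (Set.inter_subset_inter_right A (dyadicCube_subset_of_mem_children hz'))
    have hν2 : ∀ j, k + 1 ≤ j → j ≤ k + 1 + n → ∀ z', ν (dyadicCube j z') ≤ cap j := by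
      intro j hj1 hj2 z'
      rw [hνap]
      by_cases h0 : ∀ w ∈ dyadicChildren z, μ w (dyadicCube j z') = 0
      · rw [Finset.sum_eq_zero h0]; exact zero_le
      · push Not at h0
        obtain ⟨w, hw, hw0⟩ := h0
        -- Dyadic cubes are nested: a subcube charged by two children would have two ancestors of
        -- generation `k + 1`. Hence at most one term of the sum survives.
        have hmeet : ∀ w, μ w (dyadicCube j z') ≠ 0 →
            ∃ x, dyadicIdx j x = z' ∧ dyadicIdx (k + 1) x = w := by
          intro w hw0
          by_contra! hcon
          refine hw0 (measure_mono_null ?_ (hμ1 w))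
          intro x hx hx2
          exact hcon x hx hx2.2
        rw [Finset.sum_eq_single w _ (fun h => absurd hw h)]
        · exact hμ2 w j hj1 hj2 z'
        · intro w' _ hne
          by_contra hw'0
          obtain ⟨x, hx1, hx2⟩ := hmeet w hw0
          obtain ⟨y, hy1, hy2⟩ := hmeet w' hw'0
          exact hne (by rw [← hx2, ← hy2]; exact dyadicIdx_eq_of_le hj1 (hy1.trans hx1.symm))
    have hν3 : Φ (A ∩ dyadicCube k z) ≤ ν Set.univ := by
      rw [hνap]
      calc Φ (A ∩ dyadicCube k z) ≤ Φ (⋃ z' ∈ dyadicChildren z, A ∩ dyadicCube (k + 1) z') := by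
            refine Φ.mono ?_
            rw [← Set.inter_iUnion₂]
            exact Set.inter_subset_inter_right A (dyadicCube_subset_biUnion_children k z)
        _ ≤ ∑ z' ∈ dyadicChildren z, Φ (A ∩ dyadicCube (k + 1) z') :=
            measure_biUnion_finset_le _ _
        _ ≤ _ := Finset.sum_le_sum fun z' _ => hμ3 z'
    have hνfin : ν Set.univ ≠ ∞ := by
      rw [hνap]
      refine (ENNReal.sum_lt_top.2 fun z' _ => ?_).ne
      have h1 : μ z' (dyadicCube (k + 1) z')ᶜ = 0 :=
        measure_mono_null (Set.compl_subset_compl.2 Set.inter_subset_right) (hμ1 z')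
      calc μ z' Set.univ ≤ μ z' (dyadicCube (k + 1) z') + μ z' (dyadicCube (k + 1) z')ᶜ := by
            rw [← Set.union_compl_self (dyadicCube (k + 1) z')]
            exact measure_union_le _ _
        _ ≤ cap (k + 1) := by
            rw [h1, add_zero]
            exact hμ2 z' (k + 1) le_rfl (by omega) z'
        _ < ∞ := (hcap _).lt_top
    -- If the glued measure exceeds the cap of the parent, it is scaled down to exactly that cap,
    -- which still dominates `Φ`; scaling down keeps the finer bounds.
    rcases le_or_gt (ν Set.univ) (cap k) with hle | hlt
    · refine ⟨ν, hν1, fun j hj1 hj2 z' => ?_, hν3⟩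
      rcases eq_or_lt_of_le hj1 with rfl | hj
      · exact (measure_mono (Set.subset_univ _)).trans hle
      · exact hν2 j hj (by omega) z'
    · have hν0 : ν Set.univ ≠ 0 := (zero_le.trans_lt hlt).ne'
      have huniv : ((cap k / ν Set.univ) • ν) Set.univ = cap k := by
        rw [Measure.smul_apply, smul_eq_mul, ENNReal.div_mul_cancel hν0 hνfin]
      refine ⟨(cap k / ν Set.univ) • ν, ?_, fun j hj1 hj2 z' => ?_, ?_⟩
      · rw [Measure.smul_apply, hν1, smul_zero]
      · rcases eq_or_lt_of_le hj1 with rfl | hj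
        · exact (measure_mono (Set.subset_univ _)).trans huniv.le
        · rw [Measure.smul_apply, smul_eq_mul]
          refine (mul_le_of_le_one_left' ?_).trans (hν2 j hj (by omega) z')
          exact ENNReal.div_le_of_le_mul (by rw [one_mul]; exact hlt.le)
      · rw [huniv]; exact hΦ k z

/-- The bound imposed on the mass of dyadic cubes of side `2⁻ᵏ`. -/
noncomputable def frostmanCap (d : ℕ) (β : ℝ) (k : ℕ) : ℝ≥0∞ := ENNReal.ofReal ((d * (1 / 2) ^ k) ^ β)

lemma ediam_dyadicCube_le (k : ℕ) (z : Fin d → ℤ) :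
    Metric.ediam (dyadicCube k z) ≤ ENNReal.ofReal (d * (1 / 2) ^ k) := by
  refine Metric.ediam_le fun x hx y hy => ?_
  rw [edist_dist]
  apply ENNReal.ofReal_le_ofReal
  rw [dist_eq_norm, EuclideanSpace.norm_eq]
  apply Real.sqrt_le_iff.2 ⟨by positivity, ?_⟩
  calc ∑ i, ‖(x - y) i‖ ^ 2 ≤ (∑ i, ‖(x - y) i‖) ^ 2 :=
        Finset.sum_sq_le_sq_sum_of_nonneg fun i _ => norm_nonneg _
    _ ≤ (∑ _i : Fin d, (1 / 2) ^ k) ^ 2 := by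
        gcongr with i _
        have hxi : ⌊2 ^ k * x i⌋ = z i := congrFun hx i
        have hyi : ⌊2 ^ k * y i⌋ = z i := congrFun hy i
        have h := Int.abs_sub_lt_one_of_floor_eq_floor (hxi.trans hyi.symm)
        rw [← mul_sub, abs_mul, abs_of_pos (by positivity : (0 : ℝ) < 2 ^ k)] at h
        rw [one_div, inv_pow, ← one_div, le_div_iff₀' (by positivity)]
        exact h.le
    _ = _ := by simp

/-- Hausdorff content: the outer measure generated by the powers of the diameter. -/
noncomputable def hausdorffContent (d : ℕ) (β : ℝ) : OuterMeasure (EuclideanSpace ℝ (Fin d)) :=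
  OuterMeasure.ofFunction (fun s => ⨆ _ : s.Nonempty, Metric.ediam s ^ β) (by simp)

/-- A cover whose sum of powers is below `r ^ β` consists of sets of diameter at most `r`. For
arbitrarily cheap covers the size restriction in the Hausdorff measure is thus automatic. -/
lemma hausdorffContent_ne_zero {β : ℝ} (hβ : 0 < β) {A : Set (EuclideanSpace ℝ (Fin d))}
    (hA : Measure.hausdorffMeasure β A ≠ 0) : hausdorffContent d β A ≠ 0 := by
  intro h0
  refine hA ?_
  rw [Measure.hausdorffMeasure_apply, ENNReal.iSup_eq_zero]
  intro r
  rw [ENNReal.iSup_eq_zero]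
  intro hr
  refine le_antisymm (ENNReal.le_of_forall_pos_le_add fun ε hε _ => ?_) zero_le
  rw [zero_add]
  have hrβ : 0 < r ^ β := by
    rcases eq_or_ne r ∞ with rfl | hrt
    · rw [ENNReal.top_rpow_of_pos hβ]; exact ENNReal.zero_lt_top
    · exact ENNReal.rpow_pos hr hrt
  have hlt : hausdorffContent d β A < min (ε : ℝ≥0∞) (r ^ β) := by
    rw [h0]
    exact lt_min (by exact_mod_cast hε) hrβ
  rw [hausdorffContent, OuterMeasure.ofFunction_apply] at hlt
  simp only [iInf_lt_iff] at hlt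
  obtain ⟨t, hAt, ht⟩ := hlt
  refine iInf_le_of_le t (iInf_le_of_le hAt (iInf_le_of_le (fun n => ?_)
    (ht.le.trans (min_le_left _ _))))
  rcases (t n).eq_empty_or_nonempty with he | hne
  · rw [he]; simp
  · have h1 : Metric.ediam (t n) ^ β ≤ r ^ β := by
      calc Metric.ediam (t n) ^ β ≤ ⨆ _ : (t n).Nonempty, Metric.ediam (t n) ^ β :=
            le_iSup_of_le hne le_rfl
        _ ≤ ∑' n, ⨆ _ : (t n).Nonempty, Metric.ediam (t n) ^ β := ENNReal.le_tsum n
        _ ≤ r ^ β := ht.le.trans (min_le_right _ _)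
    exact (ENNReal.rpow_le_rpow_iff hβ).1 h1

/-- Frostman's lemma at a finite scale. -/
lemma exists_frostman_measures {β : ℝ} (hβ : 0 < β) {A : Set (EuclideanSpace ℝ (Fin d))}
    (hA : Measure.hausdorffMeasure β A ≠ 0) :
    ∃ c₀ : ℝ≥0∞, c₀ ≠ 0 ∧ ∀ n : ℕ, ∃ μ : Measure (EuclideanSpace ℝ (Fin d)),
      μ Aᶜ = 0 ∧ c₀ ≤ μ Set.univ ∧ μ Set.univ ≤ frostmanCap d β 0 ∧
      ∀ k ≤ n, ∀ z, μ (dyadicCube k z) ≤ frostmanCap d β k := by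
  obtain ⟨z, hz⟩ : ∃ z, hausdorffContent d β (A ∩ dyadicCube 0 z) ≠ 0 := by
    by_contra! hcon
    refine hausdorffContent_ne_zero hβ hA (measure_mono_null (t := ⋃ z, A ∩ dyadicCube 0 z) ?_
      (measure_iUnion_null hcon))
    intro x hx
    exact Set.mem_iUnion.2 ⟨dyadicIdx 0 x, hx, rfl⟩
  have hΦ : ∀ k z, hausdorffContent d β (A ∩ dyadicCube k z) ≤ frostmanCap d β k := by
    intro k z
    refine (OuterMeasure.ofFunction_le _).trans (iSup_le fun _ => ?_)
    rw [frostmanCap, ← ENNReal.ofReal_rpow_of_nonneg (by positivity) hβ.le]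
    exact ENNReal.rpow_le_rpow ((Metric.ediam_mono Set.inter_subset_right).trans
      (ediam_dyadicCube_le k z)) hβ.le
  -- The lower mass bound is the content of `A` in one unit cube, independent of `n`. This
  -- uniformity replaces a weak limit of the measures.
  refine ⟨_, hz, fun n => ?_⟩
  obtain ⟨μ, h1, h2, h3⟩ := exists_measure_dyadicCube_le (A := A) (hausdorffContent d β)
    (cap := frostmanCap d β) (fun k => ENNReal.ofReal_ne_top) hΦ n 0 z
  have h4 : μ (dyadicCube 0 z)ᶜ = 0 :=
    measure_mono_null (Set.compl_subset_compl.2 Set.inter_subset_right) h1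
  refine ⟨μ, measure_mono_null (Set.compl_subset_compl.2 Set.inter_subset_left) h1, h3, ?_,
    fun k hk z => h2 k (Nat.zero_le k) (by omega) z⟩
  calc μ Set.univ ≤ μ (dyadicCube 0 z) + μ (dyadicCube 0 z)ᶜ := by
        rw [← Set.union_compl_self (dyadicCube 0 z)]
        exact measure_union_le _ _
    _ ≤ _ := by
        rw [h4, add_zero]
        exact h2 0 le_rfl (by omega) z

/-- A ball of radius `2⁻ᵏ` meets only the cube of its center and adjacent ones: in each coordinate
the index moves by at most one. -/
lemma measure_closedBall_le_of_dyadicCube_le {μ : Measure (EuclideanSpace ℝ (Fin d))} {k : ℕ}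
    {b : ℝ≥0∞} (h : ∀ z, μ (dyadicCube k z) ≤ b) (x : EuclideanSpace ℝ (Fin d)) :
    μ {y | ‖x - y‖ ≤ (1 / 2) ^ k} ≤ 3 ^ d * b := by
  set T : Finset (Fin d → ℤ) :=
    Fintype.piFinset fun i => Finset.Icc (dyadicIdx k x i - 1) (dyadicIdx k x i + 1) with hT
  have hcard : T.card = 3 ^ d := by
    rw [hT, Fintype.card_piFinset]
    simp only [Int.card_Icc]
    rw [Finset.prod_congr rfl (g := fun _ => 3) fun i _ => by omega]
    simp
  calc μ {y | ‖x - y‖ ≤ (1 / 2) ^ k} ≤ μ (⋃ z ∈ T, dyadicCube k z) := by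
        refine measure_mono fun y hy => Set.mem_biUnion (x := dyadicIdx k y) ?_ rfl
        refine Fintype.mem_piFinset.2 fun i => ?_
        have h1 : |2 ^ k * x i - 2 ^ k * y i| ≤ 1 := by
          rw [← mul_sub, abs_mul, abs_of_pos (by positivity : (0 : ℝ) < 2 ^ k)]
          have h2 : |x i - y i| ≤ (1 / 2) ^ k := (PiLp.norm_apply_le (x - y) i).trans hy
          calc (2 : ℝ) ^ k * |x i - y i| ≤ 2 ^ k * (1 / 2) ^ k := by gcongr
            _ = 1 := by rw [← mul_pow]; norm_num
        rw [abs_le] at h1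
        rw [Finset.mem_Icc]
        constructor
        · rw [dyadicIdx, dyadicIdx, Int.le_floor]
          push_cast
          linarith [Int.floor_le (2 ^ k * x i)]
        · rw [dyadicIdx, dyadicIdx, ← Int.lt_add_one_iff, Int.floor_lt]
          push_cast
          linarith [Int.lt_floor_add_one (2 ^ k * x i)]
    _ ≤ ∑ z ∈ T, μ (dyadicCube k z) := measure_biUnion_finset_le _ _
    _ ≤ ∑ _z ∈ T, b := Finset.sum_le_sum fun z _ => h z
    _ = _ := by rw [Finset.sum_const, hcard, nsmul_eq_mul]; push_cast; rfl

/-- The regularized energy kernel is bounded by a dyadic sum. -/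
lemma rpow_neg_max_le_sum {β : ℝ} (hβ : 0 ≤ β) (n : ℕ) {r : ℝ} :
    ENNReal.ofReal (max r ((1 / 2) ^ n) ^ (-β)) ≤ 1 + ∑ k ∈ Finset.range (n + 1),
      ENNReal.ofReal (2 ^ β * (2 ^ k) ^ β) * (if r ≤ (1 / 2) ^ k then 1 else 0) := by
  set t := max r ((1 / 2 : ℝ) ^ n) with ht
  have ht0 : 0 < t := lt_max_of_lt_right (by positivity)
  rcases le_total 1 t with h1 | h1
  · refine le_add_right ?_
    rw [← ENNReal.ofReal_one]
    exact ENNReal.ofReal_le_ofReal (Real.rpow_le_one_of_one_le_of_nonpos h1 (by linarith))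
  · obtain ⟨k, hk1, hk2⟩ := exists_nat_pow_near_of_lt_one ht0 h1
      (by norm_num : (0 : ℝ) < 1 / 2) (by norm_num)
    have hkn : k ≤ n := by
      by_contra! hcon
      have h3 : (1 / 2 : ℝ) ^ k < (1 / 2) ^ n :=
        pow_lt_pow_right_of_lt_one₀ (by norm_num) (by norm_num) hcon
      linarith [le_max_right r ((1 / 2 : ℝ) ^ n)]
    refine le_add_left ?_
    refine le_trans ?_ (Finset.single_le_sum (f := fun k => ENNReal.ofReal (2 ^ β * (2 ^ k) ^ β) *
      (if r ≤ (1 / 2) ^ k then 1 else 0)) (fun _ _ => zero_le)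
      (Finset.mem_range.2 (Nat.lt_succ_of_le hkn)))
    rw [if_pos ((le_max_left _ _).trans hk2), mul_one]
    apply ENNReal.ofReal_le_ofReal
    calc t ^ (-β) ≤ ((1 / 2) ^ (k + 1)) ^ (-β) :=
          Real.rpow_le_rpow_of_nonpos (by positivity) hk1.le (by linarith)
      _ = (2 ^ (k + 1)) ^ β := by
          rw [Real.rpow_neg (by positivity), ← Real.inv_rpow (by positivity), one_div, inv_pow,
            inv_inv]
      _ = _ := by rw [pow_succ, mul_comm, Real.mul_rpow (by norm_num) (by positivity)]

/-- Uniform bound on the regularized potentials of the Frostman measures. -/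
lemma exists_potential_le {β β' : ℝ} (hβ' : 0 ≤ β') (hββ' : β' < β) :
    ∃ E₀ : ℝ≥0∞, E₀ ≠ ∞ ∧ ∀ (n : ℕ) (μ : Measure (EuclideanSpace ℝ (Fin d))),
      μ Set.univ ≤ frostmanCap d β 0 → (∀ k ≤ n, ∀ z, μ (dyadicCube k z) ≤ frostmanCap d β k) →
      ∀ x, ∫⁻ y, ENNReal.ofReal (max ‖x - y‖ ((1 / 2) ^ n) ^ (-β')) ∂μ ≤ E₀ := by
  -- Scale `k` contributes a multiple of `2 ^ (k * β') * 2 ^ (-k * β)`; the strict inequality makes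
  -- the total finite uniformly in `n`.
  set ρ : ℝ := 2 ^ (β' - β) with hρ
  have hρ1 : ρ < 1 := Real.rpow_lt_one_of_one_lt_of_neg one_lt_two (by linarith)
  refine ⟨frostmanCap d β 0 + ∑' k : ℕ, ENNReal.ofReal (2 ^ β' * 3 ^ d * d ^ β * ρ ^ k),
    ENNReal.add_ne_top.2 ⟨ENNReal.ofReal_ne_top,
      ((summable_geometric_of_lt_one (by positivity) hρ1).mul_left _).tsum_ofReal_ne_top⟩,
    fun n μ hμ0 hμ x => ?_⟩
  have hball : ∀ k, MeasurableSet {y : EuclideanSpace ℝ (Fin d) | ‖x - y‖ ≤ (1 / 2) ^ k} :=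
    fun k => measurableSet_le (by fun_prop) measurable_const
  calc ∫⁻ y, ENNReal.ofReal (max ‖x - y‖ ((1 / 2) ^ n) ^ (-β')) ∂μ
      ≤ ∫⁻ y, (1 + ∑ k ∈ Finset.range (n + 1), ENNReal.ofReal (2 ^ β' * (2 ^ k) ^ β') *
          {y | ‖x - y‖ ≤ (1 / 2) ^ k}.indicator 1 y) ∂μ := by
        refine lintegral_mono fun y => (rpow_neg_max_le_sum hβ' n).trans (le_of_eq ?_)
        simp [Set.indicator_apply]
    _ = μ Set.univ + ∑ k ∈ Finset.range (n + 1), ENNReal.ofReal (2 ^ β' * (2 ^ k) ^ β') *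
          μ {y | ‖x - y‖ ≤ (1 / 2) ^ k} := by
        rw [lintegral_add_left measurable_const, lintegral_one, lintegral_finsetSum]
        · congr 1
          refine Finset.sum_congr rfl fun k _ => ?_
          rw [lintegral_const_mul' _ _ ENNReal.ofReal_ne_top, lintegral_indicator_one (hball k)]
        · exact fun k _ => (measurable_one.indicator (hball k)).const_mul _
    _ ≤ frostmanCap d β 0 + ∑ k ∈ Finset.range (n + 1),
          ENNReal.ofReal (2 ^ β' * 3 ^ d * d ^ β * ρ ^ k) := by
        gcongr with k hk
        refine (mul_le_mul_right (measure_closedBall_le_of_dyadicCube_le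
          (hμ k (Nat.lt_succ_iff.1 (Finset.mem_range.1 hk))) x) _).trans (le_of_eq ?_)
        have h3 : (3 : ℝ≥0∞) ^ d = ENNReal.ofReal (3 ^ d) := by
          rw [ENNReal.ofReal_pow (by norm_num)]; norm_num
        rw [frostmanCap, h3, ← ENNReal.ofReal_mul (by positivity),
          ← ENNReal.ofReal_mul (by positivity)]
        congr 1
        have h2k : (0 : ℝ) < 2 ^ k := by positivity
        have hρk : ρ ^ k = (2 ^ k) ^ β' * ((2 ^ k) ^ β)⁻¹ := by
          rw [hρ, ← Real.rpow_neg h2k.le, ← Real.rpow_add h2k, ← sub_eq_add_neg,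
            ← Real.rpow_natCast, ← Real.rpow_mul (by norm_num), mul_comm,
            Real.rpow_mul (by norm_num), Real.rpow_natCast]
        rw [hρk, Real.mul_rpow (by positivity) (by positivity), one_div, inv_pow,
          Real.inv_rpow h2k.le]
        ring
    _ ≤ _ := by
        gcongr
        exact ENNReal.sum_le_tsum _

end Frostman

/-! ### The second moment method and hitting -/

/-- Second moment bound for the probability that a nonnegative function does not vanish. -/
lemma sq_lintegral_le_mul_measure_ne_zero {Ω : Type*} {m : MeasurableSpace Ω} {P : Measure Ω}
    {f : Ω → ℝ≥0∞} (hf : Measurable f) :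
    (∫⁻ ω, f ω ∂P) ^ 2 ≤ (∫⁻ ω, f ω ^ 2 ∂P) * P {ω | f ω ≠ 0} := by
  set S : Set Ω := {ω | f ω ≠ 0} with hS
  have hSm : MeasurableSet S := (hf (measurableSet_singleton 0)).compl
  have hpq : (2 : ℝ).HolderConjugate 2 := Real.HolderConjugate.two_two
  have h := ENNReal.lintegral_mul_le_Lp_mul_Lq P hpq hf.aemeasurable
    ((measurable_one : Measurable (1 : Ω → ℝ≥0∞)).indicator hSm).aemeasurable
  have h1 : ∫⁻ ω, (f * S.indicator (1 : Ω → ℝ≥0∞)) ω ∂P = ∫⁻ ω, f ω ∂P := by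
    refine lintegral_congr fun ω => ?_
    by_cases hω : ω ∈ S
    · simp [hω]
    · have : f ω = 0 := by simpa [hS] using hω
      simp [this]
  have h2 : ∫⁻ ω, (S.indicator (1 : Ω → ℝ≥0∞) ω) ^ (2 : ℝ) ∂P = P S := by
    rw [← lintegral_indicator_one hSm]
    refine lintegral_congr fun ω => ?_
    by_cases hω : ω ∈ S <;> simp [hω]
  rw [h1, h2] at h
  calc (∫⁻ ω, f ω ∂P) ^ 2 ≤ ((∫⁻ ω, f ω ^ (2 : ℝ) ∂P) ^ (1 / (2 : ℝ)) * P S ^ (1 / (2 : ℝ))) ^ 2 := by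
        gcongr
    _ = _ := by
        rw [mul_pow, ← ENNReal.rpow_natCast, ← ENNReal.rpow_natCast, ← ENNReal.rpow_mul,
          ← ENNReal.rpow_mul]
        simp

namespace UnitCubeField

variable {Ω : Type*} {m : MeasurableSpace Ω} {P : Measure Ω} {N d : ℕ}
  {Z : (Fin N → ℝ) → Ω → EuclideanSpace ℝ (Fin d)} {κ : (Fin N → ℝ) → (Fin N → ℝ) → ℝ}
  {α c C : ℝ}

/-- Interpolated two-point estimate, in which the space and time variables are separated. -/
lemma exists_measure_pair_le_separated [IsProbabilityMeasure P] (hZ : UnitCubeField P Z κ α c C)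
    {M : ℝ} (hM : 0 ≤ M) {β : ℝ} (hβ0 : 0 ≤ β) (hβd : β < d) :
    ∃ B : ℝ, 0 < B ∧ ∀ u ∈ Set.Icc (0 : Fin N → ℝ) 1, ∀ v ∈ Set.Icc (0 : Fin N → ℝ) 1,
      ∀ x y : EuclideanSpace ℝ (Fin d), ‖y‖ ≤ M → ∀ ε, 0 < ε → ε ≤ 1 →
      P {ω | ‖Z u ω - x‖ ≤ ε ∧ ‖Z v ω - y‖ ≤ ε} ≤
        ENNReal.ofReal (B * (ε ^ d) ^ 2) * (ENNReal.ofReal (max ‖x - y‖ ε ^ (-β)) *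
          edist u v ^ (-(α * (d - β)))) := by
  have hα := hZ.α_pos
  obtain ⟨B, hB, H⟩ := hZ.exists_measure_pair_le hM
  refine ⟨B, hB, fun u hu v hv x y hy ε hε hε1 => ?_⟩
  have hmax : 0 < max ‖x - y‖ ε := lt_max_of_lt_right hε
  rcases eq_or_ne u v with rfl | huv
  · rw [edist_self, ENNReal.zero_rpow_of_neg (by
      rw [neg_lt_zero]; exact mul_pos hα (by linarith)), ENNReal.mul_top, ENNReal.mul_top]
    · exact le_top
    · simp only [ne_eq, ENNReal.ofReal_eq_zero, not_le]; positivity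
    · simp only [ne_eq, ENNReal.ofReal_eq_zero, not_le]; positivity
  · have hdist : 0 < dist u v := dist_pos.2 huv
    refine (H u hu v hv x y hy ε hε hε1).trans ?_
    rw [edist_dist, ENNReal.ofReal_rpow_of_pos hdist, ← ENNReal.ofReal_mul (by positivity),
      ← ENNReal.ofReal_mul (by positivity)]
    apply ENNReal.ofReal_le_ofReal
    set h := dist u v ^ α with hh
    have hh0 : 0 < h := by positivity
    set μ := max ε (max ‖x - y‖ h) with hμ
    have hμ0 : 0 < μ := lt_max_of_lt_left hε
    have e1 : dist u v ^ (-(α * (d - β))) = h ^ (-(d - β)) := by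
      rw [hh, ← Real.rpow_mul hdist.le]; congr 1; ring
    -- The power `d` of `1 / μ` is split so that one part is estimated by the space distance and the
    -- other by the time distance.
    have e2 : (ε ^ 2 / μ) ^ d = (ε ^ d) ^ 2 * (μ ^ (-β) * μ ^ (-(d - β))) := by
      rw [← Real.rpow_add hμ0, div_pow, ← pow_mul, ← pow_mul, mul_comm 2 d, div_eq_mul_inv]
      congr 1
      rw [show -β + -(d - β) = -(d : ℝ) by ring, Real.rpow_neg hμ0.le, Real.rpow_natCast]
    rw [e1, e2, mul_assoc]
    gcongr ?_ * (?_ * (?_ * ?_))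
    · exact Real.rpow_le_rpow_of_nonpos hmax
        (max_le ((le_max_left _ _).trans (le_max_right _ _)) (le_max_left _ _)) (by linarith)
    · exact Real.rpow_le_rpow_of_nonpos hh0 ((le_max_right _ _).trans (le_max_right _ _))
        (by linarith)

/-- The field hits every compact set of positive `β`-dimensional Hausdorff measure with positive
probability when `β > d - N / α`. -/
lemma measure_hit_pos [IsProbabilityMeasure P] (hZ : UnitCubeField P Z κ α c C)
    {A : Set (EuclideanSpace ℝ (Fin d))} (hA : IsCompact A) {β β' : ℝ} (hβ'0 : 0 < β')
    (hββ' : β' < β) (hβd : β ≤ d) (hβN : α * (d - β') < N)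
    (hAβ : Measure.hausdorffMeasure β A ≠ 0) :
    0 < P {ω | ∃ u ∈ Set.Icc (0 : Fin N → ℝ) 1, Z u ω ∈ A} := by
  obtain ⟨Z', hZ', hcont, hae⟩ := hZ.exists_continuous_version
  suffices h : 0 < P {ω | ∃ u ∈ Set.Icc (0 : Fin N → ℝ) 1, Z' u ω ∈ A} by
    refine h.trans_le (measure_mono_ae ?_)
    filter_upwards [hae] with ω hω
    rintro ⟨u, hu, huA⟩
    exact ⟨u, hu, hω u ▸ huA⟩
  have hα := hZ.α_pos
  have hβ0 : 0 < β := hβ'0.trans hββ'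
  obtain ⟨M, hM⟩ := hA.isBounded.exists_norm_le
  obtain ⟨B₁, hB₁, H₁⟩ := hZ'.exists_le_measure_ball |M|
  obtain ⟨B₂, hB₂, H₂⟩ := hZ'.exists_measure_pair_le_separated (abs_nonneg M) hβ'0.le
    (hββ'.trans_le hβd)
  obtain ⟨I, hI, HI⟩ := exists_lintegral_edist_rpow_neg_le (N := N) (θ := α * (d - β'))
    (mul_nonneg hα.le (by linarith)) hβN
  obtain ⟨E₀, hE₀, HE⟩ := exists_potential_le (d := d) hβ'0.le hββ'
  obtain ⟨c₀, hc₀, HF⟩ := exists_frostman_measures hβ0 hAβ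
  choose μ hμA hμc hμcap hμk using HF
  have hfin : ∀ n, IsFiniteMeasure (μ n) := fun n =>
    ⟨(hμcap n).trans_lt ENNReal.ofReal_lt_top⟩
  set lam := cubeMeasure N with hlam
  have hjoint : Measurable (Function.uncurry Z') :=
    measurable_uncurry_of_continuous_of_measurable hcont hZ'.measurable
  -- the set of near hits
  set S : ℕ → Set (Ω × (EuclideanSpace ℝ (Fin d) × (Fin N → ℝ))) :=
    fun n => {q | ‖Z' q.2.2 q.1 - q.2.1‖ ≤ (1 / 2) ^ n} with hS
  have hSm : ∀ n, MeasurableSet (S n) := by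
    intro n
    have h1 : Measurable fun q : Ω × (EuclideanSpace ℝ (Fin d) × (Fin N → ℝ)) => Z' q.2.2 q.1 :=
      hjoint.comp ((measurable_snd.comp measurable_snd).prodMk measurable_fst)
    have h2 : Measurable fun q : Ω × (EuclideanSpace ℝ (Fin d) × (Fin N → ℝ)) => q.2.1 :=
      measurable_fst.comp measurable_snd
    exact measurableSet_le (h1.sub h2).norm measurable_const
  set π : ℕ → Measure (EuclideanSpace ℝ (Fin d) × (Fin N → ℝ)) := fun n => (μ n).prod lam with hπ
  have hπuniv : ∀ n, π n Set.univ = μ n Set.univ := by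
    intro n
    rw [hπ, ← Set.univ_prod_univ]
    change ((μ n).prod lam) (Set.univ ×ˢ Set.univ) = _
    rw [Measure.prod_prod, measure_univ (μ := lam), mul_one]
  have hπae : ∀ n, ∀ᵐ q ∂(π n), q.1 ∈ A ∧ q.2 ∈ Set.Icc (0 : Fin N → ℝ) 1 := by
    intro n
    have h1 : ∀ᵐ x ∂(μ n), x ∈ A := hμA n
    have h2 := ae_cubeMeasure_mem N
    exact (Measure.quasiMeasurePreserving_fst.ae h1).and (Measure.quasiMeasurePreserving_snd.ae h2)
  -- `J n` is an approximate local time: the mass of pairs `(x, u)` for which `Z'` at time `u` is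
  -- within `2⁻ⁿ` of `x`. Its mean is at least of order `e n`, its second moment at most of order `e
  -- n ^ 2`.
  set J : ℕ → Ω → ℝ≥0∞ := fun n ω => π n (Prod.mk ω ⁻¹' S n) with hJ
  have hJm : ∀ n, Measurable (J n) := fun n => measurable_measure_prodMk_left (hSm n)
  set K : ℝ≥0∞ := ENNReal.ofReal B₂ * (E₀ * frostmanCap d β 0 * I) with hK
  have hKtop : K ≠ ∞ := ENNReal.mul_ne_top ENNReal.ofReal_ne_top
    (ENNReal.mul_ne_top (ENNReal.mul_ne_top hE₀ ENNReal.ofReal_ne_top) hI)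
  set e : ℕ → ℝ≥0∞ := fun n => ENNReal.ofReal (((1 / 2) ^ n) ^ d) with he
  have hfirst : ∀ n, ENNReal.ofReal B₁ * c₀ * e n ≤ ∫⁻ ω, J n ω ∂P := by
    intro n
    have h1 : ∫⁻ ω, J n ω ∂P = ∫⁻ q, P {ω | ‖Z' q.2 ω - q.1‖ ≤ (1 / 2) ^ n} ∂(π n) :=
      (Measure.prod_apply (μ := P) (ν := π n) (hSm n)).symm.trans
        (Measure.prod_apply_symm (μ := P) (ν := π n) (hSm n))
    rw [h1]
    calc ENNReal.ofReal B₁ * c₀ * e n ≤ ENNReal.ofReal B₁ * μ n Set.univ * e n := by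
          gcongr
          exact hμc n
      _ = ∫⁻ _q, ENNReal.ofReal (B₁ * ((1 / 2) ^ n) ^ d) ∂(π n) := by
          rw [lintegral_const, ENNReal.ofReal_mul hB₁.le, hπuniv]
          simp only [he]
          ring
      _ ≤ _ := by
          refine lintegral_mono_ae ?_
          filter_upwards [hπae n] with q hq
          exact H₁ q.2 hq.2 q.1 ((hM _ hq.1).trans (le_abs_self M)) _ (by positivity)
            (pow_le_one₀ (by norm_num) (by norm_num))
  have hsecond : ∀ n, ∫⁻ ω, J n ω ^ 2 ∂P ≤ K * e n ^ 2 := by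
    intro n
    set T : Set (Ω × ((EuclideanSpace ℝ (Fin d) × (Fin N → ℝ)) ×
        (EuclideanSpace ℝ (Fin d) × (Fin N → ℝ)))) :=
      {q | (q.1, q.2.1) ∈ S n ∧ (q.1, q.2.2) ∈ S n} with hT
    have hTm : MeasurableSet T :=
      ((measurable_fst.prodMk (measurable_fst.comp measurable_snd)) (hSm n)).inter
        ((measurable_fst.prodMk (measurable_snd.comp measurable_snd)) (hSm n))
    have h1 : ∫⁻ ω, J n ω ^ 2 ∂P =
        ∫⁻ q, P {ω | ‖Z' q.1.2 ω - q.1.1‖ ≤ (1 / 2) ^ n ∧ ‖Z' q.2.2 ω - q.2.1‖ ≤ (1 / 2) ^ n}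
          ∂((π n).prod (π n)) := by
      have e1 := Measure.prod_apply (μ := P) (ν := (π n).prod (π n)) hTm
      have e2 := Measure.prod_apply_symm (μ := P) (ν := (π n).prod (π n)) hTm
      refine Eq.trans ?_ (e1.symm.trans e2)
      refine lintegral_congr fun ω => ?_
      have : Prod.mk ω ⁻¹' T = (Prod.mk ω ⁻¹' S n) ×ˢ (Prod.mk ω ⁻¹' S n) := by
        ext q; rfl
      rw [this, Measure.prod_prod, pow_two]
    rw [h1]
    calc _ ≤ ∫⁻ q, ENNReal.ofReal (B₂ * (((1 / 2) ^ n) ^ d) ^ 2) *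
          (ENNReal.ofReal (max ‖q.1.1 - q.2.1‖ ((1 / 2) ^ n) ^ (-β')) *
            edist q.1.2 q.2.2 ^ (-(α * (d - β')))) ∂((π n).prod (π n)) := by
          refine lintegral_mono_ae ?_
          filter_upwards [(Measure.quasiMeasurePreserving_fst (μ := π n) (ν := π n)).ae (hπae n),
            (Measure.quasiMeasurePreserving_snd (μ := π n) (ν := π n)).ae (hπae n)] with q hq1 hq2
          exact H₂ q.1.2 hq1.2 q.2.2 hq2.2 q.1.1 q.2.1 ((hM _ hq2.1).trans (le_abs_self M)) _
            (by positivity) (pow_le_one₀ (by norm_num) (by norm_num))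
      _ = ENNReal.ofReal (B₂ * (((1 / 2) ^ n) ^ d) ^ 2) *
          ∫⁻ q, (ENNReal.ofReal (max ‖q.1.1 - q.2.1‖ ((1 / 2) ^ n) ^ (-β')) *
            edist q.1.2 q.2.2 ^ (-(α * (d - β')))) ∂((π n).prod (π n)) :=
          lintegral_const_mul' _ _ ENNReal.ofReal_ne_top
      _ ≤ ENNReal.ofReal (B₂ * (((1 / 2) ^ n) ^ d) ^ 2) * (E₀ * frostmanCap d β 0 * I) := by
          gcongr
          have hm1 : Measurable fun q : (EuclideanSpace ℝ (Fin d) × (Fin N → ℝ)) ×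
              (EuclideanSpace ℝ (Fin d) × (Fin N → ℝ)) =>
              ENNReal.ofReal (max ‖q.1.1 - q.2.1‖ ((1 / 2) ^ n) ^ (-β')) *
                edist q.1.2 q.2.2 ^ (-(α * (d - β'))) := by
            fun_prop
          rw [lintegral_prod_symm _ hm1.aemeasurable]
          calc _ ≤ ∫⁻ _q, E₀ * I ∂(π n) := by
                refine lintegral_mono_ae ?_
                filter_upwards [hπae n] with q hq
                have hx : Measurable fun x : EuclideanSpace ℝ (Fin d) =>
                    ENNReal.ofReal (max ‖x - q.1‖ ((1 / 2) ^ n) ^ (-β')) := by fun_prop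
                have hu : Measurable fun u : Fin N → ℝ => edist u q.2 ^ (-(α * (d - β'))) := by
                  fun_prop
                rw [lintegral_prod_mul hx.aemeasurable hu.aemeasurable]
                refine mul_le_mul' ?_ (HI _ hq.2)
                simp_rw [norm_sub_rev _ q.1]
                exact HE n (μ n) (hμcap n) (hμk n) q.1
            _ = E₀ * I * μ n Set.univ := by
                rw [lintegral_const, hπuniv]
            _ ≤ E₀ * I * frostmanCap d β 0 := by gcongr; exact hμcap n
            _ = _ := by ring
      _ = _ := by
          rw [ENNReal.ofReal_mul hB₂.le, ENNReal.ofReal_pow (by positivity), hK, he]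
          ring
  -- uniform lower bound for the probability of near hits
  set p₀ : ℝ≥0∞ := (ENNReal.ofReal B₁ * c₀) ^ 2 / K with hp₀
  have hp₀pos : 0 < p₀ := by
    rw [hp₀]
    refine ENNReal.div_pos ?_ hKtop
    refine pow_ne_zero 2 (mul_ne_zero ?_ hc₀)
    simpa using hB₁
  have hprob : ∀ n, p₀ ≤ P {ω | J n ω ≠ 0} := by
    intro n
    have hen0 : e n ^ 2 ≠ 0 := by
      refine pow_ne_zero 2 ?_
      simp only [he, ne_eq, ENNReal.ofReal_eq_zero, not_le]
      positivity
    have hent : e n ^ 2 ≠ ∞ := ENNReal.pow_ne_top ENNReal.ofReal_ne_top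
    have h1 : (ENNReal.ofReal B₁ * c₀) ^ 2 * e n ^ 2 ≤ (K * P {ω | J n ω ≠ 0}) * e n ^ 2 := by
      calc (ENNReal.ofReal B₁ * c₀) ^ 2 * e n ^ 2 = (ENNReal.ofReal B₁ * c₀ * e n) ^ 2 := by ring
        _ ≤ (∫⁻ ω, J n ω ∂P) ^ 2 := by gcongr; exact hfirst n
        _ ≤ (∫⁻ ω, J n ω ^ 2 ∂P) * P {ω | J n ω ≠ 0} := sq_lintegral_le_mul_measure_ne_zero (hJm n)
        _ ≤ (K * e n ^ 2) * P {ω | J n ω ≠ 0} := by gcongr; exact hsecond n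
        _ = _ := by ring
    have h2 := (ENNReal.mul_le_mul_iff_left hen0 hent).1 h1
    rw [hp₀]
    exact ENNReal.div_le_of_le_mul' h2
  -- almost sure limit of near hits
  set G : ℕ → Set Ω := fun n => ⋃ k ≥ n, {ω | J k ω ≠ 0} with hG
  have hGm : ∀ n, MeasurableSet (G n) := fun n =>
    MeasurableSet.biUnion (Set.to_countable _) fun k _ => (hJm k (measurableSet_singleton 0)).compl
  have hGanti : Antitone G := fun a b hab =>
    Set.biUnion_subset_biUnion_left fun k (hk : k ≥ b) => hab.trans hk
  have hlim := tendsto_measure_iInter_atTop (μ := P) (fun n => (hGm n).nullMeasurableSet) hGanti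
    ⟨0, measure_ne_top P _⟩
  have hGp : p₀ ≤ P (⋂ n, G n) := by
    refine ge_of_tendsto' hlim fun n => (hprob n).trans (measure_mono ?_)
    exact Set.subset_biUnion_of_mem (u := fun k => {ω | J k ω ≠ 0}) (le_refl n)
  refine (hp₀pos.trans_le hGp).trans_le (measure_mono fun ω hω => ?_)
  have hnear : ∀ n : ℕ, ∃ q ∈ A ×ˢ Set.Icc (0 : Fin N → ℝ) 1, ‖Z' q.2 ω - q.1‖ ≤ (1 / 2) ^ n := by
    intro n
    obtain ⟨k, hk, hJk⟩ := Set.mem_iUnion₂.1 (Set.mem_iInter.1 hω n)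
    by_contra! hcon
    refine hJk ?_
    have : ∀ᵐ q ∂(π k), q ∉ Prod.mk ω ⁻¹' S k := by
      filter_upwards [hπae k] with q hq hqS
      have h1 : ‖Z' q.2 ω - q.1‖ ≤ (1 / 2) ^ k := hqS
      have h2 : (1 / 2 : ℝ) ^ k ≤ (1 / 2) ^ n :=
        pow_le_pow_of_le_one (by norm_num) (by norm_num) hk
      exact absurd (h1.trans h2) (not_le.2 (hcon q ⟨hq.1, hq.2⟩))
    exact measure_eq_zero_iff_ae_notMem.2 this
  have hcomp : IsCompact (A ×ˢ Set.Icc (0 : Fin N → ℝ) 1) := hA.prod isCompact_Icc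
  have hne : (A ×ˢ Set.Icc (0 : Fin N → ℝ) 1).Nonempty := by
    obtain ⟨q, hq, -⟩ := hnear 0
    exact ⟨q, hq⟩
  have hφ : Continuous fun q : EuclideanSpace ℝ (Fin d) × (Fin N → ℝ) => ‖Z' q.2 ω - q.1‖ :=
    (((hcont ω).comp continuous_snd).sub continuous_fst).norm
  -- The distance attains its minimum on the compact product; being below every `2⁻ⁿ`, the minimum
  -- is zero.
  obtain ⟨q, hq, hmin⟩ := hcomp.exists_isMinOn hne hφ.continuousOn
  have hzero : ‖Z' q.2 ω - q.1‖ ≤ 0 := by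
    refine ge_of_tendsto' (tendsto_pow_atTop_nhds_zero_of_lt_one (by norm_num : (0 : ℝ) ≤ 1 / 2)
      (by norm_num)) fun n => ?_
    obtain ⟨q', hq', hle⟩ := hnear n
    exact (hmin hq').trans hle
  have heq : Z' q.2 ω = q.1 := by
    rw [← sub_eq_zero]; exact norm_le_zero_iff.1 hzero
  exact ⟨q.2, hq.2, heq ▸ hq.1⟩

end UnitCubeField

/-! ### From cubes to the open orthant -/

/-- The open orthant is exhausted by countably many closed cubes. -/
lemma openOrthant_subset_iUnion_cubeParam (N : ℕ) :
    openOrthant N ⊆ ⋃ n : ℕ, cubeParam (1 / ((n : ℝ) + 1)) ((n : ℝ) + 1) '' Set.Icc 0 1 := by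
  intro t ht
  obtain ⟨n₁, h₁⟩ := exists_nat_gt (∑ k, (t k : ℝ))
  obtain ⟨n₂, h₂⟩ := exists_nat_gt (∑ k, 1 / (t k : ℝ))
  have hpos : ∀ k, 0 < (t k : ℝ) := fun k => ht k
  have hn0 : (0 : ℝ) < ((max n₁ n₂ : ℕ) : ℝ) + 1 := by positivity
  have hle₁ : (n₁ : ℝ) ≤ (max n₁ n₂ : ℕ) := by exact_mod_cast le_max_left _ _
  have hle₂ : (n₂ : ℝ) ≤ (max n₁ n₂ : ℕ) := by exact_mod_cast le_max_right _ _
  refine Set.mem_iUnion.2 ⟨max n₁ n₂, ?_⟩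
  set n : ℕ := max n₁ n₂ with hn
  have hk₁ : ∀ k, (t k : ℝ) ≤ n := fun k =>
    (Finset.single_le_sum (f := fun k => (t k : ℝ)) (fun i _ => (hpos i).le)
      (Finset.mem_univ k)).trans (h₁.le.trans hle₁)
  have hk₂ : ∀ k, 1 / ((n : ℝ) + 1) ≤ t k := by
    intro k
    have : 1 / (t k : ℝ) ≤ n :=
      (Finset.single_le_sum (f := fun k => 1 / (t k : ℝ)) (fun i _ => (one_div_pos.2 (hpos i)).le)
        (Finset.mem_univ k)).trans (h₂.le.trans hle₂)
    rw [one_div_le hn0 (hpos k)]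
    linarith
  refine ⟨fun k => ((t k : ℝ) - 1 / ((n : ℝ) + 1)) / ((n : ℝ) + 1), ⟨fun k => ?_, fun k => ?_⟩, ?_⟩
  · exact div_nonneg (sub_nonneg.2 (hk₂ k)) hn0.le
  · simp only [Pi.one_apply]
    rw [div_le_one hn0]
    have : 0 < 1 / ((n : ℝ) + 1) := by positivity
    linarith [hk₁ k]
  · funext k
    have : 1 / ((n : ℝ) + 1) + ((n : ℝ) + 1) * (((t k : ℝ) - 1 / ((n : ℝ) + 1)) / ((n : ℝ) + 1))
        = t k := by
      field_simp
      ring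
    simp only [cubeParam, this, Real.toNNReal_coe]

section fieldRange

variable {Ω : Type*} {N d : ℕ} (X : Param N → Ω → EuclideanSpace ℝ (Fin d))

lemma fieldRange_subset_iUnion (ω : Ω) :
    fieldRange X ω ⊆ ⋃ n : ℕ, (fun u => X (cubeParam (1 / ((n : ℝ) + 1)) ((n : ℝ) + 1) u) ω) ''
      Set.Icc 0 1 := by
  rintro _ ⟨t, ht, rfl⟩
  obtain ⟨n, u, hu, rfl⟩ := Set.mem_iUnion.1 (openOrthant_subset_iUnion_cubeParam N ht)
  exact Set.mem_iUnion.2 ⟨n, u, hu, rfl⟩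

lemma image_cubeParam_subset_fieldRange {a L : ℝ} (ha : 0 < a) (hL : 0 < L) (ω : Ω) :
    (fun u => X (cubeParam a L u) ω) '' Set.Icc 0 1 ⊆ fieldRange X ω := by
  rintro _ ⟨u, hu, rfl⟩
  exact ⟨_, paramCube_subset_openOrthant ha (cubeParam_mem ha hL hu), rfl⟩

end fieldRange

/-- A sequence of factors increasing to `1` lets estimates known only below a critical exponent be
intersected over countably many almost sure events. The shift by `2` keeps the factor positive at `n
= 0`. -/
lemma ofReal_le_of_forall_lt {x : ℝ} {y : ℝ≥0∞}
    (h : ∀ n : ℕ, ENNReal.ofReal (x * (1 - 1 / ((n : ℝ) + 2))) ≤ y) : ENNReal.ofReal x ≤ y := by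
  have hlim : Filter.Tendsto (fun n : ℕ => x * (1 - 1 / ((n : ℝ) + 2))) Filter.atTop (nhds x) := by
    have h1 : Filter.Tendsto (fun n : ℕ => 1 / ((n : ℝ) + 2)) Filter.atTop (nhds 0) :=
      tendsto_const_nhds.div_atTop
        (Filter.tendsto_atTop_add_const_right _ _ tendsto_natCast_atTop_atTop)
    simpa using (h1.const_sub 1).const_mul x
  exact le_of_tendsto' (ENNReal.tendsto_ofReal hlim) h

lemma le_ofReal_of_forall_lt {x : ℝ} {y : ℝ≥0∞}
    (h : ∀ n : ℕ, y ≤ ENNReal.ofReal (x / (1 - 1 / ((n : ℝ) + 2)))) : y ≤ ENNReal.ofReal x := by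
  have hlim : Filter.Tendsto (fun n : ℕ => x / (1 - 1 / ((n : ℝ) + 2))) Filter.atTop (nhds x) := by
    have h1 : Filter.Tendsto (fun n : ℕ => 1 / ((n : ℝ) + 2)) Filter.atTop (nhds 0) :=
      tendsto_const_nhds.div_atTop
        (Filter.tendsto_atTop_add_const_right _ _ tendsto_natCast_atTop_atTop)
    have h2 := (tendsto_const_nhds (x := x)).div (h1.const_sub 1) (by norm_num)
    rw [sub_zero, div_one] at h2
    exact h2
  exact ge_of_tendsto' (ENNReal.tendsto_ofReal hlim) h

lemma one_sub_one_div_add_two_mem (n : ℕ) :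
    (0 : ℝ) < 1 - 1 / ((n : ℝ) + 2) ∧ 1 - 1 / ((n : ℝ) + 2) < 1 := by
  have h1 : (0 : ℝ) < 1 / ((n : ℝ) + 2) := by positivity
  have h2 : 1 / ((n : ℝ) + 2) < 1 := by
    rw [div_lt_one (by positivity)]
    have : (0 : ℝ) ≤ n := n.cast_nonneg
    linarith
  constructor <;> linarith

theorem corollary3p4 {Ω : Type*} {m : MeasurableSpace Ω} (P : Measure Ω)
    [IsProbabilityMeasure P] [P.IsComplete] {N d : ℕ}
    (F : Filtration (Param N) m) (hF : IsCommutingFiltration P F)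
    (X : Param N → Ω → EuclideanSpace ℝ (Fin d)) (σ : Param N → Param N → ℝ)
    (hX : IsCenteredGaussianField P X σ) (hadapted : Adapted F X)
    (α γ : ℝ) (hα0 : 0 < α) (hα1 : α < 1) (hγ : α ≤ γ) (hN : 2 ≤ (N : ℝ) / α)
    (hA1 : HypA1 σ α γ) (hA2 : HypA2 P F X α γ) :
    HasStochasticCodim P (fieldRange X) (max ((d : ℝ) - (N : ℝ) / α) 0) ∧
      ((N : ℝ) / α < d →
        ∀ᵐ ω ∂P, dimH (fieldRange X ω) = ENNReal.ofReal ((N : ℝ) / α)) := by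
  have hNα : 0 < (N : ℝ) / α := by linarith
  have hN0 : (0 : ℝ) < N := (div_pos_iff_of_pos_right hα0).1 hNα
  -- In dimension zero every set has dimension `0`, so both hitting implications have false
  -- premises.
  rcases Nat.eq_zero_or_pos d with rfl | hd
  · have hmax : max (((0 : ℕ) : ℝ) - (N : ℝ) / α) 0 = 0 := by
      rw [max_eq_right]; push_cast; linarith
    refine ⟨⟨le_max_right _ _, by rw [hmax]; positivity, fun A _ => ?_⟩, fun h => ?_⟩
    · have hA0 : dimH A = 0 := dimH_subsingleton (Set.subsingleton_of_subsingleton)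
      rw [hmax, hA0]
      simp
    · push_cast at h; linarith
  have hcube : ∀ a L : ℝ, 0 < a → 0 < L → ∃ c C : ℝ,
      UnitCubeField P (fun u => X (cubeParam a L u))
        (fun u v => σ (cubeParam a L u) (cubeParam a L v)) α c C :=
    fun a L ha hL => UnitCubeField.of_field hd hX hadapted hα0 hγ hA1 ha hL
  have hn0 : ∀ n : ℕ, (0 : ℝ) < (n : ℝ) + 1 := fun n => by positivity
  obtain ⟨c₁, C₁, hZ₁⟩ := hcube 1 1 one_pos one_pos
  refine ⟨⟨le_max_right _ _, max_le (by linarith) (by positivity), fun A hA => ⟨fun h => ?_,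
    fun h => ?_⟩⟩, fun hdN => ?_⟩
  · obtain ⟨q, hq1, hq2⟩ := ENNReal.lt_iff_exists_nnreal_btwn.1 h
    have hβq : max ((d : ℝ) - N / α) 0 < q := by
      rwa [← ENNReal.ofReal_coe_nnreal, ENNReal.ofReal_lt_ofReal_iff_of_nonneg
        (le_max_right _ _)] at hq1
    obtain ⟨β', h1, h2⟩ := exists_between hβq
    have hμ : Measure.hausdorffMeasure (q : ℝ) A ≠ 0 := by
      rw [hausdorffMeasure_of_lt_dimH hq2]; exact ENNReal.top_ne_zero
    have hqd : (q : ℝ) ≤ d := by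
      have : dimH A ≤ (d : ℝ≥0∞) := by
        refine (dimH_mono (Set.subset_univ A)).trans ?_
        rw [Real.dimH_univ_eq_finrank, finrank_euclideanSpace, Fintype.card_fin]
      have := hq2.le.trans this
      exact_mod_cast this
    have hlow : (d : ℝ) - N / α < β' := (le_max_left _ _).trans_lt h1
    -- Choosing `β'` above `d - N / α` is exactly what makes the time kernel integrable.
    have hβN : α * (d - β') < N := by
      have : (d : ℝ) - β' < N / α := by linarith
      rw [lt_div_iff₀ hα0] at this
      linarith
    refine (hZ₁.measure_hit_pos hA ((le_max_right _ _).trans_lt h1) h2 hqd hβN hμ).trans_le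
      (measure_mono ?_)
    rintro ω ⟨u, hu, huA⟩
    exact ⟨_, image_cubeParam_subset_fieldRange X one_pos one_pos ω ⟨u, hu, rfl⟩, huA⟩
  · obtain ⟨s, hs1, hs2⟩ := ENNReal.lt_iff_exists_nnreal_btwn.1 h
    have hs2' : (s : ℝ) < max ((d : ℝ) - N / α) 0 := by
      rw [← ENNReal.ofReal_coe_nnreal] at hs2
      exact (ENNReal.ofReal_lt_ofReal_iff'.1 hs2).1
    have hs0 : (0 : ℝ) < s := by
      have : (0 : ℝ≥0∞) < s := bot_le.trans_lt hs1
      exact_mod_cast this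
    have hsd : (s : ℝ) < d - N / α := by
      rcases lt_max_iff.1 hs2' with h' | h'
      · exact h'
      · linarith
    have hds : 0 < (d : ℝ) - s := by linarith
    -- This `η` solves `d - N / η = s`; it is below `α` exactly because `s < d - N / α`.
    have hη : 0 < (N : ℝ) / (d - s) := by positivity
    have hηα : (N : ℝ) / (d - s) < α := by
      rw [div_lt_iff₀ hds, ← div_lt_iff₀' hα0]
      linarith
    have hηs : (d : ℝ) - N / (N / (d - s)) = s := by
      rw [div_div_cancel₀ hN0.ne']; ring
    have hμ : Measure.hausdorffMeasure ((d : ℝ) - N / (N / (d - s))) A = 0 := by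
      rw [hηs]; exact hausdorffMeasure_of_dimH_lt hs1
    refine measure_mono_null (t := ⋃ n : ℕ, {ω | ∃ u ∈ Set.Icc (0 : Fin N → ℝ) 1,
      X (cubeParam (1 / ((n : ℝ) + 1)) ((n : ℝ) + 1) u) ω ∈ A}) ?_
      (measure_iUnion_null fun n => ?_)
    · rintro ω ⟨x, hx, hxA⟩
      obtain ⟨n, u, hu, rfl⟩ := Set.mem_iUnion.1 (fieldRange_subset_iUnion X ω hx)
      exact Set.mem_iUnion.2 ⟨n, u, hu, hxA⟩
    · obtain ⟨c, C, hZ⟩ := hcube _ _ (one_div_pos.2 (hn0 n)) (hn0 n)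
      exact hZ.measure_hit_eq_zero hη hηα (by rw [hηs]; exact hs0) hμ
  · have hupper : ∀ k n : ℕ, ∀ᵐ ω ∂P,
        dimH ((fun u => X (cubeParam (1 / ((n : ℝ) + 1)) ((n : ℝ) + 1) u) ω) '' Set.Icc 0 1) ≤
          ENNReal.ofReal (N / α / (1 - 1 / ((k : ℝ) + 2))) := by
      intro k n
      obtain ⟨c, C, hZ⟩ := hcube _ _ (one_div_pos.2 (hn0 n)) (hn0 n)
      obtain ⟨hk0, hk1⟩ := one_sub_one_div_add_two_mem k
      rw [div_div]
      exact hZ.ae_dimH_image_le (mul_pos hα0 hk0) (mul_lt_of_lt_one_right hα0 hk1)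
    have hlower : ∀ k : ℕ, ∀ᵐ ω ∂P, ENNReal.ofReal (N / α * (1 - 1 / ((k : ℝ) + 2))) ≤
        dimH ((fun u => X (cubeParam 1 1 u) ω) '' Set.Icc 0 1) := by
      intro k
      obtain ⟨hk0, hk1⟩ := one_sub_one_div_add_two_mem k
      have hlt : (N : ℝ) / α * (1 - 1 / ((k : ℝ) + 2)) < N / α := mul_lt_of_lt_one_right hNα hk1
      -- The intermediate exponent provides the geometric gain over scales; it is at most `d`
      -- because `N / α < d`.
      obtain ⟨β', h1, h2⟩ := exists_between hlt
      refine hZ₁.ae_le_dimH_image (mul_pos hNα hk0) h1 (h2.trans hdN).le ?_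
      rw [lt_div_iff₀ hα0] at h2
      linarith
    filter_upwards [ae_all_iff.2 fun k => ae_all_iff.2 (hupper k), ae_all_iff.2 hlower]
      with ω hu hl
    refine le_antisymm (le_ofReal_of_forall_lt fun k => ?_) (ofReal_le_of_forall_lt fun k => ?_)
    · refine (dimH_mono (fieldRange_subset_iUnion X ω)).trans ?_
      rw [dimH_iUnion]
      exact iSup_le (hu k)
    · exact (hl k).trans (dimH_mono (image_cubeParam_subset_fieldRange X one_pos one_pos ω))
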